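/- **Setting.** Let $\hbar\neq 0$ and $u_0$ be complex numbers and let $\mathbb C[[\mathbf p]]$ be the space of formal power series in infinitely many variables $\mathbf p=(p_1,p_2,\dots)$. Put $s(t)=\frac{\sinh (t/2)}{t/2}$. The quantum Hamiltonians $\hat H_k$, $k\ge 0$, are the operators on $\mathbb C[[\mathbf p]]$ defined by the generating function $$ \frac1{2\pi\, s(\hbar^{1/2}z)}:\int_0^{2\pi} e^{\,z\, s(i\hbar^{1/2}z\,\partial_x)\,u(x)}\,dx:\;=\;1+\sum_{k\ge -1}\hat H_k\, z^{k+2},\qquad u(x)=u_0+\sum_{k\ge1}\Big(p_k e^{ikx}+\hbar k\tfrac{\partial}{\partial p_k}e^{-ikx}\Big), $$ where the normal ordering $:\ :$ puts all derivatives to the right of all multiplications by the $p_k$ (only integer powers of $\hbar$ occur). For a sequence $\mathbf t=(t_0,t_1,\dots)$ of complex numbers such that $\sum_{k\ge0}t_k\hat H_k f$ converges (absolutely) coefficientwise for every $f\in\mathbb C[[\mathbf p]]$ (for instance, any $\mathbf t$ with finitely many nonzero entries), the total SFT potential of the disk is $$ \Psi^{\rm disk}(\mathbf t,\mathbf p,u_0,\hbar)=\exp\Big(\frac1\hbar\sum_{k\ge0}t_k\hat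 H_k\Big)\,e^{p_1/\hbar}\in\mathbb C[[\mathbf p]], $$ i.e. the result of the Schrödinger evolution $\hbar\,\partial\Psi/\partial t_k=\hat H_k\Psi$ with initial value $\Psi|_{\mathbf t=0}=e^{p_1/\hbar}$. Let the polynomials $h_j$ be given by $\sum_{j\ge0}h_j(q_1,q_2,\dots)z^j=\exp\big(\sum_{k\ge1}q_kz^k/k\big)$. For a polynomial $P$ in $D=(D_1,D_2,\dots)$ the Hirota bilinear expression is $$P(D)\,\tau\cdot\tau=P\big(\tfrac{\partial}{\partial q_1},\tfrac{\partial}{\partial q_2},\dots\big)\big[\tau(\mathbf p+\mathbf q)\,\tau(\mathbf p-\mathbf q)\big]\Big|_{\mathbf q=0},$$ and we write $\tilde D=(D_1,2D_2,3D_3,\dots)$. **Corollary 1.6.** For every complex $\epsilon\ne0$, every complex $u_0$ and every $\mathbf t$ as above (with $\hbar=\epsilon^2$), the exponential series defining $\Psi^{\rm disk}(\mathbf t,\mathbf p,u_0,\epsilon^2)$ converges coefficientwise, and $\tau(\mathbf p,\epsilon)=\Psi^{\rm disk}(\mathbf t,\mathbf p,u_0,\epsilon^2)$ is a tau-function of the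 KP hierarchy in the sense that it satisfies the Hirota bilinear equations $$ \sum_{j\ge0}h_j(-2\mathbf y)\,h_{j+1}(\epsilon\tilde D)\,e^{\epsilon\sum_{k\ge1}y_kD_k}\,\tau\cdot\tau=0 $$ identically in the indeterminates $\mathbf y=(y_1,y_2,\dots)$, i.e. for the coefficient of every monomial in $\mathbf y$. -/

import Mathlib

open scoped PowerSeries Nat

noncomputable section

namespace DiskSFT

/-! Multi-indices `a = (a₁, a₂, …)` with finitely many nonzero entries are elements of
`ℕ+ →₀ ℕ`. Formal power series in the infinitely many variables `p₁, p₂, …` are elements of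
`MvPowerSeries ℕ+ ℂ`; this is the completion of the bosonic Fock space. -/

/-- The weight `∑ k a_k` of a multi-index, i.e. the degree of `∏ p_k ^ a_k` when `deg p_k = k`. -/
def wt (a : ℕ+ →₀ ℕ) : ℕ := a.sum fun k n => (k : ℕ) * n

/-- The finite set of all multi-indices of weight `n`. -/
def multiIndices (n : ℕ) : Finset (ℕ+ →₀ ℕ) :=
  {a ∈ ((Finset.range n).image Nat.succPNat).finsupp (fun _ => Finset.range (n + 1)) | wt a = n}

theorem mem_multiIndices {n : ℕ} {a : ℕ+ →₀ ℕ} : a ∈ multiIndices n ↔ wt a = n := by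
  classical
  refine ⟨fun h => (Finset.mem_filter.1 h).2, fun h => Finset.mem_filter.2 ⟨?_, h⟩⟩
  have key : ∀ k ∈ a.support, (k : ℕ) * a k ≤ n := fun k hk => by
    rw [← h]
    exact Finset.single_le_sum (f := fun k : ℕ+ => (k : ℕ) * a k)
      (fun _ _ => Nat.zero_le _) hk
  rw [Finset.mem_finsupp_iff]
  refine ⟨fun k hk => ?_, fun k _ => ?_⟩
  · have h1 := key k hk
    have h2 : 1 ≤ a k := Nat.one_le_iff_ne_zero.2 (Finsupp.mem_support_iff.1 hk)
    have h3 : (k : ℕ) ≤ n := le_trans (Nat.le_mul_of_pos_right _ h2) h1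
    refine Finset.mem_image.2 ⟨(k : ℕ) - 1, ?_, ?_⟩
    · have := k.pos
      exact Finset.mem_range.2 (by omega)
    · exact PNat.succPNat_natPred k
  · rw [Finset.mem_range]
    by_cases hk : k ∈ a.support
    · have h1 := key k hk
      have h3 : a k ≤ (k : ℕ) * a k := Nat.le_mul_of_pos_left _ k.pos
      omega
    · rw [Finsupp.notMem_support_iff.1 hk]
      omega

/-- The coefficients of the exponential of a linear form:
`exp (∑ c_k x_k) = ∑_a (∏_k c_k ^ a_k / a_k !) x^a`. -/
def expLin {A : Type*} [CommRing A] [Algebra ℂ A] (c : ℕ+ → A) : MvPowerSeries ℕ+ A :=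
  fun a => a.prod fun k n => ((n ! : ℂ)⁻¹) • c k ^ n

/-- The value `h_j(q)` of the polynomial `h_j` given by `∑_j h_j(q) z^j = exp (∑_k q_k z^k / k)`,
at a sequence `q₁, q₂, …` of elements of a commutative algebra. -/
def h {A : Type*} [CommRing A] [Algebra ℂ A] (j : ℕ) (q : ℕ+ → A) : A :=
  ∑ a ∈ multiIndices j, MvPowerSeries.coeff a (expLin fun k => ((k : ℂ)⁻¹) • q k)

/-- The partial derivative `∂^a = ∏_k (∂/∂p_k) ^ a_k` of a formal power series. -/
def partialDeriv (a : ℕ+ →₀ ℕ) (f : MvPowerSeries ℕ+ ℂ) : MvPowerSeries ℕ+ ℂ :=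
  fun m => (a.prod fun k n => (((m k + n).descFactorial n : ℕ) : ℂ)) *
    MvPowerSeries.coeff (m + a) f

theorem partialDeriv_zero (f : MvPowerSeries ℕ+ ℂ) : partialDeriv 0 f = f := by
  ext m
  simp [partialDeriv, MvPowerSeries.coeff_apply]

theorem partialDeriv_add_single (a : ℕ+ →₀ ℕ) (k : ℕ+) (f : MvPowerSeries ℕ+ ℂ) :
    partialDeriv (a + Finsupp.single k 1) f = MvPowerSeries.pderiv ℂ k (partialDeriv a f) := by
  classical
  ext m
  rw [MvPowerSeries.coeff_pderiv]
  simp only [partialDeriv, MvPowerSeries.coeff_apply]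
  have e : m + (a + Finsupp.single k 1) = m + Finsupp.single k 1 + a := by abel
  rw [e]
  set s : Finset ℕ+ := insert k a.support with hs
  have hk : k ∈ s := Finset.mem_insert_self _ _
  have h1 : (a + Finsupp.single k 1).support ⊆ s := fun i hi => by
    by_contra hc
    rw [hs, Finset.mem_insert, not_or] at hc
    simp [Ne.symm hc.1] at hi
    exact hc.2 (Finsupp.mem_support_iff.2 hi)
  have h2 : a.support ⊆ s := Finset.subset_insert _ _
  rw [Finsupp.prod_of_support_subset _ h1 _ (by simp),
    Finsupp.prod_of_support_subset _ h2 _ (by simp),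
    ← Finset.mul_prod_erase s _ hk, ← Finset.mul_prod_erase s _ hk]
  have h3 : ∀ i ∈ s.erase k,
      (((m i + (a + Finsupp.single k 1 : ℕ+ →₀ ℕ) i).descFactorial
        ((a + Finsupp.single k 1 : ℕ+ →₀ ℕ) i) : ℕ) : ℂ) =
      ((((m + Finsupp.single k 1 : ℕ+ →₀ ℕ) i + a i).descFactorial (a i) : ℕ) : ℂ) := by
    intro i hi
    simp [Ne.symm (Finset.ne_of_mem_erase hi)]
  rw [Finset.prod_congr rfl h3]
  have h4 : (m k + (a k + 1)).descFactorial (a k + 1) =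
      (m k + 1 + a k).descFactorial (a k) * (m k + 1) := by
    rw [Nat.descFactorial_succ, mul_comm, show m k + (a k + 1) = m k + 1 + a k by ring]
    congr 1
    omega
  simp only [Finsupp.add_apply, Finsupp.single_eq_same, h4]
  push_cast
  ring

/-! ### The quantum Hamiltonians -/

/-- With `s(t) = sinh (t/2) / (t/2) = ∑ t^(2n) / (2^(2n) (2n+1)!)`, this is the power series
`s(w^(1/2) z)` in `z`; only integer powers of `w` occur. -/
def sSeries (w : ℂ) : ℂ⟦X⟧ :=
  PowerSeries.mk fun n => if Even n then w ^ (n / 2) / (2 ^ n * ((n + 1)! : ℂ)) else 0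

/-- The power series in `z` that multiplies `p^a ∏_k (ħ k ∂/∂p_k)^(b_k)` in the normally ordered
generating function
`(2π s(ħ^(1/2) z))⁻¹ : ∫_0^{2π} exp (z s(i ħ^(1/2) z ∂_x) u(x)) dx :`,
where `u(x) = u₀ + ∑_{k ≥ 1} (q_k e^{ikx} + p_k e^{-ikx})` and `a`, `b` have the same weight. Since
`s` is even, `s(i ħ^(1/2) z ∂_x)` multiplies `e^{±ikx}` by `s(ħ^(1/2) z k)`, and the integral
picks out the terms in which the weights of `a` and `b` agree. -/
def hamSymbol (u₀ ħ : ℂ) (a b : ℕ+ →₀ ℕ) : ℂ⟦X⟧ :=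
  PowerSeries.rescale u₀ (PowerSeries.exp ℂ) * (sSeries ħ)⁻¹ *
    MvPowerSeries.coeff a (expLin fun k => PowerSeries.X * sSeries (ħ * (k : ℂ) ^ 2)) *
    MvPowerSeries.coeff b (expLin fun k => PowerSeries.X * sSeries (ħ * (k : ℂ) ^ 2))

/-- The operator `∏_k (ħ k ∂/∂p_k)^(b_k)`. -/
def momentum (ħ : ℂ) (b : ℕ+ →₀ ℕ) (f : MvPowerSeries ℕ+ ℂ) : MvPowerSeries ℕ+ ℂ :=
  (b.prod fun k n => (ħ * (k : ℂ)) ^ n) • partialDeriv b f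

/-- The quantum Hamiltonian `Ĥ_n`, the coefficient of `z^(n+2)` in the generating function, as an
operator on formal power series in `p₁, p₂, …`:
`Ĥ_n f = ∑_{wt a = wt b} [z^(n+2)] hamSymbol a b · p^a ∏_k (ħ k ∂/∂p_k)^(b_k) f`.
Only finitely many terms contribute to the coefficient of a given monomial `p^m`. -/
def hamiltonian (u₀ ħ : ℂ) (n : ℕ) (f : MvPowerSeries ℕ+ ℂ) : MvPowerSeries ℕ+ ℂ :=
  fun m => ∑ ac ∈ Finset.HasAntidiagonal.antidiagonal m, ∑ b ∈ multiIndices (wt ac.1),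
    PowerSeries.coeff (n + 2) (hamSymbol u₀ ħ ac.1 b) *
      MvPowerSeries.coeff ac.2 (momentum ħ b f)

/-! ### The potential of the disk -/

/-- The plane wave `exp (p₁ / ħ)`, the potential of the disk at `t = 0`. -/
def planeWave (ħ : ℂ) : MvPowerSeries ℕ+ ℂ :=
  expLin fun k => if k = 1 then ħ⁻¹ else 0

/-- The series `∑_k t_k Ĥ_k` converges (coefficientwise, on every formal power series). This holds
in particular when only finitely many `t_k` are nonzero. -/
def Admissible (u₀ ħ : ℂ) (t : ℕ → ℂ) : Prop :=
  ∀ (f : MvPowerSeries ℕ+ ℂ) (m : ℕ+ →₀ ℕ),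
    Summable fun k => t k * MvPowerSeries.coeff m (hamiltonian u₀ ħ k f)

theorem admissible_of_finite (u₀ ħ : ℂ) (t : ℕ → ℂ) (ht : t.support.Finite) :
    Admissible u₀ ħ t := fun f m =>
  summable_of_hasFiniteSupport (ht.subset fun k hk => by
    rw [Function.mem_support] at hk ⊢
    exact left_ne_zero_of_mul hk)

/-- The operator `ħ⁻¹ ∑_{k ≥ 0} t_k Ĥ_k`. -/
def evolution (u₀ ħ : ℂ) (t : ℕ → ℂ) (f : MvPowerSeries ℕ+ ℂ) : MvPowerSeries ℕ+ ℂ :=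
  fun m => ħ⁻¹ * ∑' k, t k * MvPowerSeries.coeff m (hamiltonian u₀ ħ k f)

/-- The coefficient of `p^m` in the `N`-th term of the series
`exp (ħ⁻¹ ∑_k t_k Ĥ_k) e^{p₁/ħ} = ∑_N (1/N!) (ħ⁻¹ ∑_k t_k Ĥ_k)^N e^{p₁/ħ}`. -/
def potentialTerm (u₀ ħ : ℂ) (t : ℕ → ℂ) (m : ℕ+ →₀ ℕ) (N : ℕ) : ℂ :=
  (N ! : ℂ)⁻¹ * MvPowerSeries.coeff m ((evolution u₀ ħ t)^[N] (planeWave ħ))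

/-- The total potential of the disk, `Ψ = exp (ħ⁻¹ ∑_{k ≥ 0} t_k Ĥ_k) e^{p₁/ħ}`. -/
def diskPotential (u₀ ħ : ℂ) (t : ℕ → ℂ) : MvPowerSeries ℕ+ ℂ :=
  fun m => ∑' N, potentialTerm u₀ ħ t m N

/-! ### The bilinear equations of the KP hierarchy -/

/-- The expansion `τ(p + c q) = ∑_a (c^|a| / a!) (∂^a τ)(p) q^a` in powers of `q = (q₁, q₂, …)`. -/
def shift (c : ℂ) (τ : MvPowerSeries ℕ+ ℂ) : MvPowerSeries ℕ+ (MvPowerSeries ℕ+ ℂ) :=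
  fun a => (a.prod fun _ n => c ^ n / (n ! : ℂ)) • partialDeriv a τ

/-- The Hirota bilinear expression `P(D) τ·τ = P(∂/∂q) [τ(p + q) τ(p - q)]` at `q = 0`, for a
polynomial `P` in `D₁, D₂, …`. -/
def hirota (P : MvPolynomial ℕ+ ℂ) (τ : MvPowerSeries ℕ+ ℂ) : MvPowerSeries ℕ+ ℂ :=
  ∑ a ∈ P.support, (MvPolynomial.coeff a P * (a.prod fun _ n => (n ! : ℂ))) •
    MvPowerSeries.coeff a (shift 1 τ * shift (-1) τ)

/-- The coefficient of `y^m` in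
`∑_{j ≥ 0} h_j(-2y) h_{j+1}(ε D₁, 2 ε D₂, 3 ε D₃, …) exp (ε ∑_k y_k D_k)`,
a polynomial in `D₁, D₂, …`. All monomials of `h_j(-2y)` have weight `j`, so the terms with
`j > wt m` do not contribute. -/
def kpOperator (ε : ℂ) (m : ℕ+ →₀ ℕ) : MvPolynomial ℕ+ ℂ :=
  ∑ j ∈ Finset.range (wt m + 1), MvPowerSeries.coeff m
    (h j (fun k => (-2 : ℂ) • (MvPowerSeries.X k : MvPowerSeries ℕ+ (MvPolynomial ℕ+ ℂ))) *
      MvPowerSeries.C (h (j + 1) fun k => (ε * (k : ℂ)) • (MvPolynomial.X k : MvPolynomial ℕ+ ℂ)) *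
      expLin fun k => ε • (MvPolynomial.X k : MvPolynomial ℕ+ ℂ))

/-- The bilinear equations of the KP hierarchy
`∑_{j ≥ 0} h_j(-2y) h_{j+1}(ε D̃) exp (ε ∑_k y_k D_k) τ·τ = 0`,
as an identity of formal power series in the indeterminates `y₁, y₂, …`. -/
def SatisfiesKP (ε : ℂ) (τ : MvPowerSeries ℕ+ ℂ) : Prop :=
  ∀ m : ℕ+ →₀ ℕ, hirota (kpOperator ε m) τ = 0

end DiskSFT

end

/-! Since `ε D_k` acts on the factor `exp (ε ∑ y_k D_k)` as `∂/∂y_k`, the KP equations say that `τ(x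
+ εy) τ(x - εy)` is killed by the single operator `B = ∑_j h_j(-2y) h_{j+1}(∂_{y_1}, 2∂_{y_2}, …)`;
this is `satisfiesKP_iff`. It remains to see that the kernel of `B` contains the pairing of the
plane wave with itself and survives the evolution.

Put `r = exp (εz/2)` and `s = exp (-εz/2)`. Because `k z s(kεz) = (r^k - s^k)/ε`, each Hamiltonian
is a coefficient in `z` of a scalar series times `V = ∑_i V_i`, where `V_i` is the product of the
degree `i` parts of the exponentials of `∑ (r^k - s^k) p_k/(εk)` and `∑ ε (r^k - s^k) ∂_k`. Let `V`
and `V'` be its copies acting on the two factors of the pairing. The heart of the proof is the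
intertwining relation `B (V + V') = (s² V + r² V') B` (`Heisenberg.commutator`), which makes the
kernel of `B` stable under `H ⊗ 1 + 1 ⊗ H`.

To prove it, normally order `B V` and `s² V B`. The contraction factors are the expansions at zero
and at infinity of one rational function, so their difference is a formal delta function
(`hop_pow_sub_pow_combination`). The remaining normally ordered products then factor into a creation
part and an annihilation part. Exchanging the two factors gives the same products with the opposite
scalar, and the two contributions cancel.

`B` and `V` are infinite sums, so the relation is proved modulo series of order at least `N`, for
every `N`. The Hamiltonians preserve the weight and every weight space is finite dimensional; hence
the exponential converges. All maps are continuous coefficientwise, so the kernel condition passes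
to the sum over the times and, through the binomial theorem for `H ⊗ 1 + 1 ⊗ H` and the Cauchy
product, to the exponential. At time zero the pairing does not depend on `y`, and every term of `B`
contains a `y`-derivative. -/

noncomputable section

namespace DiskSFT

set_option linter.unusedSectionVars false

open Finset hiding mk antidiagonal mem_antidiagonal
open Finset.HasAntidiagonal hiding mk
open PowerSeries

/-! ### Complete homogeneous elements of noncommutative algebras and normal ordering. -/

section Hop

variable {A : Type*} [Ring A] [Algebra ℂ A]

/-- The complete homogeneous elements attached to a sequence `q₁, q₂, …` in a (noncommutative)
algebra: `n h_n = ∑_{k=1}^n q_k h_{n-k}`. For commuting `q_k` these are the coefficients of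
`exp (∑ q_k x^k / k)`. -/
def hop (q : ℕ+ → A) : ℕ → A
  | 0 => 1
  | n + 1 => ((n + 1 : ℂ)⁻¹) • ∑ i : Fin (n + 1), q (Nat.succPNat i) * hop q (n - i)
decreasing_by omega

theorem hop_zero (q : ℕ+ → A) : hop q 0 = 1 := by rw [hop]

theorem hop_succ (q : ℕ+ → A) (n : ℕ) :
    hop q (n + 1) = ((n + 1 : ℂ)⁻¹) •
      ∑ x ∈ antidiagonal n, q (Nat.succPNat x.1) * hop q x.2 := by
  rw [hop, Finset.Nat.sum_antidiagonal_eq_sum_range_succ (fun i j => q (Nat.succPNat i) * hop q j),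
    Finset.sum_range]

theorem succ_smul_hop (q : ℕ+ → A) (n : ℕ) :
    (n + 1 : ℂ) • hop q (n + 1) =
      ∑ x ∈ antidiagonal n, q (Nat.succPNat x.1) * hop q x.2 := by
  rw [hop_succ, smul_inv_smul₀]
  exact_mod_cast Nat.succ_ne_zero n

theorem snd_lt_succ {n : ℕ} {x : ℕ × ℕ} (hx : x ∈ antidiagonal n) : x.2 < n + 1 := by
  have := mem_antidiagonal.1 hx
  omega

/-- The recursion is the differential equation of the exponential generating series; identities for
`hop` are proved below by checking it for a candidate. -/
theorem hop_unique (q : ℕ+ → A) (f : ℕ → A) (h0 : f 0 = 1)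
    (hs : ∀ n : ℕ, (n + 1 : ℂ) • f (n + 1) =
      ∑ x ∈ antidiagonal n, q (Nat.succPNat x.1) * f x.2) : f = hop q := by
  funext n
  induction n using Nat.strong_induction_on with
  | _ n ih =>
    cases n with
    | zero => rw [h0, hop_zero]
    | succ n =>
      have h : (n + 1 : ℂ) ≠ 0 := by exact_mod_cast Nat.succ_ne_zero n
      rw [← inv_smul_smul₀ h (f (n + 1)), hs, hop_succ]
      congr 1
      exact sum_congr rfl fun x hx => by rw [ih x.2 (snd_lt_succ hx)]

/-- Any relation between two algebras that holds for the generators and is compatible with the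
operations holds for the complete homogeneous elements. -/
theorem hop_rel {A' : Type*} [Ring A'] [Algebra ℂ A'] (S : Set (A × A')) (q : ℕ+ → A)
    (q' : ℕ+ → A') (h1 : (1, 1) ∈ S)
    (hadd : ∀ x ∈ S, ∀ y ∈ S, x + y ∈ S) (h0 : (0, 0) ∈ S)
    (hsmul : ∀ (c : ℂ), ∀ x ∈ S, c • x ∈ S)
    (hq : ∀ k, ∀ x ∈ S, (q k, q' k) * x ∈ S) (n : ℕ) : (hop q n, hop q' n) ∈ S := by
  induction n using Nat.strong_induction_on with
  | _ n ih =>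
    cases n with
    | zero => rw [hop_zero, hop_zero]; exact h1
    | succ n =>
      rw [hop_succ, hop_succ]
      have : ∀ s : Finset (ℕ × ℕ), s ⊆ antidiagonal n →
          (∑ x ∈ s, q (Nat.succPNat x.1) * hop q x.2,
            ∑ x ∈ s, q' (Nat.succPNat x.1) * hop q' x.2) ∈ S := by
        intro s
        induction s using Finset.induction_on with
        | empty => intro; simpa using h0
        | insert a s ha ihs =>
          intro hsub
          rw [sum_insert ha, sum_insert ha]
          have hm := ih a.2 (snd_lt_succ (hsub (mem_insert_self _ _)))
          exact hadd _ (hq (Nat.succPNat a.1) _ hm) _ (ihs fun x hx => hsub (mem_insert_of_mem hx))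
      exact hsmul _ _ (this _ subset_rfl)

theorem mul_hop_eq_hop_mul {q q' : ℕ+ → A} {x : A} (h : ∀ k, x * q k = q' k * x) (n : ℕ) :
    x * hop q n = hop q' n * x := by
  refine hop_rel {p : A × A | x * p.1 = p.2 * x} q q' (by simp) ?_ (by simp) ?_ ?_ n
  · rintro a ha b hb
    simp only [Set.mem_ofPred_eq, Prod.fst_add, Prod.snd_add, mul_add, add_mul] at *
    rw [ha, hb]
  · intro c a ha
    simp only [Set.mem_ofPred_eq, Prod.smul_fst, Prod.smul_snd, mul_smul_comm, smul_mul_assoc] at *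
    rw [ha]
  · intro k a ha
    simp only [Set.mem_ofPred_eq, Prod.fst_mul, Prod.snd_mul] at *
    rw [← mul_assoc, h, mul_assoc, ha, mul_assoc]

theorem commute_hop {q : ℕ+ → A} {x : A} (h : ∀ k, Commute x (q k)) (n : ℕ) :
    Commute x (hop q n) := mul_hop_eq_hop_mul h n

theorem commute_hop_hop {q q' : ℕ+ → A} (h : ∀ k l, Commute (q k) (q' l)) (m n : ℕ) :
    Commute (hop q m) (hop q' n) :=
  (commute_hop (fun l => (commute_hop (fun k => (h k l).symm) m).symm) n)

/-- Weighted homogeneity: `h_n` has degree `n` when `q_k` has degree `k`. -/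
theorem hop_pow_mul {t : A} {q : ℕ+ → A} (h : ∀ k, Commute t (q k)) (n : ℕ) :
    hop (fun k => t ^ (k : ℕ) * q k) n = t ^ n * hop q n := by
  refine (congrFun (hop_unique _ (fun n => t ^ n * hop q n) (by simp [hop_zero]) fun n => ?_) n).symm
  rw [← mul_smul_comm, succ_smul_hop, mul_sum]
  refine sum_congr rfl fun x hx => ?_
  have hx := mem_antidiagonal.1 hx
  rw [show t ^ (n + 1) = t ^ (Nat.succPNat x.1 : ℕ) * t ^ x.2 by
    rw [← pow_add, Nat.succPNat_coe]; congr 1; omega]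
  rw [mul_assoc, mul_assoc]
  congr 1
  rw [← mul_assoc, ← mul_assoc, ((h _).pow_left x.2).eq]

theorem hop_smul_pow {R : Type*} [CommRing R] [Algebra R A]
    (t : R) (q : ℕ+ → A) (n : ℕ) :
    hop (fun k => t ^ (k : ℕ) • q k) n = t ^ n • hop q n := by
  have := hop_pow_mul (t := algebraMap R A t) (q := q) (fun k => Algebra.commutes t _) n
  simpa only [← map_pow, ← Algebra.smul_def] using this

theorem map_hop {A' : Type*} [Ring A'] [Algebra ℂ A'] (g : A →+* A')
    (hg : ∀ (c : ℂ) (x : A), g (c • x) = c • g x) (q : ℕ+ → A) (n : ℕ) :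
    g (hop q n) = hop (fun k => g (q k)) n := by
  refine hop_rel {p : A × A' | g p.1 = p.2} q _ (by simp) ?_ (by simp) ?_ ?_ n
  · rintro a ha b hb
    simp_all
  · intro c a ha
    simp_all
  · intro k a ha
    simp_all

theorem hop_zero_fun (n : ℕ) : hop (0 : ℕ+ → A) n = if n = 0 then 1 else 0 := by
  cases n with
  | zero => simp [hop_zero]
  | succ n => simp [hop_succ]

/-- Power series with commuting coefficients commute. -/
theorem commute_of_coeff {A : Type*} [Semiring A] {f g : A⟦X⟧}
    (h : ∀ m n, Commute (coeff m f) (coeff n g)) : Commute f g := by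
  ext n
  rw [coeff_mul, coeff_mul, ← Finset.Nat.sum_antidiagonal_swap]
  exact sum_congr rfl fun x _ => (h _ _).eq

/-- The exponential of a sum is the product of the exponentials. Splitting `n + 1` as the sum of the
two degrees is the Leibniz rule for the Euler derivation, so the product satisfies the recursion for
`q + q'`. Commutation is needed only between the two families, to move `Q'` past `F`. -/
theorem hop_add {q q' : ℕ+ → A} (h : ∀ k l, Commute (q k) (q' l)) (n : ℕ) :
    hop (fun k => q k + q' k) n = ∑ x ∈ antidiagonal n, hop q x.1 * hop q' x.2 := by
  refine (congrFun (hop_unique _ (fun n => ∑ x ∈ antidiagonal n, hop q x.1 * hop q' x.2)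
    (by simp [hop_zero]) fun n => ?_) n).symm
  set F : A⟦X⟧ := mk (hop q) with hF
  set G : A⟦X⟧ := mk (hop q') with hG
  set Q : A⟦X⟧ := mk fun n => q (Nat.succPNat n) with hQ
  set Q' : A⟦X⟧ := mk fun n => q' (Nat.succPNat n) with hQ'
  have hc : Commute F Q' := commute_of_coeff fun m n => by
    rw [hF, hQ', coeff_mk, coeff_mk]
    exact (commute_hop (fun k => (h k _).symm) m).symm
  have e1 : (n + 1 : ℂ) • ∑ x ∈ antidiagonal (n + 1), hop q x.1 * hop q' x.2 =
      ∑ x ∈ antidiagonal (n + 1), (x.1 : ℂ) • (hop q x.1 * hop q' x.2) +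
      ∑ x ∈ antidiagonal (n + 1), (x.2 : ℂ) • (hop q x.1 * hop q' x.2) := by
    rw [smul_sum, ← sum_add_distrib]
    refine sum_congr rfl fun x hx => ?_
    rw [← add_smul]
    congr 1
    have := mem_antidiagonal.1 hx
    exact_mod_cast this.symm
  have e2 : ∑ x ∈ antidiagonal (n + 1), (x.1 : ℂ) • (hop q x.1 * hop q' x.2) =
      coeff n (Q * F * G) := by
    rw [Finset.Nat.sum_antidiagonal_succ, coeff_mul]
    simp only [Nat.cast_zero, zero_smul, zero_add, Nat.cast_add, Nat.cast_one]
    refine sum_congr rfl fun x _ => ?_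
    rw [← smul_mul_assoc, succ_smul_hop, coeff_mul, hG, coeff_mk]
    simp only [hQ, hF, coeff_mk]
  have e3 : ∑ x ∈ antidiagonal (n + 1), (x.2 : ℂ) • (hop q x.1 * hop q' x.2) =
      coeff n (F * (Q' * G)) := by
    rw [Finset.Nat.sum_antidiagonal_succ', coeff_mul]
    simp only [Nat.cast_zero, zero_smul, zero_add, Nat.cast_add, Nat.cast_one]
    refine sum_congr rfl fun x _ => ?_
    rw [← mul_smul_comm, succ_smul_hop, coeff_mul, hF, coeff_mk]
    simp only [hQ', hG, coeff_mk]
  rw [e1, e2, e3, ← mul_assoc, hc.eq, ← map_add, ← add_mul, ← add_mul, mul_assoc, coeff_mul]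
  simp only [map_add, hQ, hQ', coeff_mk, coeff_mul, hF, hG]

theorem sum_antidiagonal_shift (f g : ℕ → A) (l n : ℕ) :
    ∑ x ∈ antidiagonal n, f x.1 * (if l ≤ x.2 then g (x.2 - l) else 0) =
      if l ≤ n then ∑ x ∈ antidiagonal (n - l), f x.1 * g x.2 else 0 := by
  have h : (mk f : A⟦X⟧) * (X ^ l * mk g) = X ^ l * (mk f * mk g) := by
    rw [← mul_assoc, ← mul_assoc, ((commute_X (mk f)).pow_right l).eq]
  have h2 := congrArg (coeff n) h
  rw [coeff_X_pow_mul', coeff_mul, coeff_mul] at h2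
  simpa only [coeff_X_pow_mul', coeff_mk] using h2

/-- If `[D, q_k] = 0` for `k ≠ l` and `[D, q_l] = l v` with `v` central, then
`[D, h_n] = v h_{n-l}`. -/
theorem mul_hop_of_commutator {q : ℕ+ → A} {d v : A} {l : ℕ+}
    (hl : d * q l = q l * d + ((l : ℕ) : ℂ) • v)
    (h : ∀ k, k ≠ l → Commute d (q k)) (hv : ∀ k, Commute v (q k)) (n : ℕ) :
    d * hop q n = hop q n * d + if (l : ℕ) ≤ n then v * hop q (n - l) else 0 := by
  induction n using Nat.strong_induction_on with
  | _ n ih =>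
    cases n with
    | zero => simp [hop_zero]
    | succ n =>
      have hn : (n + 1 : ℂ) ≠ 0 := by exact_mod_cast Nat.succ_ne_zero n
      rw [← smul_right_inj hn, ← mul_smul_comm, smul_add, ← smul_mul_assoc, succ_smul_hop, mul_sum,
        sum_mul]
      have e1 : ∀ x ∈ antidiagonal n, d * (q (Nat.succPNat x.1) * hop q x.2) =
          q (Nat.succPNat x.1) * hop q x.2 * d +
          q (Nat.succPNat x.1) * (if (l : ℕ) ≤ x.2 then v * hop q (x.2 - l) else 0) +
          (if Nat.succPNat x.1 = l then ((l : ℕ) : ℂ) • v * hop q x.2 else 0) := by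
        intro x hx
        have h1 : d * q (Nat.succPNat x.1) = q (Nat.succPNat x.1) * d +
            if Nat.succPNat x.1 = l then ((l : ℕ) : ℂ) • v else 0 := by
          split_ifs with hk
          · rw [hk, hl]
          · rw [add_zero, (h _ hk).eq]
        rw [← mul_assoc, h1, add_mul, mul_assoc, ih x.2 (snd_lt_succ hx), mul_add, ite_mul, zero_mul,
          mul_assoc]
      rw [sum_congr rfl e1, sum_add_distrib, sum_add_distrib, add_assoc]
      congr 1
      have e2 := sum_antidiagonal_shift (fun i => q (Nat.succPNat i)) (fun j => v * hop q j) l n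
      rw [e2]
      by_cases hln : (l : ℕ) ≤ n + 1
      · rw [if_pos hln]
        have e3 : ∑ x ∈ antidiagonal n, (if Nat.succPNat x.1 = l then ((l : ℕ) : ℂ) • v * hop q x.2
            else 0) = ((l : ℕ) : ℂ) • v * hop q (n + 1 - l) := by
          have hl0 := l.pos
          rw [sum_eq_single ((l : ℕ) - 1, n + 1 - l)]
          · rw [if_pos]
            exact PNat.succPNat_natPred l
          · rintro ⟨a, b⟩ hx hne
            rw [if_neg]
            rintro rfl
            have := mem_antidiagonal.1 hx
            apply hne
            simp only [Nat.succPNat_coe, Prod.mk.injEq] at *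
            omega
          · intro hx
            exact absurd (mem_antidiagonal.2 (by simp only; omega)) hx
        rw [e3]
        split_ifs with hln'
        -- With `n = l + b`, the recursion for `h_{b+1}` contributes the factor `b + 1` and the
        -- contraction of `d` with `q_l` contributes `l`; together they make `n + 1`.
        · obtain ⟨b, rfl⟩ := Nat.exists_eq_add_of_le hln'
          have e4 : ∑ x ∈ antidiagonal ((l : ℕ) + b - l), q (Nat.succPNat x.1) * (v * hop q x.2) =
              v * ((b + 1 : ℂ) • hop q (b + 1)) := by
            rw [Nat.add_sub_cancel_left, succ_smul_hop, mul_sum]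
            refine sum_congr rfl fun x _ => ?_
            rw [← mul_assoc, ← mul_assoc, (hv _).eq]
          rw [e4, show (l : ℕ) + b + 1 - l = b + 1 by omega, mul_smul_comm, smul_mul_assoc,
            ← add_smul]
          congr 1
          push_cast
          ring
        -- Here the only contribution is the contraction with the top generator `q_{n+1}`.
        · have : n + 1 = l := by omega
          rw [zero_add, ← this, Nat.sub_self, smul_mul_assoc]
          push_cast
          rfl
      · rw [if_neg hln, if_neg (by omega), zero_add, smul_zero]
        refine sum_eq_zero fun x hx => if_neg ?_
        rintro rfl
        have := mem_antidiagonal.1 hx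
        simp only [Nat.succPNat_coe] at hln
        omega

/-- Normal ordering of a product of two exponentials in a Heisenberg algebra. -/
theorem hop_mul_hop {R : Type*} [CommRing R] [Algebra ℂ R] [Algebra R A] [IsScalarTower ℂ R A]
    {d q : ℕ+ → A} {v : ℕ+ → R}
    (hd : ∀ k l, k ≠ l → Commute (d k) (q l))
    (hdq : ∀ k, d k * q k = q k * d k + ((k : ℕ) : ℂ) • algebraMap R A (v k)) (m n : ℕ) :
    hop d m * hop q n = ∑ x ∈ antidiagonal m,
      if x.2 ≤ n then hop v x.2 • (hop q (n - x.2) * hop d x.1) else 0 := by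
  set F : A⟦X⟧ := mk (hop q) with hF
  have hC : ∀ (c : ℂ) (x : A), (C (c • x) : A⟦X⟧) = c • C x := fun c x => by
    ext n
    simp [coeff_C]
  have hCv : ∀ (c : ℂ) (x : R), (C (algebraMap R A (c • x)) : A⟦X⟧) = c • C (algebraMap R A x) :=
    fun c x => by
      rw [← hC, Algebra.algebraMap_eq_smul_one, smul_assoc, ← Algebra.algebraMap_eq_smul_one]
  -- Conjugation by the generating series of `hop q` shifts each `d_k` by the central term `x^k
  -- v_k`. Hence it turns `hop d` into a convolution of `hop d` and `hop v`, and the claim is the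
  -- coefficient of `x^n`.
  have hconj : ∀ k, F * (C (d k) + X ^ (k : ℕ) * C (algebraMap R A (v k))) = C (d k) * F := by
    intro k
    ext n
    rw [mul_add, map_add, coeff_mul_C, coeff_C_mul, hF, coeff_mk,
      mul_hop_of_commutator (hdq k) (fun l hl => hd k l hl.symm)
        (fun l => Algebra.commutes _ _), ← mul_assoc, ((commute_X (mk (hop q))).pow_right _).eq,
      mul_assoc, coeff_X_pow_mul', coeff_mul_C, coeff_mk]
    split_ifs
    · rw [Algebra.commutes]
    · rfl
  have h1 := mul_hop_eq_hop_mul hconj m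
  have h2 : hop (fun k => (C (d k) : A⟦X⟧)) m = C (hop d m) := (map_hop C hC d m).symm
  have h3 : ∀ j, hop (fun k : ℕ+ => X ^ (k : ℕ) * (C (algebraMap R A (v k)) : A⟦X⟧)) j =
      X ^ j * C (algebraMap R A (hop v j)) := fun j => by
    rw [hop_pow_mul (fun k => (commute_X _).symm)]
    congr 1
    exact (map_hop ((C : A →+* A⟦X⟧).comp (algebraMap R A)) hCv v j).symm
  rw [h2, hop_add] at h1
  · have h4 := congrArg (coeff n) h1
    rw [coeff_C_mul, hF, coeff_mk] at h4
    rw [← h4, mul_sum, map_sum]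
    refine sum_congr rfl fun x _ => ?_
    rw [h3, ← mul_assoc, ← mul_assoc, ((commute_X _).pow_right _).eq, mul_assoc, coeff_X_pow_mul',
      coeff_mul_C]
    split_ifs
    · rw [show hop (fun k => (C (d k) : A⟦X⟧)) x.1 = C (hop d x.1) from (map_hop C hC d _).symm,
        coeff_mul_C, coeff_mk, Algebra.smul_def, Algebra.commutes]
    · rfl
  · intro k l
    exact Commute.mul_right ((commute_X _).pow_right _) (commute_of_coeff fun a b => by
      rw [coeff_C, coeff_C]
      split_ifs
      · exact (Algebra.commutes _ _).symm
      all_goals simp)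

/-- `exp (∑ (r^k - s^k) x^k / k) = (1 - s x) / (1 - r x)`. -/
theorem hop_pow_sub_pow {R : Type*} [CommRing R] [Algebra ℂ R] (r s : R) (n : ℕ) :
    hop (fun k : ℕ+ => r ^ (k : ℕ) - s ^ (k : ℕ)) n = if n = 0 then 1 else r ^ (n - 1) * (r - s) := by
  refine (congrFun (hop_unique _ (fun n => if n = 0 then 1 else r ^ (n - 1) * (r - s)) (by simp)
    fun n => ?_) n).symm
  rw [if_neg n.succ_ne_zero, Nat.add_sub_cancel]
  simp only [Nat.succPNat_coe]
  induction n with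
  | zero => simp
  | succ n ih =>
    -- The terms with `x.2 = 0` and `x.2 = 1` are split off; lowering `x.2` by one turns the others
    -- into `r` times the previous sum without its `x.2 = 0` term.
    have key : ∑ x ∈ antidiagonal (n + 1), (r ^ (x.1 + 1) - s ^ (x.1 + 1)) *
        (if x.2 = 0 then 1 else r ^ (x.2 - 1) * (r - s)) =
        (r ^ (n + 2) - s ^ (n + 2)) + (r ^ (n + 1) - s ^ (n + 1)) * (r - s) +
         r * (∑ x ∈ antidiagonal n, (r ^ (x.1 + 1) - s ^ (x.1 + 1)) *
        (if x.2 = 0 then 1 else r ^ (x.2 - 1) * (r - s)) - (r ^ (n + 1) - s ^ (n + 1))) := by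
      cases n with
      | zero => 
        simp [Finset.Nat.antidiagonal_succ]
        ring
      | succ n =>
      rw [Finset.Nat.sum_antidiagonal_succ', Finset.Nat.sum_antidiagonal_succ',
        Finset.Nat.sum_antidiagonal_succ']
      simp only [Nat.succ_ne_zero, if_false, if_true, Nat.add_sub_cancel]
      simp only [mul_sub r, mul_add r, mul_sum]
      have : ∀ x ∈ antidiagonal n, (r ^ (x.1 + 1) - s ^ (x.1 + 1)) * (r ^ (x.2 + 1) * (r - s)) = 
          r * ((r ^ (x.1 + 1) - s ^ (x.1 + 1)) * (r ^ x.2 * (r - s))) := fun x _ => by ring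
      rw [sum_congr rfl this]
      simp only [pow_zero]
      ring
    rw [key, ← ih]
    simp only [Algebra.smul_def]
    push_cast
    ring

end Hop

end DiskSFT

end

noncomputable section

namespace DiskSFT

set_option linter.unusedSectionVars false

open Finset hiding mk antidiagonal mem_antidiagonal
open Finset.HasAntidiagonal hiding mk

/-! ### The commutator of the vertex operators with the bilinear operator. -/

section Vertex

variable {R A : Type*} [CommRing R] [Algebra ℂ R] [Ring A] [Algebra ℂ A] [Algebra R A]

/-- Two commuting Heisenberg algebras: creation operators `a`, `a'`, annihilation operators
`d`, `d'`. -/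
structure Heisenberg (a a' d d' : ℕ+ → A) : Prop where
  aa : ∀ k l, Commute (a k) (a l)
  aa' : ∀ k l, Commute (a k) (a' l)
  a'a' : ∀ k l, Commute (a' k) (a' l)
  dd : ∀ k l, Commute (d k) (d l)
  dd' : ∀ k l, Commute (d k) (d' l)
  d'd' : ∀ k l, Commute (d' k) (d' l)
  da' : ∀ k l, Commute (d k) (a' l)
  d'a : ∀ k l, Commute (d' k) (a l)
  da : ∀ k l, k ≠ l → Commute (d k) (a l)
  d'a'_of_ne : ∀ k l, k ≠ l → Commute (d' k) (a' l)
  da_self : ∀ k, d k * a k = a k * d k + 1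
  d'a'_self : ∀ k, d' k * a' k = a' k * d' k + 1

theorem Heisenberg.swap {a a' d d' : ℕ+ → A} (H : Heisenberg a a' d d') :
    Heisenberg a' a d' d where
  aa := H.a'a'
  aa' k l := (H.aa' l k).symm
  a'a' := H.aa
  dd := H.d'd'
  dd' k l := (H.dd' l k).symm
  d'd' := H.dd
  da' := H.d'a
  d'a := H.da'
  da := H.d'a'_of_ne
  d'a'_of_ne := H.da
  da_self := H.d'a'_self
  d'a'_self := H.da_self

/-- The creation part of the vertex operator. -/
def vertexUp (f r s : R) (a : ℕ+ → A) : ℕ → A :=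
  hop fun k => (f * (r ^ (k : ℕ) - s ^ (k : ℕ))) • a k

/-- The annihilation part of the vertex operator. -/
def vertexDown (e r s : R) (d : ℕ+ → A) : ℕ → A :=
  hop fun k => (e * (k : ℕ) * (r ^ (k : ℕ) - s ^ (k : ℕ))) • d k

/-- The creation part of the bilinear operator. -/
def bilinUp (f : R) (a a' : ℕ+ → A) : ℕ → A := hop fun k => f • (a' k - a k)

/-- The annihilation part of the bilinear operator. -/
def bilinDown (e : R) (d d' : ℕ+ → A) : ℕ → A := hop fun k => (e * (k : ℕ)) • (d k - d' k)

/-- The homogeneous components of the vertex operator. -/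
def vertexTerm (e f r s : R) (a d : ℕ+ → A) (i : ℕ) : A :=
  vertexUp f r s a i * vertexDown e r s d i

/-- The homogeneous components of the bilinear operator. -/
def bilinTerm (e f : R) (a a' d d' : ℕ+ → A) (i : ℕ) : A :=
  bilinUp f a a' i * bilinDown e d d' (i + 1)

variable {a a' d d' : ℕ+ → A}

theorem smul_commutator {x y : A} (h : x * y = y * x + 1) (b c : R) :
    (b • x) * (c • y) = (c • y) * (b • x) + algebraMap R A (b * c) := by
  rw [smul_mul_smul_comm, h, smul_add, smul_mul_smul_comm, mul_comm c b,
    Algebra.algebraMap_eq_smul_one]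

theorem natCast_smul_algebraMap (k : ℕ) (x : R) :
    (k : ℂ) • algebraMap R A x = algebraMap R A (k * x) := by
  rw [map_mul, map_natCast, Algebra.smul_def, map_natCast]

/-- Only `d_k` contracts with `a_k`. Since `e f = 1`, the contraction is `k (r^k - s^k)`, whatever
the value of `e`. -/
theorem Heisenberg.bilinDown_mul_vertexUp [IsScalarTower ℂ R A] (H : Heisenberg a a' d d')
    {e f : R} (hef : e * f = 1) (r s : R) (m n : ℕ) :
    bilinDown e d d' m * vertexUp f r s a n = ∑ x ∈ antidiagonal m,
      if x.2 ≤ n then hop (fun k : ℕ+ => r ^ (k : ℕ) - s ^ (k : ℕ)) x.2 •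
        (vertexUp f r s a (n - x.2) * bilinDown e d d' x.1) else 0 := by
  refine hop_mul_hop (fun k l hkl => ?_) (fun k => ?_) m n
  · exact (((H.da k l hkl).sub_left (H.d'a k l)).smul_left _).smul_right _
  · have h : (d k - d' k) * a k = a k * (d k - d' k) + 1 := by
      rw [sub_mul, H.da_self, (H.d'a k k).eq, mul_sub]
      abel
    rw [smul_commutator h, natCast_smul_algebraMap]
    congr 2
    linear_combination ((k : ℕ) : R) * (r ^ (k : ℕ) - s ^ (k : ℕ)) * hef

/-- Now `a_k` enters through `a'_k - a_k`, which reverses the sign of the contraction and exchanges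
the roles of `r` and `s`. -/
theorem Heisenberg.vertexDown_mul_bilinUp [IsScalarTower ℂ R A] (H : Heisenberg a a' d d')
    {e f : R} (hef : e * f = 1) (r s : R) (m n : ℕ) :
    vertexDown e r s d m * bilinUp f a a' n = ∑ x ∈ antidiagonal m,
      if x.2 ≤ n then hop (fun k : ℕ+ => s ^ (k : ℕ) - r ^ (k : ℕ)) x.2 •
        (bilinUp f a a' (n - x.2) * vertexDown e r s d x.1) else 0 := by
  refine hop_mul_hop (fun k l hkl => ?_) (fun k => ?_) m n
  · exact (((H.da' k l).sub_right (H.da k l hkl)).smul_left _).smul_right _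
  · have h : d k * (a k - a' k) = (a k - a' k) * d k + 1 := by
      rw [mul_sub, H.da_self, (H.da' k k).eq, sub_mul]
      abel
    have h2 : f • (a' k - a k) = (-f) • (a k - a' k) := by
      rw [neg_smul, ← smul_neg, neg_sub]
    rw [h2, smul_commutator h, natCast_smul_algebraMap]
    congr 2
    linear_combination -((k : ℕ) : R) * (r ^ (k : ℕ) - s ^ (k : ℕ)) * hef

/-- The normally ordered product of the components of the vertex operator and of the bilinear
operator. -/
def normalTerm (e f r s : R) (a a' d d' : ℕ+ → A) (x y : ℕ × ℕ) : A :=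
  bilinUp f a a' x.2 * vertexUp f r s a x.1 * (bilinDown e d d' y.2 * vertexDown e r s d y.1)

/-- `J` stands for the operators with values of high order. A normally ordered term lies in `J` once
its creation weight reaches `N`, so only weights `W < N` remain; their annihilation weight is `W +
1`. -/
theorem Heisenberg.sum_bilinTerm_mul_vertexTerm [IsScalarTower ℂ R A] (H : Heisenberg a a' d d')
    {e f : R} (hef : e * f = 1) (r s : R) {J : Submodule R A} {N K K' : ℕ}
    (hK : N ≤ K) (hK' : N + 1 ≤ K')
    (hJ : ∀ l i x, N ≤ l + i → bilinUp f a a' l * vertexUp f r s a i * x ∈ J) :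
    ∑ L ∈ range K, ∑ i ∈ range K', bilinTerm e f a a' d d' L * vertexTerm e f r s a d i -
      ∑ W ∈ range N, ∑ x ∈ antidiagonal W, ∑ y ∈ antidiagonal (W + 1),
        (if x.1 ≤ y.1 then hop (fun k : ℕ+ => r ^ (k : ℕ) - s ^ (k : ℕ)) (y.1 - x.1) else 0) •
          normalTerm e f r s a a' d d' x y ∈ J := by
  set V := hop (fun k : ℕ+ => r ^ (k : ℕ) - s ^ (k : ℕ)) with hV
  have e1 : ∀ L i, bilinTerm e f a a' d d' L * vertexTerm e f r s a d i =
      ∑ z ∈ antidiagonal (L + 1), if z.2 ≤ i then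
        V z.2 • normalTerm e f r s a a' d d' (i - z.2, L) (i, z.1) else 0 := by
    intro L i
    rw [bilinTerm, vertexTerm, mul_assoc, ← mul_assoc (bilinDown _ _ _ _),
      H.bilinDown_mul_vertexUp hef, sum_mul, mul_sum]
    refine sum_congr rfl fun z _ => ?_
    split_ifs
    · simp only [normalTerm, smul_mul_assoc, mul_smul_comm, mul_assoc]
      rfl
    · simp
  simp only [e1]
  simp only [Finset.sum_sigma']
  rw [← sum_filter_add_sum_filter_not _ (fun w : (_ : ℕ) × (_ : ℕ) × ℕ × ℕ =>
    w.2.2.2 ≤ w.2.1 ∧ w.1 + w.2.1 < N + w.2.2.2), add_sub_right_comm]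
  refine J.add_mem ?_ (J.sum_mem ?_)
  · convert J.zero_mem
    rw [sub_eq_zero]
    rw [← sum_filter_of_ne (s := (range N).sigma _) (p := fun w => w.2.1.1 ≤ w.2.2.1)]
    -- A contraction of weight `k` between the components `L` and `i` leaves creation weight `W = L
    -- + i - k`. Conversely `L = x.2` and `i = y.1`; the latter can equal `W + 1`, which is why `K'`
    -- must be at least `N + 1`.
    · refine sum_nbij' (fun w => ⟨w.1 + w.2.1 - w.2.2.2, (w.2.1 - w.2.2.2, w.1),
        (w.2.1, w.2.2.1)⟩) (fun w => ⟨w.2.1.2, w.2.2.1, (w.2.2.2, w.2.2.1 - w.2.1.1)⟩) ?_ ?_ ?_ ?_ ?_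
      · rintro ⟨L, i, m, k⟩ h
        simp only [mem_filter, mem_sigma, mem_range, mem_antidiagonal] at h ⊢
        omega
      · rintro ⟨W, ⟨i, l⟩, j, n⟩ h
        simp only [mem_filter, mem_sigma, mem_range, mem_antidiagonal] at h ⊢
        omega
      · rintro ⟨L, i, m, k⟩ h
        simp only [mem_filter, mem_sigma, mem_range, mem_antidiagonal] at h ⊢
        congr 3
        omega
      · rintro ⟨W, ⟨i, l⟩, j, n⟩ h
        simp only [mem_filter, mem_sigma, mem_range, mem_antidiagonal] at h ⊢
        have h1 : l + j - (j - i) = W := by omega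
        have h2 : j - (j - i) = i := by omega
        rw [h1, h2]
      · rintro ⟨L, i, m, k⟩ h
        simp only [mem_filter, mem_sigma, mem_range, mem_antidiagonal] at h ⊢
        rw [if_pos h.2.1, if_pos (by omega), Nat.sub_sub_self h.2.1]
    · rintro ⟨W, ⟨i, l⟩, j, n⟩ h hne
      by_contra hc
      exact hne (by rw [if_neg hc, zero_smul])
  · rintro ⟨L, i, m, k⟩ h
    simp only [mem_filter, mem_sigma, mem_range, mem_antidiagonal] at h ⊢
    split_ifs with hk
    · exact J.smul_mem _ (hJ _ _ _ (by omega))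
    · exact J.zero_mem

theorem Heisenberg.commute_bilinUp_vertexUp (H : Heisenberg a a' d d') (f r s : R) (l i : ℕ) :
    Commute (bilinUp f a a' l) (vertexUp f r s a i) :=
  commute_hop_hop (fun k l => (((H.aa' l k).symm.sub_left (H.aa k l)).smul_left _).smul_right _) _ _

theorem Heisenberg.commute_bilinDown_vertexDown (H : Heisenberg a a' d d') (e r s : R) (n j : ℕ) :
    Commute (bilinDown e d d' n) (vertexDown e r s d j) :=
  commute_hop_hop (fun k l => (((H.dd k l).sub_left (H.dd' l k).symm).smul_left _).smul_right _) _ _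

theorem Heisenberg.sum_vertexTerm_mul_bilinTerm [IsScalarTower ℂ R A] (H : Heisenberg a a' d d')
    {e f : R} (hef : e * f = 1) (r s : R) {J : Submodule R A} {N K K' : ℕ}
    (hK : N ≤ K) (hK' : N + 1 ≤ K')
    (hJ : ∀ l i x, N ≤ l + i → bilinUp f a a' l * vertexUp f r s a i * x ∈ J) :
    ∑ L ∈ range K, ∑ i ∈ range K', vertexTerm e f r s a d i * bilinTerm e f a a' d d' L -
      ∑ W ∈ range N, ∑ x ∈ antidiagonal W, ∑ y ∈ antidiagonal (W + 1),
        (if y.1 ≤ x.1 then hop (fun k : ℕ+ => s ^ (k : ℕ) - r ^ (k : ℕ)) (x.1 - y.1) else 0) •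
          normalTerm e f r s a a' d d' x y ∈ J := by
  set V := hop (fun k : ℕ+ => s ^ (k : ℕ) - r ^ (k : ℕ)) with hV
  have e1 : ∀ L i, vertexTerm e f r s a d i * bilinTerm e f a a' d d' L =
      ∑ z ∈ antidiagonal i, if z.2 ≤ L then
        V z.2 • normalTerm e f r s a a' d d' (i, L - z.2) (z.1, L + 1) else 0 := by
    intro L i
    rw [bilinTerm, vertexTerm, mul_assoc, ← mul_assoc (vertexDown _ _ _ _ _),
      H.vertexDown_mul_bilinUp hef, sum_mul, mul_sum]
    refine sum_congr rfl fun z _ => ?_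
    split_ifs
    · simp only [normalTerm]
      rw [(H.commute_bilinUp_vertexUp _ _ _ _ _).eq, (H.commute_bilinDown_vertexDown _ _ _ _ _).eq]
      simp only [smul_mul_assoc, mul_smul_comm, mul_assoc]
      rfl
    · simp
  simp only [e1]
  simp only [Finset.sum_sigma']
  rw [← sum_filter_add_sum_filter_not _ (fun w : (_ : ℕ) × (_ : ℕ) × ℕ × ℕ =>
    w.2.2.2 ≤ w.1 ∧ w.1 + w.2.1 < N + w.2.2.2), add_sub_right_comm]
  refine J.add_mem ?_ (J.sum_mem ?_)
  · convert J.zero_mem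
    rw [sub_eq_zero]
    rw [← sum_filter_of_ne (s := (range N).sigma _) (p := fun w => w.2.2.1 ≤ w.2.1.1)]
    -- In this order `L` is recovered as `y.2 - 1`. The subtraction is not truncated, because `y.1 ≤
    -- x.1 ≤ W` while `y.1 + y.2 = W + 1`.
    · refine sum_nbij' (fun w => ⟨w.1 + w.2.1 - w.2.2.2, (w.2.1, w.1 - w.2.2.2),
        (w.2.2.1, w.1 + 1)⟩) (fun w => ⟨w.2.2.2 - 1, w.2.1.1, (w.2.2.1, w.2.1.1 - w.2.2.1)⟩)
        ?_ ?_ ?_ ?_ ?_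
      · rintro ⟨L, i, m, k⟩ h
        simp only [mem_filter, mem_sigma, mem_range, mem_antidiagonal] at h ⊢
        omega
      · rintro ⟨W, ⟨i, l⟩, j, n⟩ h
        simp only [mem_filter, mem_sigma, mem_range, mem_antidiagonal] at h ⊢
        omega
      · rintro ⟨L, i, m, k⟩ h
        simp only [mem_filter, mem_sigma, mem_range, mem_antidiagonal] at h ⊢
        have h1 : i - m = k := by omega
        rw [h1, Nat.add_sub_cancel]
      · rintro ⟨W, ⟨i, l⟩, j, n⟩ h
        simp only [mem_filter, mem_sigma, mem_range, mem_antidiagonal] at h ⊢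
        have h1 : n - 1 + i - (i - j) = W := by omega
        have h2 : n - 1 - (i - j) = l := by omega
        have h3 : n - 1 + 1 = n := by omega
        rw [h1, h2, h3]
      · rintro ⟨L, i, m, k⟩ h
        simp only [mem_filter, mem_sigma, mem_range, mem_antidiagonal] at h ⊢
        rw [if_pos h.2.1, if_pos (by omega)]
        congr 2
        omega
    · rintro ⟨W, ⟨i, l⟩, j, n⟩ h hne
      by_contra hc
      exact hne (by rw [if_neg hc, zero_smul])
  · rintro ⟨L, i, m, k⟩ h
    simp only [mem_filter, mem_sigma, mem_range, mem_antidiagonal] at h ⊢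
    split_ifs with hk
    · exact J.smul_mem _ (hJ _ _ _ (by omega))
    · exact J.zero_mem

/-- Because `r s = 1`, the functions `(1 - su)/(1 - ru)` and `s² (u - r)/(u - s)` are equal. The two
terms on the left are the coefficients of `u^(j-i)` in the expansions at `u = 0` and `u = ∞`, so
their difference is a coefficient of a multiple of the delta function `∑_n (ru)^n` over all integers
`n`. -/
theorem hop_pow_sub_pow_combination {r s : R} (hrs : r * s = 1) (i j : ℕ) :
    (if i ≤ j then hop (fun k : ℕ+ => r ^ (k : ℕ) - s ^ (k : ℕ)) (j - i) else 0) -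
      s ^ 2 * (if j ≤ i then hop (fun k : ℕ+ => s ^ (k : ℕ) - r ^ (k : ℕ)) (i - j) else 0) =
      (1 - s ^ 2) * (s ^ i * r ^ j) := by
  have hp : ∀ n, s ^ n * r ^ n = 1 := fun n => by rw [← mul_pow, mul_comm, hrs, one_pow]
  rw [hop_pow_sub_pow, hop_pow_sub_pow]
  rcases lt_trichotomy i j with h | rfl | h
  · obtain ⟨k, rfl⟩ := Nat.exists_eq_add_of_lt h
    rw [if_pos h.le, if_neg (by omega), if_neg (by omega), show i + k + 1 - i - 1 = k by omega]
    rw [show s ^ i * r ^ (i + k + 1) = s ^ i * r ^ i * r ^ k * r by ring, hp]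
    linear_combination r ^ k * s * hrs
  · simp [hp]
  · obtain ⟨k, rfl⟩ := Nat.exists_eq_add_of_lt h
    rw [if_pos h.le, if_neg (by omega), if_neg (by omega), show j + k + 1 - j - 1 = k by omega]
    rw [show s ^ (j + k + 1) * r ^ j = s ^ j * r ^ j * s ^ k * s by ring, hp]
    linear_combination s ^ k * s * hrs

/-- The creation part common to both normally ordered commutators. -/
def commonUp (f s : R) (a a' : ℕ+ → A) : ℕ → A :=
  hop fun k => f • (a' k - s ^ (2 * (k : ℕ)) • a k)

/-- The annihilation part common to both normally ordered commutators. -/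
def commonDown (e r : R) (d d' : ℕ+ → A) : ℕ → A :=
  hop fun k => (e * (k : ℕ)) • (r ^ (2 * (k : ℕ)) • d k - d' k)

/-- The weight `s^i r^j` separates creation from annihilation and, by homogeneity, rescales the
generators of the vertex operator. The exponents then add up: `f (a' - a) + s^k f (r^k - s^k) a = f
(a' - s^(2k) a)`, and similarly for the annihilation part. -/
theorem Heisenberg.sum_smul_normalTerm (H : Heisenberg a a' d d') {e f r s : R} (hrs : r * s = 1)
    (W W' : ℕ) :
    ∑ x ∈ antidiagonal W, ∑ y ∈ antidiagonal W',
        (s ^ x.1 * r ^ y.1) • normalTerm e f r s a a' d d' x y =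
      commonUp f s a a' W * commonDown e r d d' W' := by
  have hp : ∀ n, s ^ n * r ^ n = 1 := fun n => by rw [← mul_pow, mul_comm, hrs, one_pow]
  have e1 : commonUp f s a a' W =
      ∑ x ∈ antidiagonal W, s ^ x.1 • (bilinUp f a a' x.2 * vertexUp f r s a x.1) := by
    have h := hop_add (q := fun k : ℕ+ =>
        s ^ (k : ℕ) • (f * (r ^ (k : ℕ) - s ^ (k : ℕ))) • a k) (q' := fun k => f • (a' k - a k))
      (fun k l => ((((H.aa' k l).sub_right (H.aa k l)).smul_right _).smul_left _).smul_left _) W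
    rw [commonUp]
    convert h using 1
    · congr 1
      funext k
      rw [smul_sub, smul_sub, smul_smul, smul_smul, add_sub_left_comm, ← sub_smul,
        show s ^ (k : ℕ) * (f * (r ^ (k : ℕ) - s ^ (k : ℕ))) - f = -(f * s ^ (2 * (k : ℕ))) by
          linear_combination f * hp k]
      rw [neg_smul, sub_eq_add_neg]
    · refine sum_congr rfl fun x _ => ?_
      rw [hop_smul_pow, smul_mul_assoc, (H.commute_bilinUp_vertexUp _ _ _ _ _).eq]
      rfl
  have e2 : commonDown e r d d' W' =
      ∑ y ∈ antidiagonal W', r ^ y.1 • (bilinDown e d d' y.2 * vertexDown e r s d y.1) := by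
    have h := hop_add (q := fun k : ℕ+ =>
        r ^ (k : ℕ) • (e * (k : ℕ) * (r ^ (k : ℕ) - s ^ (k : ℕ))) • d k)
        (q' := fun k => (e * (k : ℕ)) • (d k - d' k))
      (fun k l => ((((H.dd k l).sub_right (H.dd' k l)).smul_right _).smul_left _).smul_left _) W'
    rw [commonDown]
    convert h using 1
    · congr 1
      funext k
      rw [smul_sub, smul_sub, smul_smul, smul_smul, add_sub, ← add_smul,
        show r ^ (k : ℕ) * (e * (k : ℕ) * (r ^ (k : ℕ) - s ^ (k : ℕ))) + e * (k : ℕ) =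
          e * (k : ℕ) * r ^ (2 * (k : ℕ)) by linear_combination -(e * (k : ℕ)) * hp k]
    · refine sum_congr rfl fun x _ => ?_
      rw [hop_smul_pow, smul_mul_assoc, (H.commute_bilinDown_vertexDown _ _ _ _ _).eq]
      rfl
  rw [e1, e2, sum_mul_sum]
  refine sum_congr rfl fun x _ => sum_congr rfl fun y _ => ?_
  rw [smul_mul_smul_comm, normalTerm]

theorem Heisenberg.commutator_left [IsScalarTower ℂ R A] (H : Heisenberg a a' d d')
    {e f r s : R} (hef : e * f = 1) (hrs : r * s = 1) {J : Submodule R A} {N K K' : ℕ}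
    (hK : N ≤ K) (hK' : N + 1 ≤ K')
    (hJ : ∀ l i x, N ≤ l + i → bilinUp f a a' l * vertexUp f r s a i * x ∈ J) :
    ∑ L ∈ range K, ∑ i ∈ range K', (bilinTerm e f a a' d d' L * vertexTerm e f r s a d i -
      s ^ 2 • (vertexTerm e f r s a d i * bilinTerm e f a a' d d' L)) -
      (1 - s ^ 2) • ∑ W ∈ range N, commonUp f s a a' W * commonDown e r d d' (W + 1) ∈ J := by
  have h1 := H.sum_bilinTerm_mul_vertexTerm hef r s hK hK' hJ
  have h2 := J.smul_mem (s ^ 2) (H.sum_vertexTerm_mul_bilinTerm hef r s hK hK' hJ)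
  convert J.sub_mem h1 h2 using 1
  simp only [sum_sub_distrib, smul_sub, smul_sum]
  rw [sub_sub_sub_comm]
  congr 1
  rw [← sum_sub_distrib]
  refine sum_congr rfl fun W _ => ?_
  rw [← H.sum_smul_normalTerm hrs, smul_sum, ← sum_sub_distrib]
  refine sum_congr rfl fun x _ => ?_
  rw [smul_sum, ← sum_sub_distrib]
  refine sum_congr rfl fun y _ => ?_
  rw [smul_smul, smul_smul, ← sub_smul, hop_pow_sub_pow_combination hrs]

/-- Together with `vertexTerm_swap` this is the symmetry that exchanges the two factors, negates `e`
and `f`, and exchanges `r` with `s`. It yields the second half of the commutator from the first. -/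
theorem bilinTerm_swap (e f : R) (i : ℕ) :
    bilinTerm (-e) (-f) a' a d' d i = bilinTerm e f a a' d d' i := by
  rw [bilinTerm, bilinTerm, bilinUp, bilinUp, bilinDown, bilinDown]
  congr 2 <;> funext k
  · rw [neg_smul, ← smul_neg, neg_sub]
  · rw [neg_mul, neg_smul, ← smul_neg, neg_sub]

theorem vertexTerm_swap (e f r s : R) (i : ℕ) :
    vertexTerm (-e) (-f) s r a d i = vertexTerm e f r s a d i := by
  rw [vertexTerm, vertexTerm, vertexUp, vertexUp, vertexDown, vertexDown]
  congr 2 <;> funext k <;> congr 1 <;> ring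

/-- The bilinear operator intertwines the vertex operators of neighbouring charges. -/
theorem Heisenberg.commutator [IsScalarTower ℂ R A] (H : Heisenberg a a' d d')
    {e f r s : R} (hef : e * f = 1) (hrs : r * s = 1) {J : Submodule R A} {N K K' : ℕ}
    (hK : N ≤ K) (hK' : N + 1 ≤ K')
    (hJ : ∀ l i x, N ≤ l + i → bilinUp f a a' l * vertexUp f r s a i * x ∈ J)
    (hJ' : ∀ l i x, N ≤ l + i → bilinUp f a a' l * vertexUp f r s a' i * x ∈ J) :
    ∑ L ∈ range K, ∑ i ∈ range K', (bilinTerm e f a a' d d' L *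
        (vertexTerm e f r s a d i + vertexTerm e f r s a' d' i) -
      (s ^ 2 • vertexTerm e f r s a d i + r ^ 2 • vertexTerm e f r s a' d' i) *
        bilinTerm e f a a' d d' L) ∈ J := by
  have hp : ∀ n, s ^ n * r ^ n = 1 := fun n => by rw [← mul_pow, mul_comm, hrs, one_pow]
  have h1 := H.commutator_left hef hrs hK hK' hJ
  have hsr : s * r = 1 := by rw [mul_comm, hrs]
  have hef' : -e * -f = 1 := by rw [neg_mul_neg, hef]
  have hu : bilinUp (-f) a' a = bilinUp f a a' := by
    rw [bilinUp, bilinUp]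
    congr 1
    funext k
    rw [neg_smul, ← smul_neg, neg_sub]
  have hv : vertexUp (-f) s r a' = vertexUp f r s a' := by
    rw [vertexUp, vertexUp]
    congr 1
    funext k
    congr 1
    ring
  have h2 := H.swap.commutator_left (J := J) hef' hsr hK hK' (by rw [hu, hv]; exact hJ')
  -- After the exchange, the generators of the common parts are multiplied by `r^(2k)` in the
  -- creation part and by `s^(2k)` in the annihilation part, so homogeneity gives scalar factors.
  have e1 : ∀ W, commonUp (-f) r a' a W = r ^ (2 * W) • commonUp f s a a' W := fun W => by
    rw [pow_mul, commonUp, commonUp, ← hop_smul_pow]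
    congr 1
    funext k
    rw [← pow_mul, smul_smul, smul_sub, smul_sub, smul_smul, smul_smul,
      show r ^ (2 * (k : ℕ)) * f * s ^ (2 * (k : ℕ)) = f by
        linear_combination f * hp (2 * k), neg_mul, neg_smul, neg_smul, mul_comm f]
    abel
  have e2 : ∀ W, commonDown (-e) s d' d W = s ^ (2 * W) • commonDown e r d d' W := fun W => by
    rw [pow_mul, commonDown, commonDown, ← hop_smul_pow]
    congr 1
    funext k
    rw [← pow_mul, smul_smul, smul_sub, smul_sub, smul_smul, smul_smul,
      show s ^ (2 * (k : ℕ)) * (e * (k : ℕ)) * r ^ (2 * (k : ℕ)) = e * (k : ℕ) by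
        linear_combination e * (k : ℕ) * hp (2 * k), neg_mul, neg_mul, neg_smul, neg_smul,
        mul_comm (s ^ (2 * (k : ℕ)))]
    abel
  convert J.add_mem h1 h2 using 1
  simp only [bilinTerm_swap, vertexTerm_swap, e1, e2, smul_mul_smul_comm]
  rw [sub_add_sub_comm, ← sum_add_distrib]
  simp only [← sum_add_distrib]
  rw [smul_sum, smul_sum, ← sum_add_distrib, sum_eq_zero (s := range N), sub_zero]
  · refine sum_congr rfl fun L _ => sum_congr rfl fun i _ => ?_
    rw [mul_add, add_mul, smul_mul_assoc, smul_mul_assoc]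
    abel
  -- The annihilation weight exceeds the creation weight by one, so the exchange contributes `r^(2W)
  -- s^(2W+2) = s²`, and `(1 - s²) + (1 - r²) s² = 0`.
  · intro W _
    rw [smul_smul, ← add_smul, show (1 - s ^ 2 + (1 - r ^ 2) * (r ^ (2 * W) * s ^ (2 * (W + 1)))) = 0
      by linear_combination (1 - r ^ 2) * s ^ 2 * hp (2 * W) - hp 2, zero_smul]

end Vertex

end DiskSFT

end

noncomputable section

namespace DiskSFT

open Finset hiding mk antidiagonal mem_antidiagonal
open Finset.HasAntidiagonal hiding mk

/-! ### Sums over multi-indices of given weight as complete homogeneous elements. -/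

theorem wt_add (a b : ℕ+ →₀ ℕ) : wt (a + b) = wt a + wt b :=
  Finsupp.sum_add_index' (fun _ => Nat.mul_zero _) fun _ _ _ => Nat.mul_add _ _ _

theorem wt_single (k : ℕ+) (n : ℕ) : wt (Finsupp.single k n) = k * n :=
  Finsupp.sum_single_index (Nat.mul_zero _)

theorem wt_zero : wt 0 = 0 := Finsupp.sum_zero_index

theorem eq_zero_of_wt_eq_zero {a : ℕ+ →₀ ℕ} (h : wt a = 0) : a = 0 := by
  ext k
  by_contra hk
  have hk' : k ∈ a.support := Finsupp.mem_support_iff.2 hk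
  have := sum_eq_zero_iff.1 h k hk'
  have hk0 := k.pos
  rcases Nat.mul_eq_zero.1 this with h | h
  · omega
  · exact hk h

theorem multiIndices_zero : multiIndices 0 = {0} := by
  ext a
  rw [mem_multiIndices, mem_singleton]
  exact ⟨eq_zero_of_wt_eq_zero, fun h => h ▸ wt_zero⟩

theorem sub_single_add_single {a : ℕ+ →₀ ℕ} {k : ℕ+} (h : a k ≠ 0) :
    a - Finsupp.single k 1 + Finsupp.single k 1 = a := by
  ext j
  by_cases hj : j = k
  · subst hj
    simp
    omega
  · simp [Ne.symm hj]

/-- The generating function of a family indexed by multi-indices that satisfies the recursion of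
divided powers is the exponential of the generators. -/
theorem sum_multiIndices {M : Type*} [AddCommGroup M] [Module ℂ M] (D : ℕ+ → Module.End ℂ M)
    (x : (ℕ+ →₀ ℕ) → M)
    (h : ∀ b k, ((b k + 1 : ℕ) : ℂ) • x (b + Finsupp.single k 1) = D k (x b)) (n : ℕ) :
    ∑ b ∈ multiIndices n, x b = hop (fun k => ((k : ℕ) : ℂ) • D k) n (x 0) := by
  induction n using Nat.strong_induction_on with
  | _ n ih =>
    cases n with
    | zero => simp [hop_zero, multiIndices_zero]
    | succ n =>
      have hn : (n + 1 : ℂ) ≠ 0 := by exact_mod_cast Nat.succ_ne_zero n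
      rw [← smul_right_inj hn, ← LinearMap.smul_apply, succ_smul_hop, LinearMap.sum_apply]
      have e1 : ∀ y ∈ antidiagonal n, ((fun k : ℕ+ => ((k : ℕ) : ℂ) • D k) (Nat.succPNat y.1) *
          hop (fun k => ((k : ℕ) : ℂ) • D k) y.2) (x 0) = ∑ b ∈ multiIndices y.2,
            (((y.1 + 1 : ℕ) : ℂ) * ((b (Nat.succPNat y.1) + 1 : ℕ) : ℂ)) •
              x (b + Finsupp.single (Nat.succPNat y.1) 1) := by
        intro y hy
        rw [Module.End.mul_apply, ← ih y.2 (snd_lt_succ hy), map_sum]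
        refine sum_congr rfl fun b _ => ?_
        rw [mul_smul, h]
        rfl
      rw [sum_congr rfl e1, smul_sum]
      -- The weight `n + 1` is distributed as `∑ k b_k`. The pairs `(b, k)` with `b_k ≠ 0` then
      -- correspond to the terms of the recursion by removing one unit from `b` at `k`.
      have e2 : ∀ b ∈ multiIndices (n + 1), (n + 1 : ℂ) • x b =
          ∑ k ∈ b.support, (((k : ℕ) : ℂ) * (b k : ℂ)) • x b := by
        intro b hb
        rw [← sum_smul]
        congr 1
        rw [mem_multiIndices] at hb
        have := congrArg (Nat.cast : ℕ → ℂ) hb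
        rw [wt, Finsupp.sum] at this
        push_cast at this
        exact this.symm
      rw [sum_congr rfl e2, Finset.sum_sigma', Finset.sum_sigma']
      refine sum_nbij' (fun w => ⟨((w.2 : ℕ) - 1, n + 1 - w.2), w.1 - Finsupp.single w.2 1⟩)
        (fun w => ⟨w.2 + Finsupp.single (Nat.succPNat w.1.1) 1, Nat.succPNat w.1.1⟩) ?_ ?_ ?_ ?_ ?_
      · rintro ⟨b, k⟩ hw
        simp only [mem_sigma, mem_multiIndices, Finsupp.mem_support_iff, mem_antidiagonal] at hw ⊢
        have h1 := congrArg wt (sub_single_add_single hw.2)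
        rw [wt_add, wt_single] at h1
        have := k.pos
        omega
      · rintro ⟨⟨i, j⟩, b⟩ hw
        simp only [mem_sigma, mem_multiIndices, Finsupp.mem_support_iff, mem_antidiagonal] at hw ⊢
        rw [wt_add, wt_single]
        refine ⟨?_, ?_⟩
        · simp only [Nat.succPNat_coe]
          omega
        · simp
      · rintro ⟨b, k⟩ hw
        simp only [mem_sigma, mem_multiIndices, Finsupp.mem_support_iff] at hw ⊢
        have hk : Nat.succPNat ((k : ℕ) - 1) = k := PNat.succPNat_natPred k
        rw [hk, sub_single_add_single hw.2]
      · rintro ⟨⟨i, j⟩, b⟩ hw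
        simp only [mem_sigma, mem_multiIndices, mem_antidiagonal] at hw ⊢
        simp only [Nat.succPNat_coe, Nat.succ_eq_add_one, add_tsub_cancel_right]
        rw [show n + 1 - (i + 1) = j by omega]
      · rintro ⟨b, k⟩ hw
        simp only [mem_sigma, mem_multiIndices, Finsupp.mem_support_iff] at hw ⊢
        have hk : Nat.succPNat ((k : ℕ) - 1) = k := PNat.succPNat_natPred k
        have := k.pos
        rw [hk, sub_single_add_single hw.2, Nat.sub_add_cancel this]
        congr 3
        simp
        omega

theorem coeff_expLin {A : Type*} [CommRing A] [Algebra ℂ A] (c : ℕ+ → A) (a : ℕ+ →₀ ℕ) :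
    MvPowerSeries.coeff a (expLin c) = a.prod fun k n => ((n ! : ℂ)⁻¹) • c k ^ n := rfl

/-- The recursion of divided powers for a product over a multi-index. -/
theorem prod_add_single {A : Type*} [CommRing A] (F : ℕ+ → ℕ → A) (h0 : ∀ k, F k 0 = 1)
    (b : ℕ+ →₀ ℕ) (k : ℕ+) {u v : A} (h : u * F k (b k + 1) = v * F k (b k)) :
    u * (b + Finsupp.single k 1).prod F = v * b.prod F := by
  classical
  have h1 : (b + Finsupp.single k 1).support ⊆ insert k b.support := fun i hi => by
    by_contra hc
    rw [mem_insert, not_or] at hc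
    simp [Ne.symm hc.1] at hi
    exact hc.2 (Finsupp.mem_support_iff.2 hi)
  rw [Finsupp.prod_of_support_subset _ h1 _ (fun i _ => h0 i),
    Finsupp.prod_of_support_subset _ (subset_insert k _) _ (fun i _ => h0 i),
    ← mul_prod_erase _ _ (mem_insert_self k _), ← mul_prod_erase _ _ (mem_insert_self k _)]
  have h2 : ∀ i ∈ (insert k b.support).erase k,
      F i ((b + Finsupp.single k 1 : ℕ+ →₀ ℕ) i) = F i (b i) := fun i hi => by
    simp [Ne.symm (ne_of_mem_erase hi)]
  rw [prod_congr rfl h2, ← mul_assoc, ← mul_assoc]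
  congr 1
  simpa using h

theorem coeff_expLin_add_single {A : Type*} [CommRing A] [Algebra ℂ A] (c : ℕ+ → A)
    (b : ℕ+ →₀ ℕ) (k : ℕ+) :
    ((b k + 1 : ℕ) : ℂ) • MvPowerSeries.coeff (b + Finsupp.single k 1) (expLin c) =
      c k * MvPowerSeries.coeff b (expLin c) := by
  rw [coeff_expLin, coeff_expLin, Algebra.smul_def]
  refine prod_add_single (fun k n => ((n ! : ℂ)⁻¹) • c k ^ n) (fun k => by simp) b k ?_
  rw [Nat.factorial_succ, ← Algebra.smul_def, smul_smul, pow_succ', mul_smul_comm]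
  congr 1
  push_cast
  have : (b k + 1 : ℂ) ≠ 0 := by exact_mod_cast Nat.succ_ne_zero (b k)
  rw [mul_inv, mul_inv_cancel_left₀ this]

theorem lmul_hop {A : Type*} [Ring A] [Algebra ℂ A] (q : ℕ+ → A) (n : ℕ) :
    Algebra.lmul ℂ A (hop q n) = hop (fun k => Algebra.lmul ℂ A (q k)) n :=
  map_hop (Algebra.lmul ℂ A).toRingHom (fun c x => map_smul (Algebra.lmul ℂ A) c x) q n

theorem h_eq_hop {A : Type*} [CommRing A] [Algebra ℂ A] (j : ℕ) (q : ℕ+ → A) :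
    h j q = hop q j := by
  rw [h, sum_multiIndices (fun k => Algebra.lmul ℂ A (((k : ℂ)⁻¹) • q k)) _ fun b k =>
    coeff_expLin_add_single _ b k]
  have e : (fun k : ℕ+ => ((k : ℕ) : ℂ) • Algebra.lmul ℂ A (((k : ℂ)⁻¹) • q k)) =
      fun k => Algebra.lmul ℂ A (q k) := by
    funext k
    have : ((k : ℕ) : ℂ) ≠ 0 := by exact_mod_cast k.pos.ne'
    rw [← map_smul, smul_inv_smul₀ this]
  rw [e, ← lmul_hop, coeff_expLin, Finsupp.prod_zero_index]
  exact mul_one _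

end DiskSFT

end

noncomputable section

namespace DiskSFT

open Finset hiding mk antidiagonal mem_antidiagonal
open Finset.HasAntidiagonal hiding mk

/-! ### Filtered modules and power series of operators -/

section Filtered

variable {M : Type*} [AddCommGroup M] [Module ℂ M]

/-- Power series with scalar coefficients act on power series of operators. -/
instance operatorAlgebra : Algebra ℂ⟦X⟧ (Module.End ℂ M)⟦X⟧ :=
  (PowerSeries.map (algebraMap ℂ (Module.End ℂ M))).toAlgebra' fun c x =>
    commute_of_coeff fun m n => by
      rw [PowerSeries.coeff_map]
      exact Algebra.commutes _ _

theorem coeff_smul_operator (c : ℂ⟦X⟧) (x : (Module.End ℂ M)⟦X⟧) (n : ℕ) :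
    PowerSeries.coeff n (c • x) =
      ∑ y ∈ antidiagonal n, PowerSeries.coeff y.1 c • PowerSeries.coeff y.2 x := by
  rw [show c • x = PowerSeries.map (algebraMap ℂ (Module.End ℂ M)) c * x from rfl,
    PowerSeries.coeff_mul]
  refine sum_congr rfl fun y _ => ?_
  rw [PowerSeries.coeff_map, ← Algebra.smul_def]

theorem coeff_smul_C (c : ℂ⟦X⟧) (x : Module.End ℂ M) (n : ℕ) :
    PowerSeries.coeff n (c • (PowerSeries.C x : (Module.End ℂ M)⟦X⟧)) =
      PowerSeries.coeff n c • x := by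
  rw [show c • (PowerSeries.C x : (Module.End ℂ M)⟦X⟧) =
    PowerSeries.map (algebraMap ℂ (Module.End ℂ M)) c * PowerSeries.C x from rfl,
    PowerSeries.coeff_mul_C, PowerSeries.coeff_map, ← Algebra.smul_def]

theorem coeff_const_smul (c : ℂ) (x : (Module.End ℂ M)⟦X⟧) (n : ℕ) :
    PowerSeries.coeff n (c • x) = c • PowerSeries.coeff n x := rfl

instance : IsScalarTower ℂ ℂ⟦X⟧ (Module.End ℂ M)⟦X⟧ := ⟨fun c x y => by
  ext n : 1
  rw [coeff_smul_operator, coeff_const_smul, coeff_smul_operator, smul_sum]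
  refine sum_congr rfl fun z _ => ?_
  rw [map_smul, smul_assoc]⟩

theorem C_smul_operator (c : ℂ) (x : (Module.End ℂ M)⟦X⟧) : PowerSeries.C c • x = c • x := by
  rw [show (PowerSeries.C c : ℂ⟦X⟧) = c • 1 by
    ext n
    simp [PowerSeries.coeff_C, PowerSeries.coeff_one], smul_assoc, one_smul]

theorem C_smul_C_operator (c : ℂ) (x : Module.End ℂ M) :
    (PowerSeries.C c : ℂ⟦X⟧) • (PowerSeries.C x : (Module.End ℂ M)⟦X⟧) =
      PowerSeries.C (c • x) := by
  rw [C_smul_operator]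
  ext n : 1
  rw [coeff_const_smul, PowerSeries.coeff_C, PowerSeries.coeff_C]
  split_ifs <;> simp

/-- A power series of operators has degree at least `d` with respect to a filtration. -/
def HasDegree (I : ℕ → Submodule ℂ M) (d : ℤ) (x : (Module.End ℂ M)⟦X⟧) : Prop :=
  ∀ (n N N' : ℕ) (v : M), (N' : ℤ) ≤ N + d → v ∈ I N → PowerSeries.coeff n x v ∈ I N'

variable {I : ℕ → Submodule ℂ M}

theorem HasDegree.add {d : ℤ} {x y : (Module.End ℂ M)⟦X⟧} (hx : HasDegree I d x)
    (hy : HasDegree I d y) : HasDegree I d (x + y) := fun n N N' v h hv => by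
  rw [map_add, LinearMap.add_apply]
  exact (I N').add_mem (hx n N N' v h hv) (hy n N N' v h hv)

theorem HasDegree.zero (d : ℤ) : HasDegree I d 0 := fun n N N' v _ _ => by
  rw [map_zero, LinearMap.zero_apply]
  exact (I N').zero_mem

theorem HasDegree.smul {d : ℤ} {x : (Module.End ℂ M)⟦X⟧} (hx : HasDegree I d x) (c : ℂ⟦X⟧) :
    HasDegree I d (c • x) := fun n N N' v h hv => by
  rw [coeff_smul_operator, LinearMap.sum_apply]
  exact (I N').sum_mem fun y _ => (I N').smul_mem _ (hx _ N N' v h hv)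

theorem HasDegree.smul' {d : ℤ} {x : (Module.End ℂ M)⟦X⟧} (hx : HasDegree I d x) (c : ℂ) :
    HasDegree I d (c • x) := by
  rw [← C_smul_operator]
  exact hx.smul _

theorem HasDegree.mul (h0 : I 0 = ⊤) {d d' : ℤ} {x y : (Module.End ℂ M)⟦X⟧}
    (hx : HasDegree I d x) (hy : HasDegree I d' y) : HasDegree I (d + d') (x * y) :=
  fun n N N' v h hv => by
    rw [PowerSeries.coeff_mul, LinearMap.sum_apply]
    refine (I N').sum_mem fun z _ => ?_
    rw [Module.End.mul_apply]
    -- If the right factor would lower the order below zero, the intermediate vector is only known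
    -- to lie in `I 0`, which is everything.
    by_cases hd : 0 ≤ (N : ℤ) + d'
    · exact hx _ ((N : ℤ) + d').toNat _ _ (by omega) (hy _ N _ _ (by omega) hv)
    · exact hx _ 0 _ _ (by omega) (h0 ▸ Submodule.mem_top)

theorem HasDegree.mono {d d' : ℤ} (h : d' ≤ d) {x : (Module.End ℂ M)⟦X⟧} (hx : HasDegree I d x) :
    HasDegree I d' x := fun n N N' v hN hv => hx n N N' v (by omega) hv

theorem HasDegree.one (hI : Antitone I) : HasDegree I 0 1 := fun n N N' v h hv => by
  rw [PowerSeries.coeff_one]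
  split_ifs
  · exact hI (by omega) hv
  · exact (I N').zero_mem

/-- The sign `c` is `1` for creation operators and `-1` for annihilation operators. -/
theorem HasDegree.hop (hI : Antitone I) (h0 : I 0 = ⊤) {q : ℕ+ → (Module.End ℂ M)⟦X⟧} {c : ℤ}
    (hq : ∀ k : ℕ+, HasDegree I (c * (k : ℕ)) (q k)) (n : ℕ) : HasDegree I (c * n) (hop q n) := by
  induction n using Nat.strong_induction_on with
  | _ n ih =>
    cases n with
    | zero => rw [hop_zero, Nat.cast_zero, mul_zero]; exact HasDegree.one hI
    | succ n =>
      rw [hop_succ]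
      refine HasDegree.smul' ?_ _
      refine Finset.sum_induction _ _ (fun _ _ => HasDegree.add) (HasDegree.zero _) fun x hx => ?_
      refine ((hq _).mul h0 (ih x.2 (snd_lt_succ hx))).mono ?_
      have := mem_antidiagonal.1 hx
      rw [← this, Nat.succPNat_coe]
      push_cast
      linarith

theorem HasDegree.C {d : ℤ} {x : Module.End ℂ M}
    (h : ∀ (N N' : ℕ) (v : M), (N' : ℤ) ≤ N + d → v ∈ I N → x v ∈ I N') :
    HasDegree I d (PowerSeries.C x) := fun n N N' v hN hv => by
  rw [PowerSeries.coeff_C]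
  split_ifs
  · exact h N N' v hN hv
  · exact (I N').zero_mem

/-- The power series of operators whose values lie in the `N`-th step of a filtration. -/
def valuesIn (I : ℕ → Submodule ℂ M) (N : ℕ) : Submodule ℂ⟦X⟧ (Module.End ℂ M)⟦X⟧ where
  carrier := {x | ∀ n v, PowerSeries.coeff n x v ∈ I N}
  add_mem' hx hy n v := by
    rw [map_add, LinearMap.add_apply]
    exact (I N).add_mem (hx n v) (hy n v)
  zero_mem' n v := by
    rw [map_zero, LinearMap.zero_apply]
    exact (I N).zero_mem
  smul_mem' c x hx n v := by
    rw [coeff_smul_operator, LinearMap.sum_apply]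
    exact (I N).sum_mem fun y _ => (I N).smul_mem _ (hx _ v)

theorem HasDegree.mul_mem_valuesIn (h0 : I 0 = ⊤) {N d : ℕ} (hN : N ≤ d)
    {x : (Module.End ℂ M)⟦X⟧} (hx : HasDegree I d x) (y : (Module.End ℂ M)⟦X⟧) :
    x * y ∈ valuesIn I N := fun n v => by
  rw [PowerSeries.coeff_mul, LinearMap.sum_apply]
  refine (I N).sum_mem fun z _ => ?_
  rw [Module.End.mul_apply]
  exact hx _ 0 _ _ (by omega) (h0 ▸ Submodule.mem_top)

variable {M' : Type*} [AddCommGroup M'] [Module ℂ M']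

/-- A linear map intertwines two power series of operators. -/
def Intertwines (T : M →ₗ[ℂ] M') (x : (Module.End ℂ M)⟦X⟧) (y : (Module.End ℂ M')⟦X⟧) : Prop :=
  ∀ n v, T (PowerSeries.coeff n x v) = PowerSeries.coeff n y (T v)

variable {T : M →ₗ[ℂ] M'}

theorem Intertwines.mul {x x' : (Module.End ℂ M)⟦X⟧} {y y' : (Module.End ℂ M')⟦X⟧}
    (h : Intertwines T x y) (h' : Intertwines T x' y') : Intertwines T (x * x') (y * y') :=
  fun n v => by
    rw [PowerSeries.coeff_mul, PowerSeries.coeff_mul, LinearMap.sum_apply, LinearMap.sum_apply,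
      map_sum]
    refine sum_congr rfl fun z _ => ?_
    rw [Module.End.mul_apply, Module.End.mul_apply, h, h']

theorem Intertwines.smul {x : (Module.End ℂ M)⟦X⟧} {y : (Module.End ℂ M')⟦X⟧}
    (h : Intertwines T x y) (c : ℂ⟦X⟧) : Intertwines T (c • x) (c • y) := fun n v => by
  rw [coeff_smul_operator, coeff_smul_operator, LinearMap.sum_apply, LinearMap.sum_apply, map_sum]
  refine sum_congr rfl fun z _ => ?_
  rw [LinearMap.smul_apply, LinearMap.smul_apply, map_smul, h]

theorem Intertwines.C {x : Module.End ℂ M} {y : Module.End ℂ M'} (h : ∀ v, T (x v) = y (T v)) :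
    Intertwines T (PowerSeries.C x) (PowerSeries.C y) := fun n v => by
  rw [PowerSeries.coeff_C, PowerSeries.coeff_C]
  split_ifs
  · exact h v
  · simp

theorem Intertwines.hop {q : ℕ+ → (Module.End ℂ M)⟦X⟧} {q' : ℕ+ → (Module.End ℂ M')⟦X⟧}
    (h : ∀ k, Intertwines T (q k) (q' k)) (n : ℕ) : Intertwines T (hop q n) (hop q' n) := by
  refine hop_rel {p : (Module.End ℂ M)⟦X⟧ × (Module.End ℂ M')⟦X⟧ | Intertwines T p.1 p.2} q q'
    ?_ ?_ ?_ ?_ ?_ n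
  · exact Intertwines.C (x := 1) (y := 1) fun v => rfl
  · intro a ha b hb n v
    simp only [Prod.fst_add, Prod.snd_add, map_add, LinearMap.add_apply]
    rw [ha n v, hb n v]
  · intro n v
    simp
  · intro c a ha n v
    simp only [Prod.smul_fst, Prod.smul_snd, coeff_const_smul, map_smul, LinearMap.smul_apply]
    rw [ha n v]
  · intro k a ha
    exact (h k).mul ha

theorem intertwines_hop {q : ℕ+ → Module.End ℂ M} {q' : ℕ+ → Module.End ℂ M'}
    (h : ∀ k v, T (q k v) = q' k (T v)) (n : ℕ) (v : M) :
    T (hop q n v) = hop q' n (T v) := by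
  refine hop_rel {p : Module.End ℂ M × Module.End ℂ M' | ∀ v, T (p.1 v) = p.2 (T v)} q q'
    ?_ ?_ ?_ ?_ ?_ n v
  · exact fun v => rfl
  · intro a ha b hb v
    simp only [Prod.fst_add, Prod.snd_add, map_add, LinearMap.add_apply]
    rw [ha v, hb v]
  · intro v
    simp
  · intro c a ha v
    simp only [Prod.smul_fst, Prod.smul_snd, map_smul, LinearMap.smul_apply]
    rw [ha v]
  · intro k a ha v
    simp only [Prod.fst_mul, Prod.snd_mul, Module.End.mul_apply]
    rw [h k, ha v]

end Filtered

/-! ### Transport of Heisenberg relations along homomorphisms and changes of variables. -/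

theorem Heisenberg.map {A A' : Type*} [Ring A] [Ring A'] {a a' d d' : ℕ+ → A}
    [Algebra ℂ A] (H : Heisenberg a a' d d') (g : A →+* A') :
    Heisenberg (fun k => g (a k)) (fun k => g (a' k)) (fun k => g (d k)) (fun k => g (d' k)) where
  aa k l := (H.aa k l).map g
  aa' k l := (H.aa' k l).map g
  a'a' k l := (H.a'a' k l).map g
  dd k l := (H.dd k l).map g
  dd' k l := (H.dd' k l).map g
  d'd' k l := (H.d'd' k l).map g
  da' k l := (H.da' k l).map g
  d'a k l := (H.d'a k l).map g
  da k l h := (H.da k l h).map g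
  d'a'_of_ne k l h := (H.d'a'_of_ne k l h).map g
  da_self k := by rw [← map_mul, H.da_self, map_add, map_mul, map_one]
  d'a'_self k := by rw [← map_mul, H.d'a'_self, map_add, map_mul, map_one]

theorem half_sum_commutator {A : Type*} [Ring A] [Algebra ℂ A] {u w p q : A}
    (hp : u * p = p * u + 1) (hq : w * q = q * w + 1) (huq : u * q = q * u) (hwp : w * p = p * w) :
    ((2⁻¹ : ℂ) • (u + w)) * (p + q) = (p + q) * ((2⁻¹ : ℂ) • (u + w)) + 1 := by
  have h1 : (1 : A) = (2⁻¹ : ℂ) • (1 + 1) := by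
    rw [← two_smul ℂ (1 : A), inv_smul_smul₀ two_ne_zero]
  rw [h1, smul_mul_assoc, mul_smul_comm, ← smul_add]
  congr 1
  rw [add_mul, mul_add, mul_add, hp, hq, huq, hwp, add_mul, mul_add, mul_add]
  abel

/-- A linear change of variables in a Heisenberg algebra. -/
theorem Heisenberg.rotate {A : Type*} [Ring A] [Algebra ℂ A] {x y dx dy : ℕ+ → A}
    (H : Heisenberg x y dx dy) {ε : ℂ} (hε : ε ≠ 0) :
    Heisenberg (fun k => x k + ε • y k) (fun k => x k - ε • y k)
      (fun k => (2⁻¹ : ℂ) • (dx k + ε⁻¹ • dy k)) (fun k => (2⁻¹ : ℂ) • (dx k - ε⁻¹ • dy k)) := by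
  have e1 : ∀ k, dx k * (ε • y k) = (ε • y k) * dx k := fun k =>
    ((H.da' k k).smul_right ε).eq
  have e2 : ∀ k, (ε⁻¹ • dy k) * x k = x k * (ε⁻¹ • dy k) := fun k =>
    ((H.d'a k k).smul_left ε⁻¹).eq
  have e3 : ∀ k, (ε⁻¹ • dy k) * (ε • y k) = (ε • y k) * (ε⁻¹ • dy k) + 1 := fun k => by
    rw [smul_mul_smul_comm, smul_mul_smul_comm, H.d'a'_self, smul_add, inv_mul_cancel₀ hε,
      mul_inv_cancel₀ hε, one_smul, one_smul]
  have cx : ∀ k l, Commute (x k) (ε • y l) := fun k l => (H.aa' k l).smul_right _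
  have cy : ∀ k l, Commute (ε • y k) (ε • y l) := fun k l => ((H.a'a' k l).smul_right _).smul_left _
  have cdx : ∀ k l, Commute (dx k) (ε⁻¹ • dy l) := fun k l => (H.dd' k l).smul_right _
  have cdy : ∀ k l, Commute (ε⁻¹ • dy k) (ε⁻¹ • dy l) := fun k l =>
    ((H.d'd' k l).smul_right _).smul_left _
  have cxy : ∀ k l, Commute (dx k) (ε • y l) := fun k l => (H.da' k l).smul_right _
  have cyx : ∀ k l, Commute (ε⁻¹ • dy k) (x l) := fun k l => (H.d'a k l).smul_left _
  have cyy : ∀ k l, k ≠ l → Commute (ε⁻¹ • dy k) (ε • y l) := fun k l h =>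
    ((H.d'a'_of_ne k l h).smul_right _).smul_left _
  -- The mixed commutators vanish because the contributions of the pairs `(dx, x)` and `(ε⁻¹ dy, ε
  -- y)` are equal and enter with opposite signs.
  have key : ∀ {k l : ℕ+}, dx k * (ε • y l) = (ε • y l) * dx k →
      (ε⁻¹ • dy k) * x l = x l * (ε⁻¹ • dy k) →
      dx k * x l - x l * dx k = (ε⁻¹ • dy k) * (ε • y l) - (ε • y l) * (ε⁻¹ • dy k) →
      Commute ((2⁻¹ : ℂ) • (dx k + ε⁻¹ • dy k)) (x l - ε • y l) ∧
      Commute ((2⁻¹ : ℂ) • (dx k - ε⁻¹ • dy k)) (x l + ε • y l) := by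
    intro k l h1 h2 h3
    refine ⟨Commute.smul_left ?_ _, Commute.smul_left ?_ _⟩
    · rw [Commute, SemiconjBy, add_mul, mul_sub, mul_sub, h1, h2, sub_mul, mul_add, mul_add,
        ← sub_eq_zero, ← sub_eq_zero.2 h3]
      abel
    · rw [Commute, SemiconjBy, sub_mul, mul_add, mul_add, h1, h2, add_mul, mul_sub, mul_sub,
        ← sub_eq_zero, ← sub_eq_zero.2 h3]
      abel
  have key' : ∀ k l, Commute ((2⁻¹ : ℂ) • (dx k + ε⁻¹ • dy k)) (x l - ε • y l) ∧
      Commute ((2⁻¹ : ℂ) • (dx k - ε⁻¹ • dy k)) (x l + ε • y l) := by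
    intro k l
    refine key (cxy k l).eq (cyx k l).eq ?_
    by_cases h : k = l
    · subst h
      rw [e3, H.da_self]
      abel
    · rw [(H.da k l h).eq, (cyy k l h).eq, sub_self, sub_self]
  constructor
  · exact fun k l => ((H.aa k l).add_right (cx k l)).add_left ((cx l k).symm.add_right (cy k l))
  · exact fun k l => ((H.aa k l).sub_right (cx k l)).add_left ((cx l k).symm.sub_right (cy k l))
  · exact fun k l => ((H.aa k l).sub_right (cx k l)).sub_left ((cx l k).symm.sub_right (cy k l))
  · exact fun k l => ((((H.dd k l).add_right (cdx k l)).add_left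
      ((cdx l k).symm.add_right (cdy k l))).smul_left _).smul_right _
  · exact fun k l => ((((H.dd k l).sub_right (cdx k l)).add_left
      ((cdx l k).symm.sub_right (cdy k l))).smul_left _).smul_right _
  · exact fun k l => ((((H.dd k l).sub_right (cdx k l)).sub_left
      ((cdx l k).symm.sub_right (cdy k l))).smul_left _).smul_right _
  · exact fun k l => (key' k l).1
  · exact fun k l => (key' k l).2
  · exact fun k l h => (((H.da k l h).add_right (cxy k l)).add_left
      ((cyx k l).add_right (cyy k l h))).smul_left _
  · exact fun k l h => (((H.da k l h).sub_right (cxy k l)).sub_left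
      ((cyx k l).sub_right (cyy k l h))).smul_left _
  · exact fun k => half_sum_commutator (H.da_self k) (e3 k) (e1 k) (e2 k)
  · intro k
    have := half_sum_commutator (H.da_self k) (by rw [neg_mul_neg, neg_mul_neg, e3 k])
      (show dx k * -(ε • y k) = -(ε • y k) * dx k by rw [mul_neg, neg_mul, e1])
      (show -(ε⁻¹ • dy k) * x k = x k * -(ε⁻¹ • dy k) by rw [mul_neg, neg_mul, e2])
    simpa only [← sub_eq_add_neg] using this

end DiskSFT

end

noncomputable section

namespace DiskSFT

open Finset hiding mk antidiagonal mem_antidiagonal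
open Finset.HasAntidiagonal hiding mk
open MvPowerSeries (coeff pderiv)

theorem pderiv_mul {σ R : Type*} [CommRing R] (k : σ) (f g : MvPowerSeries σ R) :
    pderiv R k (f * g) = f * pderiv R k g + pderiv R k f * g := by
  rw [Derivation.leibniz, smul_eq_mul, smul_eq_mul, mul_comm g]

theorem pderiv_const_smul {σ R : Type*} [CommRing R] (k : σ) (c : R) (f : MvPowerSeries σ R) :
    pderiv R k (c • f) = c • pderiv R k f := (pderiv R k).map_smul c f

/-! ### Operators on formal power series in one and in two sequences of variables -/

/-- Formal power series in `p₁, p₂, …`. -/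
abbrev Fock := MvPowerSeries ℕ+ ℂ

/-- Formal power series in `y₁, y₂, …` whose coefficients are formal power series in
`x₁, x₂, …`. -/
abbrev DoubleFock := MvPowerSeries ℕ+ Fock

theorem multiIndex_induction {P : (ℕ+ →₀ ℕ) → Prop} (h0 : P 0)
    (hs : ∀ b k, P b → P (b + Finsupp.single k 1)) (a : ℕ+ →₀ ℕ) : P a := by
  induction hn : wt a using Nat.strong_induction_on generalizing a with
  | _ n ih =>
    by_cases ha : a = 0
    · exact ha ▸ h0
    · obtain ⟨k, hk⟩ := Finsupp.ne_iff.1 ha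
      have h1 := sub_single_add_single hk
      rw [← h1]
      refine hs _ _ (ih _ ?_ _ rfl)
      have h2 := congrArg wt h1
      rw [wt_add, wt_single] at h2
      have := k.pos
      omega

/-- The elements of order at least `N`. -/
def fockOrder (N : ℕ) : Submodule ℂ Fock where
  carrier := {f | ∀ m, wt m < N → coeff m f = 0}
  add_mem' hf hg m hm := by rw [map_add, hf m hm, hg m hm, add_zero]
  zero_mem' m _ := map_zero _
  smul_mem' c f hf m hm := by rw [map_smul, hf m hm, smul_zero]

/-- The elements of order at least `N`. -/
def doubleOrder (N : ℕ) : Submodule ℂ DoubleFock where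
  carrier := {f | ∀ m n, wt m + wt n < N → coeff n (coeff m f) = 0}
  add_mem' hf hg m n hm := by rw [map_add, map_add, hf m n hm, hg m n hm, add_zero]
  zero_mem' m n _ := by rw [map_zero, map_zero]
  smul_mem' c f hf m n hm := by
    rw [show coeff m (c • f) = c • coeff m f from rfl, map_smul, hf m n hm, smul_zero]

theorem doubleOrder_antitone : Antitone doubleOrder := fun _ _ h _ hf m n hm =>
  hf m n (lt_of_lt_of_le hm h)

theorem doubleOrder_zero : doubleOrder 0 = ⊤ :=
  eq_top_iff.2 fun _ _ _ _ h => absurd h (Nat.not_lt_zero _)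

/-- The filtration is separated, so identities between infinite sums can be checked modulo each
order. -/
theorem eq_zero_of_forall_mem_doubleOrder {f : DoubleFock} (h : ∀ N, f ∈ doubleOrder N) : f = 0 := by
  ext m n
  exact h _ m n (Nat.lt_succ_self _)

/-- Multiplication by `p_k`. -/
def mulX (k : ℕ+) : Module.End ℂ Fock := LinearMap.mulLeft ℂ (MvPowerSeries.X k)

/-- Differentiation with respect to `p_k`. -/
def derivX (k : ℕ+) : Module.End ℂ Fock := (pderiv ℂ k).toLinearMap

/-- Multiplication by `x_k`. -/
def mulInner (k : ℕ+) : Module.End ℂ DoubleFock :=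
  LinearMap.mulLeft ℂ (MvPowerSeries.C (MvPowerSeries.X k))

/-- Multiplication by `y_k`. -/
def mulOuter (k : ℕ+) : Module.End ℂ DoubleFock := LinearMap.mulLeft ℂ (MvPowerSeries.X k)

/-- Differentiation with respect to `x_k`. -/
def derivInner (k : ℕ+) : Module.End ℂ DoubleFock where
  toFun f := fun m => pderiv ℂ k (coeff m f)
  map_add' f g := by
    ext m : 1
    exact (congrArg _ (map_add (coeff m) f g)).trans (map_add (pderiv ℂ k) _ _)
  map_smul' c f := by
    ext m : 1
    exact (pderiv ℂ k).map_smul c (coeff m f)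

/-- Differentiation with respect to `y_k`. -/
def derivOuter (k : ℕ+) : Module.End ℂ DoubleFock where
  toFun f := pderiv Fock k f
  map_add' f g := map_add _ f g
  map_smul' c f := by
    ext m : 1
    rw [MvPowerSeries.coeff_pderiv]
    exact (smul_mul_assoc c _ _).trans (congrArg _ (MvPowerSeries.coeff_pderiv f m).symm)

theorem mulX_apply (k : ℕ+) (f : Fock) : mulX k f = MvPowerSeries.X k * f := rfl

theorem derivX_apply (k : ℕ+) (f : Fock) : derivX k f = pderiv ℂ k f := rfl

theorem mulInner_apply (k : ℕ+) (f : DoubleFock) :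
    mulInner k f = MvPowerSeries.C (MvPowerSeries.X k) * f := rfl

theorem mulOuter_apply (k : ℕ+) (f : DoubleFock) :
    mulOuter k f = MvPowerSeries.X k * f := rfl

theorem derivOuter_apply (k : ℕ+) (f : DoubleFock) : derivOuter k f = pderiv Fock k f := rfl

theorem coeff_derivInner (k : ℕ+) (f : DoubleFock) (m : ℕ+ →₀ ℕ) :
    coeff m (derivInner k f) = pderiv ℂ k (coeff m f) := rfl

theorem coeff_mulInner (k : ℕ+) (f : DoubleFock) (m : ℕ+ →₀ ℕ) :
    coeff m (mulInner k f) = MvPowerSeries.X k * coeff m f := by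
  rw [mulInner_apply, MvPowerSeries.coeff_C_mul]

theorem coeff_const_smul_double (c : ℂ) (f : DoubleFock) (m : ℕ+ →₀ ℕ) :
    coeff m (c • f) = c • coeff m f := rfl

theorem pderiv_comm {σ R : Type*} [CommRing R] (k l : σ) (f : MvPowerSeries σ R) :
    pderiv R k (pderiv R l f) = pderiv R l (pderiv R k f) := by
  classical
  by_cases h : k = l
  · rw [h]
  · ext m
    simp only [MvPowerSeries.coeff_pderiv]
    rw [add_right_comm]
    simp [h, Ne.symm h]
    ring

theorem derivInner_mul (k : ℕ+) (f g : DoubleFock) :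
    derivInner k (f * g) = f * derivInner k g + derivInner k f * g := by
  classical
  ext m : 1
  rw [coeff_derivInner, MvPowerSeries.coeff_mul, map_sum, map_add, MvPowerSeries.coeff_mul,
    MvPowerSeries.coeff_mul, ← sum_add_distrib]
  refine sum_congr rfl fun x _ => ?_
  rw [pderiv_mul, coeff_derivInner, coeff_derivInner]

theorem derivOuter_mul (k : ℕ+) (f g : DoubleFock) :
    derivOuter k (f * g) = f * derivOuter k g + derivOuter k f * g := pderiv_mul k f g

theorem pderiv_mul_X_self {σ R : Type*} [CommRing R] (k : σ) (f : MvPowerSeries σ R) :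
    pderiv R k (MvPowerSeries.X k * f) = MvPowerSeries.X k * pderiv R k f + f := by
  rw [Derivation.leibniz, MvPowerSeries.pderiv_X_self, smul_eq_mul, smul_eq_mul, mul_one]

theorem pderiv_mul_X_of_ne {σ R : Type*} [CommRing R] {k l : σ} (h : k ≠ l)
    (f : MvPowerSeries σ R) :
    pderiv R k (MvPowerSeries.X l * f) = MvPowerSeries.X l * pderiv R k f := by
  rw [Derivation.leibniz, MvPowerSeries.pderiv_X_of_ne h.symm, smul_zero, smul_eq_mul, add_zero]

theorem heisenberg_double : Heisenberg mulInner mulOuter derivInner derivOuter where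
  aa k l := LinearMap.ext fun f => mul_left_comm _ _ _
  aa' k l := LinearMap.ext fun f => mul_left_comm _ _ _
  a'a' k l := LinearMap.ext fun f => mul_left_comm _ _ _
  dd k l := LinearMap.ext fun f => MvPowerSeries.ext fun m => pderiv_comm k l (coeff m f)
  dd' k l := LinearMap.ext fun f => by
    ext m : 1
    rw [Module.End.mul_apply, Module.End.mul_apply, coeff_derivInner, derivOuter_apply,
      derivOuter_apply, MvPowerSeries.coeff_pderiv, MvPowerSeries.coeff_pderiv, coeff_derivInner,
      Derivation.leibniz]
    simp [mul_comm]
  d'd' k l := LinearMap.ext fun f => pderiv_comm k l f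
  da' k l := LinearMap.ext fun f => by
    rw [Module.End.mul_apply, mulOuter_apply, derivInner_mul]
    have : derivInner k (MvPowerSeries.X l) = 0 := by
      classical
      ext m : 1
      rw [coeff_derivInner, MvPowerSeries.coeff_X]
      split_ifs <;> simp
    rw [this, zero_mul, add_zero]
    rfl
  d'a k l := LinearMap.ext fun f => by
    rw [Module.End.mul_apply, mulInner_apply, derivOuter_mul, derivOuter_apply _ (MvPowerSeries.C _),
      MvPowerSeries.pderiv_C, zero_mul, add_zero]
    rfl
  da k l h := LinearMap.ext fun f => by
    ext m : 1
    rw [Module.End.mul_apply, Module.End.mul_apply, coeff_derivInner, coeff_mulInner,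
      pderiv_mul_X_of_ne h, coeff_mulInner, coeff_derivInner]
  d'a'_of_ne k l h := LinearMap.ext fun f => pderiv_mul_X_of_ne h f
  da_self k := LinearMap.ext fun f => by
    ext m : 1
    rw [LinearMap.add_apply, map_add, Module.End.mul_apply, Module.End.mul_apply, coeff_derivInner,
      coeff_mulInner, pderiv_mul_X_self, coeff_mulInner, coeff_derivInner, Module.End.one_apply]
  d'a'_self k := LinearMap.ext fun f => pderiv_mul_X_self k f

theorem coeff_X_mul {σ R : Type*} [CommRing R] (k : σ) (f : MvPowerSeries σ R) (m : σ →₀ ℕ) :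
    coeff m (MvPowerSeries.X k * f) =
      if m k = 0 then 0 else coeff (m - Finsupp.single k 1) f := by
  classical
  rw [MvPowerSeries.X, MvPowerSeries.coeff_monomial_mul]
  by_cases h : m k = 0
  · rw [if_pos h, if_neg]
    intro hle
    have := hle k
    simp at this
    omega
  · rw [if_neg h, if_pos, one_mul]
    intro j
    by_cases hj : k = j
    · subst hj
      simp
      omega
    · simp [hj]

theorem wt_sub_single {m : ℕ+ →₀ ℕ} {k : ℕ+} (h : m k ≠ 0) :
    wt (m - Finsupp.single k 1) + k = wt m := by
  have := congrArg wt (sub_single_add_single h)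
  rwa [wt_add, wt_single, mul_one] at this

theorem hasDegree_mulInner (k : ℕ+) :
    HasDegree doubleOrder (k : ℕ) (PowerSeries.C (mulInner k)) :=
  HasDegree.C fun N N' f hN hf m n hmn => by
    rw [coeff_mulInner, coeff_X_mul]
    split_ifs with h
    · rfl
    · have := wt_sub_single h
      exact hf _ _ (by omega)

theorem hasDegree_mulOuter (k : ℕ+) :
    HasDegree doubleOrder (k : ℕ) (PowerSeries.C (mulOuter k)) :=
  HasDegree.C fun N N' f hN hf m n hmn => by
    rw [mulOuter_apply, coeff_X_mul]
    split_ifs with h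
    · exact map_zero _
    · have := wt_sub_single h
      exact hf _ _ (by omega)

theorem hasDegree_derivInner (k : ℕ+) :
    HasDegree doubleOrder (-(k : ℕ)) (PowerSeries.C (derivInner k)) :=
  HasDegree.C fun N N' f hN hf m n hmn => by
    rw [coeff_derivInner, MvPowerSeries.coeff_pderiv, hf, zero_mul]
    rw [wt_add, wt_single]
    omega

theorem hasDegree_derivOuter (k : ℕ+) :
    HasDegree doubleOrder (-(k : ℕ)) (PowerSeries.C (derivOuter k)) :=
  HasDegree.C fun N N' f hN hf m n hmn => by
    rw [derivOuter_apply, MvPowerSeries.coeff_pderiv,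
      show coeff (m + Finsupp.single k 1) f * ((m k : Fock) + 1) =
        ((m k + 1 : ℕ) : ℂ) • coeff (m + Finsupp.single k 1) f by
      rw [Algebra.smul_def, mul_comm]; simp, map_smul, hf, smul_zero]
    rw [wt_add, wt_single]
    omega

/-! ### The bilinear pairing of two series -/

theorem partialDeriv_add (a : ℕ+ →₀ ℕ) (f g : Fock) :
    partialDeriv a (f + g) = partialDeriv a f + partialDeriv a g := by
  ext m
  simp only [map_add]
  exact (congrArg _ (map_add _ _ _)).trans (mul_add _ _ _)

theorem partialDeriv_smul (a : ℕ+ →₀ ℕ) (c : ℂ) (f : Fock) :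
    partialDeriv a (c • f) = c • partialDeriv a f := by
  ext m
  rw [map_smul, smul_eq_mul]
  exact (congrArg _ (map_smul (coeff (m + a)) c f)).trans (mul_left_comm _ _ _)

/-- The operator `∂^a`. -/
def partialDerivL (a : ℕ+ →₀ ℕ) : Module.End ℂ Fock where
  toFun := partialDeriv a
  map_add' := partialDeriv_add a
  map_smul' := partialDeriv_smul a

theorem partialDeriv_pderiv (a : ℕ+ →₀ ℕ) (k : ℕ+) (f : Fock) :
    partialDeriv a (pderiv ℂ k f) = pderiv ℂ k (partialDeriv a f) := by
  induction a using multiIndex_induction with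
  | h0 => rw [partialDeriv_zero, partialDeriv_zero]
  | hs b l ih => rw [partialDeriv_add_single, ih, partialDeriv_add_single, pderiv_comm]

theorem coeff_shift (c : ℂ) (f : Fock) (a : ℕ+ →₀ ℕ) :
    coeff a (shift c f) = (a.prod fun _ n => c ^ n / (n ! : ℂ)) • partialDeriv a f := rfl

/-- The substitution `p = x + c y`. -/
def shiftL (c : ℂ) : Fock →ₗ[ℂ] DoubleFock where
  toFun := shift c
  map_add' f g := by
    ext a : 1
    rw [map_add, coeff_shift, partialDeriv_add, smul_add]
    rfl
  map_smul' r f := by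
    ext a : 1
    rw [coeff_shift, partialDeriv_smul, smul_comm]
    rfl

theorem derivOuter_shift (c : ℂ) (k : ℕ+) (f : Fock) :
    derivOuter k (shift c f) = c • shift c (pderiv ℂ k f) := by
  ext a : 1
  rw [derivOuter_apply, MvPowerSeries.coeff_pderiv, coeff_shift, coeff_const_smul_double,
    coeff_shift, partialDeriv_add_single, partialDeriv_pderiv,
    show ((a k : Fock) + 1) = algebraMap ℂ Fock ((a k + 1 : ℕ) : ℂ) by simp, mul_comm,
    ← Algebra.smul_def, smul_smul, smul_smul]
  congr 1
  refine prod_add_single (fun _ n => c ^ n / (n ! : ℂ)) (fun k => by simp) a k ?_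
  have : (a k + 1 : ℂ) ≠ 0 := by exact_mod_cast Nat.succ_ne_zero (a k)
  have h2 : ((a k)! : ℂ) ≠ 0 := by exact_mod_cast Nat.factorial_ne_zero _
  rw [Nat.factorial_succ]
  push_cast
  field_simp
  ring

theorem derivInner_shift (c : ℂ) (k : ℕ+) (f : Fock) :
    derivInner k (shift c f) = shift c (pderiv ℂ k f) := by
  ext a : 1
  rw [coeff_derivInner, coeff_shift, coeff_shift, partialDeriv_pderiv, pderiv_const_smul]

/-- This is `p_k = x_k + c y_k` under the substitution. A series in `y` is determined by its
constant term and its `y`-derivatives, so the coefficients are compared by induction,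
differentiating both sides with respect to `y_l`. -/
theorem shift_X_mul (c : ℂ) (k : ℕ+) (f : Fock) :
    shift c (MvPowerSeries.X k * f) = (mulInner k + c • mulOuter k) (shift c f) := by
  ext a : 1
  induction a using multiIndex_induction generalizing f with
  | h0 =>
    rw [LinearMap.add_apply, LinearMap.smul_apply, map_add, coeff_mulInner,
      coeff_const_smul_double, mulOuter_apply, coeff_X_mul, if_pos (Finsupp.zero_apply), coeff_shift, coeff_shift]
    simp [partialDeriv_zero]
  | hs b l ih =>
    have hs : ∀ g : DoubleFock, coeff (b + Finsupp.single l 1) g =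
        ((b l + 1 : ℕ) : ℂ)⁻¹ • coeff b (derivOuter l g) := by
      intro g
      have : ((b l + 1 : ℕ) : ℂ) ≠ 0 := by exact_mod_cast Nat.succ_ne_zero (b l)
      rw [derivOuter_apply, MvPowerSeries.coeff_pderiv,
        show ((b l : Fock) + 1) = algebraMap ℂ Fock ((b l + 1 : ℕ) : ℂ) by simp, mul_comm,
        ← Algebra.smul_def, inv_smul_smul₀ this]
    rw [hs, hs]
    congr 1
    have e1 : derivOuter l ((mulInner k + c • mulOuter k) (shift c f)) =
        (mulInner k + c • mulOuter k) (derivOuter l (shift c f)) +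
          if l = k then c • shift c f else 0 := by
      rw [LinearMap.add_apply, LinearMap.add_apply, map_add, LinearMap.smul_apply,
        LinearMap.smul_apply, map_smul]
      have h1 : derivOuter l (mulInner k (shift c f)) = mulInner k (derivOuter l (shift c f)) :=
        LinearMap.congr_fun (heisenberg_double.d'a l k).eq _
      rw [h1]
      split_ifs with h
      · subst h
        have h2 : derivOuter l (mulOuter l (shift c f)) =
            mulOuter l (derivOuter l (shift c f)) + shift c f :=
          LinearMap.congr_fun (heisenberg_double.d'a'_self l) _
        rw [h2, smul_add, add_assoc]
      · have h2 : derivOuter l (mulOuter k (shift c f)) = mulOuter k (derivOuter l (shift c f)) :=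
          LinearMap.congr_fun (heisenberg_double.d'a'_of_ne l k h).eq _
        rw [h2, add_zero]
    rw [e1, derivOuter_shift, derivOuter_shift, map_smul (mulInner k + c • mulOuter k), map_add, coeff_const_smul_double,
      coeff_const_smul_double, ← ih]
    split_ifs with h
    · subst h
      rw [pderiv_mul_X_self, coeff_const_smul_double, ← smul_add]
      congr 1
      exact congrArg (coeff b) (map_add (shiftL c) _ _)
    · rw [pderiv_mul_X_of_ne h, map_zero, add_zero]

/-- The product `τ(x + ε y) σ(x - ε y)`. -/
def pairing (ε : ℂ) : Fock →ₗ[ℂ] Fock →ₗ[ℂ] DoubleFock :=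
  (LinearMap.mul ℂ DoubleFock).compl₁₂ (shiftL ε) (shiftL (-ε))

theorem pairing_apply (ε : ℂ) (τ σ : Fock) : pairing ε τ σ = shift ε τ * shift (-ε) σ := rfl

/-- Multiplication by the variables of the first factor. -/
def mulFst (ε : ℂ) (k : ℕ+) : Module.End ℂ DoubleFock := mulInner k + ε • mulOuter k

/-- Multiplication by the variables of the second factor. -/
def mulSnd (ε : ℂ) (k : ℕ+) : Module.End ℂ DoubleFock := mulInner k - ε • mulOuter k

/-- Differentiation with respect to the variables of the first factor. -/
def derivFst (ε : ℂ) (k : ℕ+) : Module.End ℂ DoubleFock :=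
  (2⁻¹ : ℂ) • (derivInner k + ε⁻¹ • derivOuter k)

/-- Differentiation with respect to the variables of the second factor. -/
def derivSnd (ε : ℂ) (k : ℕ+) : Module.End ℂ DoubleFock :=
  (2⁻¹ : ℂ) • (derivInner k - ε⁻¹ • derivOuter k)

theorem heisenberg_fst_snd {ε : ℂ} (hε : ε ≠ 0) :
    Heisenberg (mulFst ε) (mulSnd ε) (derivFst ε) (derivSnd ε) :=
  heisenberg_double.rotate hε

theorem pairing_mulX_fst (ε : ℂ) (k : ℕ+) (τ σ : Fock) :
    pairing ε (mulX k τ) σ = mulFst ε k (pairing ε τ σ) := by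
  rw [pairing_apply, mulX_apply, shift_X_mul, pairing_apply, mulFst, LinearMap.add_apply,
    LinearMap.add_apply, LinearMap.smul_apply, LinearMap.smul_apply, mulInner_apply, mulOuter_apply,
    mulInner_apply, mulOuter_apply, add_mul, smul_mul_assoc, mul_assoc, mul_assoc]

theorem pairing_mulX_snd (ε : ℂ) (k : ℕ+) (τ σ : Fock) :
    pairing ε τ (mulX k σ) = mulSnd ε k (pairing ε τ σ) := by
  rw [pairing_apply, mulX_apply, shift_X_mul, pairing_apply, mulSnd, LinearMap.add_apply,
    LinearMap.sub_apply, LinearMap.smul_apply, LinearMap.smul_apply, mulInner_apply, mulOuter_apply,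
    mulInner_apply, mulOuter_apply, mul_add, mul_smul_comm, mul_left_comm, mul_left_comm (shift ε τ),
    neg_smul, sub_eq_add_neg]

/-- For `p = x + εy` and `p' = x - εy` one has `∂_x = ∂_p + ∂_p'` and `ε⁻¹ ∂_y = ∂_p - ∂_p'`, so
half of the sum differentiates the first factor only. -/
theorem pairing_derivX_fst {ε : ℂ} (hε : ε ≠ 0) (k : ℕ+) (τ σ : Fock) :
    pairing ε (derivX k τ) σ = derivFst ε k (pairing ε τ σ) := by
  rw [derivFst, LinearMap.smul_apply, LinearMap.add_apply, LinearMap.smul_apply, pairing_apply,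
    pairing_apply, derivInner_mul, derivOuter_mul, derivInner_shift, derivInner_shift,
    derivOuter_shift, derivOuter_shift, derivX_apply, eq_inv_smul_iff₀ two_ne_zero]
  simp only [mul_smul_comm, smul_mul_assoc, smul_add, smul_neg, smul_smul, mul_neg, inv_mul_cancel₀ hε,
    neg_smul, one_smul, two_smul]
  abel

theorem pairing_derivX_snd {ε : ℂ} (hε : ε ≠ 0) (k : ℕ+) (τ σ : Fock) :
    pairing ε τ (derivX k σ) = derivSnd ε k (pairing ε τ σ) := by
  rw [derivSnd, LinearMap.smul_apply, LinearMap.sub_apply, LinearMap.smul_apply, pairing_apply,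
    pairing_apply, derivInner_mul, derivOuter_mul, derivInner_shift, derivInner_shift,
    derivOuter_shift, derivOuter_shift, derivX_apply, eq_inv_smul_iff₀ two_ne_zero]
  simp only [mul_smul_comm, smul_mul_assoc, smul_add, smul_neg, smul_smul, mul_neg, inv_mul_cancel₀ hε,
    neg_smul, one_smul, two_smul]
  abel

theorem shift_mem_doubleOrder (c : ℂ) {N : ℕ} {f : Fock} (hf : f ∈ fockOrder N) :
    shift c f ∈ doubleOrder N := fun m n h => by
  rw [coeff_shift, map_smul]
  have : coeff n (partialDeriv m f) = 0 := by
    refine (congrArg _ (hf _ ?_)).trans (mul_zero _)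
    rwa [wt_add, add_comm]
  rw [this, smul_zero]

theorem mul_mem_doubleOrder {N : ℕ} {f : DoubleFock} (hf : f ∈ doubleOrder N) (g : DoubleFock) :
    f * g ∈ doubleOrder N := fun m n h => by
  classical
  rw [MvPowerSeries.coeff_mul, map_sum]
  refine sum_eq_zero fun x hx => ?_
  rw [MvPowerSeries.coeff_mul]
  refine sum_eq_zero fun y hy => ?_
  have h1 := congrArg wt (mem_antidiagonal.1 hx)
  have h2 := congrArg wt (mem_antidiagonal.1 hy)
  rw [wt_add] at h1 h2
  rw [hf _ _ (by omega), zero_mul]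

theorem pairing_mem_doubleOrder_fst (ε : ℂ) {N : ℕ} {τ : Fock} (h : τ ∈ fockOrder N) (σ : Fock) :
    pairing ε τ σ ∈ doubleOrder N := mul_mem_doubleOrder (shift_mem_doubleOrder _ h) _

theorem pairing_mem_doubleOrder_snd (ε : ℂ) {N : ℕ} (τ : Fock) {σ : Fock} (h : σ ∈ fockOrder N) :
    pairing ε τ σ ∈ doubleOrder N := by
  rw [pairing_apply, mul_comm]
  exact mul_mem_doubleOrder (shift_mem_doubleOrder _ h) _

end DiskSFT

end

noncomputable section

namespace DiskSFT

open Finset hiding mk antidiagonal mem_antidiagonal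
open Finset.HasAntidiagonal hiding mk
open MvPowerSeries (coeff pderiv)

/-! ### The bilinear operator -/

/-- The power series `exp (c z)`. -/
def expSeries (c : ℂ) : ℂ⟦X⟧ := PowerSeries.rescale c (PowerSeries.exp ℂ)

theorem expSeries_mul (c d : ℂ) : expSeries c * expSeries d = expSeries (c + d) :=
  PowerSeries.exp_mul_exp_eq_exp_add c d

theorem expSeries_zero : expSeries 0 = 1 := by
  rw [expSeries, PowerSeries.rescale_zero]
  simp

theorem expSeries_pow (c : ℂ) (k : ℕ) : expSeries c ^ k = expSeries (k * c) := by
  induction k with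
  | zero => simp [expSeries_zero]
  | succ k ih =>
    rw [pow_succ, ih, expSeries_mul]
    congr 1
    push_cast
    ring

theorem expSeries_mul_neg (c : ℂ) : expSeries c * expSeries (-c) = 1 := by
  rw [expSeries_mul, add_neg_cancel, expSeries_zero]

theorem coeff_expSeries (c : ℂ) (n : ℕ) : PowerSeries.coeff n (expSeries c) = c ^ n / (n ! : ℂ) := by
  rw [expSeries, PowerSeries.coeff_rescale, PowerSeries.coeff_exp]
  simp [div_eq_mul_inv]

/-- `k z s(k ε z) = (exp (k ε z / 2) - exp (-k ε z / 2)) / ε`. -/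
theorem natCast_mul_sSeries {ε : ℂ} (hε : ε ≠ 0) (k : ℕ) :
    (k : ℂ) • (PowerSeries.X * sSeries (ε ^ 2 * (k : ℂ) ^ 2)) =
      PowerSeries.C ε⁻¹ * (expSeries (ε / 2) ^ k - expSeries (-(ε / 2)) ^ k) := by
  ext n
  rw [PowerSeries.coeff_C_mul, map_sub, expSeries_pow, expSeries_pow, coeff_expSeries,
    coeff_expSeries, PowerSeries.coeff_smul]
  cases n with
  | zero => simp
  | succ n =>
    rw [PowerSeries.coeff_succ_X_mul, sSeries, PowerSeries.coeff_mk, mul_neg]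
    have hf : ((n + 1)! : ℂ) ≠ 0 := by exact_mod_cast Nat.factorial_ne_zero _
    split_ifs with hn
    · obtain ⟨m, rfl⟩ := hn
      rw [Odd.neg_pow (by exact ⟨m, by ring⟩), show (m + m) / 2 = m by omega, smul_eq_mul]
      rw [show (k : ℂ) * (ε / 2) = k * ε / 2 by ring, div_pow]
      field_simp
      ring
    · rw [Even.neg_pow (Nat.even_add_one.2 hn), sub_self, mul_zero, smul_zero]

/-- Homogeneous components of the bilinear operator `∑_j h_j(-2y) h_{j+1}(∂_y, 2 ∂_y, …)`. -/
def kpTerm (j : ℕ) : Module.End ℂ DoubleFock :=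
  hop (fun k => (-2 : ℂ) • mulOuter k) j * hop (fun k => ((k : ℕ) : ℂ) • derivOuter k) (j + 1)

/-- The bilinear operator `∑_j h_j(-2y) h_{j+1}(∂_y, 2 ∂_y, …)`. -/
def kpBilinear : Module.End ℂ DoubleFock where
  -- The cutoff loses nothing: the `j`-th term has order at least `j`, by `kpTerm_mem`.
  toFun f := fun m n => ∑ j ∈ range (wt m + wt n + 1), coeff n (coeff m (kpTerm j f))
  map_add' f g := by
    ext m n
    change ∑ j ∈ range (wt m + wt n + 1), coeff n (coeff m (kpTerm j (f + g))) =
      ∑ j ∈ range (wt m + wt n + 1), coeff n (coeff m (kpTerm j f)) +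
      ∑ j ∈ range (wt m + wt n + 1), coeff n (coeff m (kpTerm j g))
    simp only [map_add, sum_add_distrib]
  map_smul' c f := by
    ext m n
    change ∑ j ∈ range (wt m + wt n + 1), coeff n (coeff m (kpTerm j (c • f))) =
      c * ∑ j ∈ range (wt m + wt n + 1), coeff n (coeff m (kpTerm j f))
    simp only [map_smul, coeff_const_smul_double, mul_sum, smul_eq_mul]

theorem coeff_kpBilinear (f : DoubleFock) (m n : ℕ+ →₀ ℕ) :
    coeff n (coeff m (kpBilinear f)) =
      ∑ j ∈ range (wt m + wt n + 1), coeff n (coeff m (kpTerm j f)) := rfl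

/-- Components of the vertex operator on one factor. -/
def vertexOp {M : Type*} [AddCommGroup M] [Module ℂ M] (ε : ℂ) (a d : ℕ+ → Module.End ℂ M)
    (i : ℕ) : (Module.End ℂ M)⟦X⟧ :=
  vertexTerm (R := ℂ⟦X⟧) (PowerSeries.C ε) (PowerSeries.C ε⁻¹) (expSeries (ε / 2))
    (expSeries (-(ε / 2))) (fun k => PowerSeries.C (a k)) (fun k => PowerSeries.C (d k)) i

theorem C_const_smul {M : Type*} [AddCommGroup M] [Module ℂ M] (c : ℂ) (x : Module.End ℂ M) :
    (PowerSeries.C (c • x) : (Module.End ℂ M)⟦X⟧) = c • PowerSeries.C x := by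
  rw [← C_smul_operator, C_smul_C_operator]

theorem C_hop {M : Type*} [AddCommGroup M] [Module ℂ M] (q : ℕ+ → Module.End ℂ M) (n : ℕ) :
    (PowerSeries.C (hop q n) : (Module.End ℂ M)⟦X⟧) = hop (fun k => PowerSeries.C (q k)) n :=
  map_hop PowerSeries.C C_const_smul q n

theorem inv_smul_sub_sub_add {A : Type*} [Ring A] [Algebra ℂ A] {ε : ℂ} (hε : ε ≠ 0) (x y : A) :
    ε⁻¹ • ((x - ε • y) - (x + ε • y)) = (-2 : ℂ) • y := by
  rw [show (x - ε • y) - (x + ε • y) = ε • (-2 : ℂ) • y by module, inv_smul_smul₀ hε]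

theorem smul_half_add_sub_half_sub {A : Type*} [Ring A] [Algebra ℂ A] {ε : ℂ} (hε : ε ≠ 0) (c : ℂ)
    (x y : A) : (ε * c) • ((2⁻¹ : ℂ) • (x + ε⁻¹ • y) - (2⁻¹ : ℂ) • (x - ε⁻¹ • y)) = c • y := by
  rw [show (2⁻¹ : ℂ) • (x + ε⁻¹ • y) - (2⁻¹ : ℂ) • (x - ε⁻¹ • y) = ε⁻¹ • y by module, smul_smul,
    mul_right_comm, mul_inv_cancel₀ hε, one_mul]

theorem HasDegree.sub {M : Type*} [AddCommGroup M] [Module ℂ M] {I : ℕ → Submodule ℂ M} {d : ℤ}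
    {x y : (Module.End ℂ M)⟦X⟧} (hx : HasDegree I d x) (hy : HasDegree I d y) :
    HasDegree I d (x - y) := fun n N N' v h hv => by
  rw [map_sub, LinearMap.sub_apply]
  exact (I N').sub_mem (hx n N N' v h hv) (hy n N N' v h hv)

/-- In the coordinates `p = x + εy`, `p' = x - εy` one has `ε⁻¹ (p' - p) = -2y` and `ε (∂_p - ∂_p')
= ∂_y`. This places the KP operator in the abstract setting with `e = ε` and `f = ε⁻¹`. -/
theorem C_kpTerm_eq_bilinTerm {ε : ℂ} (hε : ε ≠ 0) (j : ℕ) :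
    (PowerSeries.C (kpTerm j) : (Module.End ℂ DoubleFock)⟦X⟧) =
      bilinTerm (R := ℂ⟦X⟧) (PowerSeries.C ε) (PowerSeries.C ε⁻¹)
        (fun k => PowerSeries.C (mulFst ε k)) (fun k => PowerSeries.C (mulSnd ε k))
        (fun k => PowerSeries.C (derivFst ε k)) (fun k => PowerSeries.C (derivSnd ε k)) j := by
  rw [kpTerm, map_mul, C_hop, C_hop, bilinTerm, bilinUp, bilinDown]
  congr 2
  · funext k
    rw [← map_sub, C_smul_C_operator]
    congr 1
    exact (inv_smul_sub_sub_add hε (mulInner k) (mulOuter k)).symm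
  · funext k
    rw [← map_sub, show (PowerSeries.C ε * ((k : ℕ) : ℂ⟦X⟧)) = PowerSeries.C (ε * (k : ℕ)) by simp,
      C_smul_C_operator]
    congr 1
    exact (smul_half_add_sub_half_sub hε ((k : ℕ) : ℂ) (derivInner k) (derivOuter k)).symm

theorem hasDegree_mulFst (ε : ℂ) (k : ℕ+) :
    HasDegree doubleOrder (k : ℕ) (PowerSeries.C (mulFst ε k)) := by
  rw [mulFst, map_add, C_const_smul]
  exact (hasDegree_mulInner k).add ((hasDegree_mulOuter k).smul' _)

theorem hasDegree_mulSnd (ε : ℂ) (k : ℕ+) :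
    HasDegree doubleOrder (k : ℕ) (PowerSeries.C (mulSnd ε k)) := by
  rw [mulSnd, map_sub, C_const_smul]
  exact (hasDegree_mulInner k).sub ((hasDegree_mulOuter k).smul' _)

theorem hasDegree_derivFst (ε : ℂ) (k : ℕ+) :
    HasDegree doubleOrder (-(k : ℕ)) (PowerSeries.C (derivFst ε k)) := by
  rw [derivFst, C_const_smul, map_add, C_const_smul]
  exact ((hasDegree_derivInner k).add ((hasDegree_derivOuter k).smul' _)).smul' _

theorem hasDegree_derivSnd (ε : ℂ) (k : ℕ+) :
    HasDegree doubleOrder (-(k : ℕ)) (PowerSeries.C (derivSnd ε k)) := by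
  rw [derivSnd, C_const_smul, map_sub, C_const_smul]
  exact ((hasDegree_derivInner k).sub ((hasDegree_derivOuter k).smul' _)).smul' _

theorem hasDegree_hop_up {q : ℕ+ → Module.End ℂ DoubleFock}
    (hq : ∀ k : ℕ+, HasDegree doubleOrder (k : ℕ) (PowerSeries.C (q k))) (c : ℕ+ → ℂ⟦X⟧) (n : ℕ) :
    HasDegree doubleOrder n (hop (fun k => c k • (PowerSeries.C (q k) :
      (Module.End ℂ DoubleFock)⟦X⟧)) n) := by
  simpa only [one_mul] using HasDegree.hop (c := 1) doubleOrder_antitone doubleOrder_zero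
    (fun k => by rw [one_mul]; exact (hq k).smul (c k)) n

theorem hasDegree_hop_down {q : ℕ+ → Module.End ℂ DoubleFock}
    (hq : ∀ k : ℕ+, HasDegree doubleOrder (-(k : ℕ)) (PowerSeries.C (q k))) (c : ℕ+ → ℂ⟦X⟧)
    (n : ℕ) :
    HasDegree doubleOrder (-n) (hop (fun k => c k • (PowerSeries.C (q k) :
      (Module.End ℂ DoubleFock)⟦X⟧)) n) := by
  simpa only [neg_one_mul] using HasDegree.hop (c := -1) doubleOrder_antitone doubleOrder_zero
    (fun k => by rw [neg_one_mul]; exact (hq k).smul (c k)) n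

theorem hasDegree_vertexOp_fst (ε : ℂ) (i : ℕ) :
    HasDegree doubleOrder 0 (vertexOp ε (mulFst ε) (derivFst ε) i) := by
  rw [← add_neg_cancel (i : ℤ)]
  exact (hasDegree_hop_up (hasDegree_mulFst ε) _ i).mul doubleOrder_zero
    (hasDegree_hop_down (hasDegree_derivFst ε) _ i)

theorem hasDegree_vertexOp_snd (ε : ℂ) (i : ℕ) :
    HasDegree doubleOrder 0 (vertexOp ε (mulSnd ε) (derivSnd ε) i) := by
  rw [← add_neg_cancel (i : ℤ)]
  exact (hasDegree_hop_up (hasDegree_mulSnd ε) _ i).mul doubleOrder_zero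
    (hasDegree_hop_down (hasDegree_derivSnd ε) _ i)

theorem hasDegree_kpUp (j : ℕ) :
    HasDegree doubleOrder j (PowerSeries.C (hop (fun k => (-2 : ℂ) • mulOuter k) j)) := by
  rw [C_hop]
  simp only [← C_smul_C_operator]
  exact hasDegree_hop_up hasDegree_mulOuter _ j

/-- Each term raises the order by `j` and lowers it by `j + 1`; one order of precision is lost. -/
theorem hasDegree_kpTerm (j : ℕ) : HasDegree doubleOrder (-1) (PowerSeries.C (kpTerm j)) := by
  rw [kpTerm, map_mul, show (-1 : ℤ) = j + -((j + 1 : ℕ) : ℤ) by push_cast; ring]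
  refine (hasDegree_kpUp j).mul doubleOrder_zero ?_
  rw [C_hop]
  simp only [← C_smul_C_operator]
  exact hasDegree_hop_down hasDegree_derivOuter _ _

theorem kpTerm_mem (j : ℕ) (f : DoubleFock) : kpTerm j f ∈ doubleOrder j := by
  have := hasDegree_kpUp j 0 0 j (hop (fun k => ((k : ℕ) : ℂ) • derivOuter k) (j + 1) f)
    (by simp) (doubleOrder_zero ▸ Submodule.mem_top)
  rwa [PowerSeries.coeff_zero_C] at this

theorem kpTerm_mem_of_mem (j : ℕ) {N : ℕ} {f : DoubleFock} (hf : f ∈ doubleOrder (N + 1)) :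
    kpTerm j f ∈ doubleOrder N := by
  have := hasDegree_kpTerm j 0 (N + 1) N f (by push_cast; linarith) hf
  rwa [PowerSeries.coeff_zero_C] at this

theorem kpBilinear_sub_mem {N K : ℕ} (h : N ≤ K) (f : DoubleFock) :
    kpBilinear f - ∑ j ∈ range K, kpTerm j f ∈ doubleOrder N := fun m n hmn => by
  rw [map_sub, map_sub, coeff_kpBilinear, map_sum, map_sum, sub_eq_zero]
  refine sum_subset (range_subset_range.2 (by omega)) fun j _ hj => ?_
  rw [mem_range, not_lt] at hj
  exact kpTerm_mem j f m n (by omega)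

/-- The kernel of the bilinear operator is stable under the vertex operators. -/
theorem kpBilinear_eq_zero {ε : ℂ} (hε : ε ≠ 0) (g : ℂ⟦X⟧) (n : ℕ) {f f' : DoubleFock}
    (hf : kpBilinear f = 0)
    (hf' : ∀ N, f' - ∑ i ∈ range N, PowerSeries.coeff n (g • (vertexOp ε (mulFst ε) (derivFst ε) i +
      vertexOp ε (mulSnd ε) (derivSnd ε) i)) f ∈ doubleOrder N) : kpBilinear f' = 0 := by
  refine eq_zero_of_forall_mem_doubleOrder fun N => ?_
  set v := fun i => vertexOp ε (mulFst ε) (derivFst ε) i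
  set v' := fun i => vertexOp ε (mulSnd ε) (derivSnd ε) i
  set r := expSeries (ε / 2) with hr
  set s := expSeries (-(ε / 2)) with hs
  have hef : (PowerSeries.C ε : ℂ⟦X⟧) * PowerSeries.C ε⁻¹ = 1 := by
    rw [← map_mul, mul_inv_cancel₀ hε, map_one]
  have hbu : ∀ l : ℕ, HasDegree doubleOrder l (bilinUp (R := ℂ⟦X⟧) (PowerSeries.C ε⁻¹)
      (fun k => PowerSeries.C (mulFst ε k)) (fun k => PowerSeries.C (mulSnd ε k)) l) := by
    intro l
    simp only [bilinUp, ← map_sub]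
    refine hasDegree_hop_up (fun k => ?_) _ l
    rw [map_sub]
    exact (hasDegree_mulSnd ε k).sub (hasDegree_mulFst ε k)
  have key := ((heisenberg_fst_snd hε).map
    (PowerSeries.C (R := Module.End ℂ DoubleFock))).commutator hef (expSeries_mul_neg (ε / 2))
    (J := valuesIn doubleOrder N) (N := N) (K := N + 1) (K' := N + 1) (Nat.le_succ N) le_rfl
    (fun l i x h => HasDegree.mul_mem_valuesIn (d := l + i) doubleOrder_zero h
      ((hbu l).mul doubleOrder_zero (hasDegree_hop_up (hasDegree_mulFst ε) _ i)) x)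
    (fun l i x h => HasDegree.mul_mem_valuesIn (d := l + i) doubleOrder_zero h
      ((hbu l).mul doubleOrder_zero (hasDegree_hop_up (hasDegree_mulSnd ε) _ i)) x)
  simp only [← C_kpTerm_eq_bilinTerm hε] at key
  have key2 := (valuesIn doubleOrder N).smul_mem g key n f
  have e1 : PowerSeries.coeff n (g • ∑ L ∈ range (N + 1), ∑ i ∈ range (N + 1),
      (PowerSeries.C (kpTerm L) * (v i + v' i) -
        (s ^ 2 • v i + r ^ 2 • v' i) * PowerSeries.C (kpTerm L))) f =
      ∑ L ∈ range (N + 1), kpTerm L (∑ i ∈ range (N + 1), PowerSeries.coeff n (g • (v i + v' i)) f) -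
      ∑ i ∈ range (N + 1), PowerSeries.coeff n (g • (s ^ 2 • v i + r ^ 2 • v' i))
        (∑ L ∈ range (N + 1), kpTerm L f) := by
    simp only [sum_sub_distrib, smul_sub, smul_sum, map_sub, map_sum, LinearMap.sub_apply,
      LinearMap.sum_apply]
    congr 1
    · refine sum_congr rfl fun L _ => sum_congr rfl fun i _ => ?_
      rw [← mul_smul_comm, PowerSeries.coeff_C_mul]
      rfl
    · rw [sum_comm]
      refine sum_congr rfl fun i _ => sum_congr rfl fun L _ => ?_
      rw [← smul_mul_assoc, PowerSeries.coeff_mul_C]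
      rfl
  have key3 := key2
  change PowerSeries.coeff n (g • ∑ L ∈ range (N + 1), ∑ i ∈ range (N + 1),
      (PowerSeries.C (kpTerm L) * (v i + v' i) -
        (s ^ 2 • v i + r ^ 2 • v' i) * PowerSeries.C (kpTerm L))) f ∈ doubleOrder N at key3
  rw [e1] at key3
  -- The truncated bilinear operator sends `f` into order `N` because the full one kills it, and the
  -- vertex operators have degree zero.
  have h1 : ∑ i ∈ range (N + 1), PowerSeries.coeff n (g • (s ^ 2 • v i + r ^ 2 • v' i))
        (∑ L ∈ range (N + 1), kpTerm L f) ∈ doubleOrder N := by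
    have h2 := kpBilinear_sub_mem (Nat.le_succ N) f
    rw [hf, zero_sub, Submodule.neg_mem_iff] at h2
    refine Submodule.sum_mem _ fun i _ => ?_
    exact (((hasDegree_vertexOp_fst ε i).smul _).add ((hasDegree_vertexOp_snd ε i).smul _)).smul g
      n N N _ (by simp) h2
  have h3 := (doubleOrder N).add_mem key3 h1
  rw [sub_add_cancel] at h3
  -- The series `f'` is approximated to order `N + 1`, since `kpTerm` lowers the order by one.
  have h4 : ∑ L ∈ range (N + 1), kpTerm L (f' -
      ∑ i ∈ range (N + 1), PowerSeries.coeff n (g • (v i + v' i)) f) ∈ doubleOrder N :=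
    Submodule.sum_mem _ fun L _ => kpTerm_mem_of_mem L (hf' (N + 1))
  have h5 := kpBilinear_sub_mem (Nat.le_succ N) f'
  have h6 := (doubleOrder N).add_mem h5 ((doubleOrder N).add_mem h4 h3)
  rw [← sum_add_distrib] at h6
  simp only [map_sub, sub_add_cancel] at h6
  exact h6

end DiskSFT

end

noncomputable section

namespace DiskSFT

open Finset hiding mk antidiagonal mem_antidiagonal
open Finset.HasAntidiagonal hiding mk
open MvPowerSeries (coeff pderiv)

/-! ### The quantum Hamiltonians as coefficients of the vertex operator -/

/-- Multiplication by `p^a`. -/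
def mulMonomial (a : ℕ+ →₀ ℕ) : Module.End ℂ Fock :=
  LinearMap.mulLeft ℂ (MvPowerSeries.monomial a (1 : ℂ))

/-- The operator `∏_k (ħ k ∂/∂p_k)^(b_k)`. -/
def momentumL (ħ : ℂ) (b : ℕ+ →₀ ℕ) : Module.End ℂ Fock :=
  (b.prod fun k n => (ħ * (k : ℂ)) ^ n) • partialDerivL b

theorem momentumL_apply (ħ : ℂ) (b : ℕ+ →₀ ℕ) (f : Fock) : momentumL ħ b f = momentum ħ b f := rfl

theorem mulMonomial_zero : mulMonomial 0 = 1 := LinearMap.ext fun f => one_mul f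

theorem mulMonomial_add_single (b : ℕ+ →₀ ℕ) (k : ℕ+) :
    mulMonomial (b + Finsupp.single k 1) = mulX k * mulMonomial b := by
  refine LinearMap.ext fun f => ?_
  rw [Module.End.mul_apply, mulX_apply]
  change MvPowerSeries.monomial (b + Finsupp.single k 1) (1 : ℂ) * f =
    MvPowerSeries.X k * (MvPowerSeries.monomial b (1 : ℂ) * f)
  rw [← mul_assoc, MvPowerSeries.X, MvPowerSeries.monomial_mul_monomial, one_mul, add_comm]

theorem momentumL_zero (ħ : ℂ) : momentumL ħ 0 = 1 := LinearMap.ext fun f => by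
  rw [momentumL_apply, momentum, partialDeriv_zero, Finsupp.prod_zero_index, one_smul]
  rfl

theorem momentumL_add_single (ħ : ℂ) (b : ℕ+ →₀ ℕ) (k : ℕ+) :
    momentumL ħ (b + Finsupp.single k 1) = (ħ * (k : ℂ)) • derivX k * momentumL ħ b := by
  refine LinearMap.ext fun f => ?_
  rw [smul_mul_assoc, LinearMap.smul_apply, Module.End.mul_apply, momentumL_apply, momentumL_apply,
    momentum, momentum, derivX_apply, pderiv_const_smul, partialDeriv_add_single, smul_smul]
  congr 1
  have := prod_add_single (fun (k : ℕ+) n => (ħ * (k : ℂ)) ^ n) (fun k => pow_zero _) b k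
    (u := 1) (v := ħ * (k : ℂ)) (by rw [one_mul, pow_succ'])
  rwa [one_mul] at this

theorem sum_expLin_smul {M : Type*} [AddCommGroup M] [Module ℂ M] (c : ℕ+ → ℂ⟦X⟧)
    (y : ℕ+ → Module.End ℂ M) (z : (ℕ+ →₀ ℕ) → Module.End ℂ M) (h0 : z 0 = 1)
    (hs : ∀ b k, z (b + Finsupp.single k 1) = y k * z b) (n : ℕ) :
    ∑ a ∈ multiIndices n, coeff a (expLin c) • (PowerSeries.C (z a) : (Module.End ℂ M)⟦X⟧) =
      hop (fun k => (((k : ℕ) : ℂ) • c k) • (PowerSeries.C (y k) : (Module.End ℂ M)⟦X⟧)) n := by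
  rw [sum_multiIndices (fun k => Algebra.lmul ℂ (Module.End ℂ M)⟦X⟧ (c k • PowerSeries.C (y k)))]
  · have e : (fun k : ℕ+ => ((k : ℕ) : ℂ) • Algebra.lmul ℂ (Module.End ℂ M)⟦X⟧
        (c k • PowerSeries.C (y k))) = fun k : ℕ+ => Algebra.lmul ℂ (Module.End ℂ M)⟦X⟧
          ((((k : ℕ) : ℂ) • c k) • PowerSeries.C (y k)) := by
      funext k
      rw [← map_smul, smul_assoc]
    rw [e, ← lmul_hop, h0, coeff_expLin, Finsupp.prod_zero_index, one_smul, map_one]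
    exact mul_one _
  · intro b k
    rw [← smul_assoc, coeff_expLin_add_single, hs, map_mul]
    exact (smul_mul_smul_comm _ _ _ _).symm

/-- Since `k z s(kεz) = (r^k - s^k)/ε`, multiplication by `p_k` receives the factor `f = ε⁻¹`. The
factor `ħ = ε²` carried by the derivatives turns it into `e = ε` on the annihilation side. -/
theorem vertexOp_eq_sum {ε : ℂ} (hε : ε ≠ 0) (i : ℕ) :
    vertexOp ε mulX derivX i = ∑ a ∈ multiIndices i, ∑ b ∈ multiIndices i,
      (coeff a (expLin fun k => PowerSeries.X * sSeries (ε ^ 2 * (k : ℂ) ^ 2)) *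
        coeff b (expLin fun k => PowerSeries.X * sSeries (ε ^ 2 * (k : ℂ) ^ 2))) •
      (PowerSeries.C (mulMonomial a * momentumL (ε ^ 2) b) : (Module.End ℂ Fock)⟦X⟧) := by
  have e1 := sum_expLin_smul (fun k => PowerSeries.X * sSeries (ε ^ 2 * (k : ℂ) ^ 2)) mulX
    mulMonomial mulMonomial_zero mulMonomial_add_single i
  have e2 := sum_expLin_smul (fun k => PowerSeries.X * sSeries (ε ^ 2 * (k : ℂ) ^ 2))
    (fun k => (ε ^ 2 * (k : ℂ)) • derivX k) (momentumL (ε ^ 2)) (momentumL_zero _)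
    (momentumL_add_single _) i
  have e3 : vertexOp ε mulX derivX i = (∑ a ∈ multiIndices i, coeff a (expLin fun k =>
      PowerSeries.X * sSeries (ε ^ 2 * (k : ℂ) ^ 2)) • PowerSeries.C (mulMonomial a)) *
      ∑ b ∈ multiIndices i, coeff b (expLin fun k =>
        PowerSeries.X * sSeries (ε ^ 2 * (k : ℂ) ^ 2)) • PowerSeries.C (momentumL (ε ^ 2) b) := by
    rw [e1, e2, vertexOp, vertexTerm, vertexUp, vertexDown]
    congr 2
    · funext k
      rw [natCast_mul_sSeries hε]
    · funext k
      rw [natCast_mul_sSeries hε, ← C_smul_C_operator, smul_smul]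
      congr 1
      rw [show (PowerSeries.C (ε ^ 2 * ((k : ℕ) : ℂ)) : ℂ⟦X⟧) =
        PowerSeries.C ε * PowerSeries.C ε * ((k : ℕ) : ℂ⟦X⟧) by
          rw [pow_two, map_mul, map_mul, map_natCast]]
      have hef : (PowerSeries.C ε : ℂ⟦X⟧) * PowerSeries.C ε⁻¹ = 1 := by
        rw [← map_mul, mul_inv_cancel₀ hε, map_one]
      linear_combination -(PowerSeries.C ε * ((k : ℕ) : ℂ⟦X⟧) *
        (expSeries (ε / 2) ^ (k : ℕ) - expSeries (-(ε / 2)) ^ (k : ℕ))) * hef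
  rw [e3, sum_mul_sum]
  refine sum_congr rfl fun a _ => sum_congr rfl fun b _ => ?_
  rw [smul_mul_smul_comm, map_mul]

/-- The prefactor `exp (u₀ z) / s(ħ^(1/2) z)` of the generating function of the Hamiltonians. -/
def hamPrefactor (u₀ ħ : ℂ) : ℂ⟦X⟧ :=
  PowerSeries.rescale u₀ (PowerSeries.exp ℂ) * (sSeries ħ)⁻¹

theorem coeff_vertexOp_apply {ε : ℂ} (hε : ε ≠ 0) (u₀ : ℂ) (n i : ℕ) (f : Fock) :
    PowerSeries.coeff n (hamPrefactor u₀ (ε ^ 2) • vertexOp ε mulX derivX i) f =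
      ∑ a ∈ multiIndices i, ∑ b ∈ multiIndices i,
        PowerSeries.coeff n (hamSymbol u₀ (ε ^ 2) a b) •
          (MvPowerSeries.monomial a 1 * momentum (ε ^ 2) b f) := by
  rw [vertexOp_eq_sum hε]
  simp only [smul_sum, map_sum, LinearMap.sum_apply]
  refine sum_congr rfl fun a _ => sum_congr rfl fun b _ => ?_
  rw [smul_smul, coeff_smul_C, LinearMap.smul_apply, hamSymbol, hamPrefactor, ← mul_assoc]
  rfl

/-- The coefficient of `p^m` only receives monomials `p^a` with `a ≤ m`, hence of weight at most `wt
m`, so components of the vertex operator of degree `N` or more are invisible below weight `N`. -/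
theorem hamiltonian_sub_mem {ε : ℂ} (hε : ε ≠ 0) (u₀ : ℂ) (n N : ℕ) (f : Fock) :
    hamiltonian u₀ (ε ^ 2) n f - ∑ i ∈ range N,
      PowerSeries.coeff (n + 2) (hamPrefactor u₀ (ε ^ 2) • vertexOp ε mulX derivX i) f ∈
        fockOrder N := fun m hm => by
  rw [map_sub, sub_eq_zero, map_sum]
  have e1 : ∀ i, coeff m (PowerSeries.coeff (n + 2)
      (hamPrefactor u₀ (ε ^ 2) • vertexOp ε mulX derivX i) f) =
      ∑ a ∈ multiIndices i, ∑ b ∈ multiIndices i,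
        PowerSeries.coeff (n + 2) (hamSymbol u₀ (ε ^ 2) a b) *
          (if a ≤ m then coeff (m - a) (momentum (ε ^ 2) b f) else 0) := fun i => by
    rw [coeff_vertexOp_apply hε, map_sum]
    refine sum_congr rfl fun a _ => ?_
    rw [map_sum]
    refine sum_congr rfl fun b _ => ?_
    rw [map_smul, MvPowerSeries.coeff_monomial_mul, one_mul, smul_eq_mul]
  simp only [e1]
  rw [Finset.sum_sigma', ← sum_filter_of_ne (s := (range N).sigma _) (p := fun w => w.2 ≤ m)]
  · refine sum_nbij' (fun x => ⟨wt x.1, x.1⟩) (fun w => (w.2, m - w.2)) ?_ ?_ ?_ ?_ ?_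
    · rintro ⟨a, c⟩ hx
      rw [mem_antidiagonal] at hx
      have h1 := congrArg wt hx
      rw [wt_add] at h1
      rw [mem_filter, mem_sigma, mem_range, mem_multiIndices]
      refine ⟨⟨?_, rfl⟩, ?_⟩
      · simp only at h1 ⊢
        omega
      · exact hx ▸ le_self_add
    · rintro ⟨i, a⟩ hw
      rw [mem_filter] at hw
      rw [mem_antidiagonal]
      exact add_tsub_cancel_of_le hw.2
    · rintro ⟨a, c⟩ hx
      rw [mem_antidiagonal] at hx
      simp only [← hx, add_tsub_cancel_left]
    · rintro ⟨i, a⟩ hw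
      rw [mem_filter, mem_sigma, mem_multiIndices] at hw
      obtain ⟨⟨_, h⟩, _⟩ := hw
      simp only at h
      subst h
      rfl
    · rintro ⟨a, c⟩ hx
      rw [mem_antidiagonal] at hx
      refine sum_congr rfl fun b _ => ?_
      simp only at hx ⊢
      rw [if_pos (hx ▸ le_self_add), ← hx, add_tsub_cancel_left]
  · rintro ⟨i, a⟩ _ hne
    by_contra hc
    exact hne (sum_eq_zero fun b _ => by rw [if_neg hc, mul_zero])

theorem momentum_add (ħ : ℂ) (b : ℕ+ →₀ ℕ) (f g : Fock) :
    momentum ħ b (f + g) = momentum ħ b f + momentum ħ b g := map_add (momentumL ħ b) f g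

theorem momentum_smul (ħ : ℂ) (b : ℕ+ →₀ ℕ) (c : ℂ) (f : Fock) :
    momentum ħ b (c • f) = c • momentum ħ b f := map_smul (momentumL ħ b) c f

theorem coeff_hamiltonian (u₀ ħ : ℂ) (n : ℕ) (f : Fock) (m : ℕ+ →₀ ℕ) :
    coeff m (hamiltonian u₀ ħ n f) = ∑ ac ∈ antidiagonal m, ∑ b ∈ multiIndices (wt ac.1),
      PowerSeries.coeff (n + 2) (hamSymbol u₀ ħ ac.1 b) * coeff ac.2 (momentum ħ b f) := rfl

/-- The quantum Hamiltonian as a linear operator. -/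
def hamiltonianL (u₀ ħ : ℂ) (n : ℕ) : Module.End ℂ Fock where
  toFun := hamiltonian u₀ ħ n
  map_add' f g := by
    ext m
    rw [map_add, coeff_hamiltonian, coeff_hamiltonian, coeff_hamiltonian, ← sum_add_distrib]
    refine sum_congr rfl fun x _ => ?_
    rw [← sum_add_distrib]
    refine sum_congr rfl fun b _ => ?_
    rw [momentum_add, map_add, mul_add]
  map_smul' c f := by
    ext m
    rw [RingHom.id_apply, map_smul, coeff_hamiltonian, coeff_hamiltonian, smul_eq_mul, mul_sum]
    refine sum_congr rfl fun x _ => ?_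
    rw [mul_sum]
    refine sum_congr rfl fun b _ => ?_
    rw [momentum_smul, map_smul, smul_eq_mul, mul_left_comm]

theorem coeff_momentum_eq_zero (ħ : ℂ) (b : ℕ+ →₀ ℕ) {f : Fock} {c : ℕ+ →₀ ℕ}
    (h : coeff (c + b) f = 0) : coeff c (momentum ħ b f) = 0 := by
  rw [momentum, map_smul]
  have : coeff c (partialDeriv b f) = 0 := (congrArg _ h).trans (mul_zero _)
  rw [this, smul_zero]

/-- The Hamiltonians preserve the weight. -/
theorem coeff_hamiltonian_eq_zero (u₀ ħ : ℂ) (n : ℕ) {f : Fock} {m : ℕ+ →₀ ℕ}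
    (h : ∀ m', wt m' = wt m → coeff m' f = 0) : coeff m (hamiltonian u₀ ħ n f) = 0 := by
  rw [coeff_hamiltonian]
  refine sum_eq_zero fun x hx => sum_eq_zero fun b hb => ?_
  rw [coeff_momentum_eq_zero, mul_zero]
  refine h _ ?_
  have h1 := congrArg wt (mem_antidiagonal.1 hx)
  rw [mem_multiIndices] at hb
  rw [wt_add] at h1 ⊢
  omega

/-! ### Hamiltonians acting on pairs -/

theorem intertwines_vertexOp {M M' : Type*} [AddCommGroup M] [Module ℂ M] [AddCommGroup M']
    [Module ℂ M'] {T : M →ₗ[ℂ] M'} {a d : ℕ+ → Module.End ℂ M} {a' d' : ℕ+ → Module.End ℂ M'}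
    (ha : ∀ k v, T (a k v) = a' k (T v)) (hd : ∀ k v, T (d k v) = d' k (T v)) (ε : ℂ) (i : ℕ) :
    Intertwines T (vertexOp ε a d i) (vertexOp ε a' d' i) :=
  (Intertwines.hop (fun k => (Intertwines.C (ha k)).smul _) i).mul
    (Intertwines.hop (fun k => (Intertwines.C (hd k)).smul _) i)

open TensorProduct

/-- The product `τ(x + ε y) σ(x - ε y)` as a linear map on the tensor product. -/
def pairingL (ε : ℂ) : Fock ⊗[ℂ] Fock →ₗ[ℂ] DoubleFock := TensorProduct.lift (pairing ε)

/-- The operator `H ⊗ 1 + 1 ⊗ H`. -/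
def diagonalAction (H : Module.End ℂ Fock) : Module.End ℂ (Fock ⊗[ℂ] Fock) :=
  H.rTensor Fock + H.lTensor Fock

theorem pairingL_diagonalAction_tmul (ε : ℂ) (H : Module.End ℂ Fock) (τ σ : Fock) :
    pairingL ε (diagonalAction H (τ ⊗ₜ σ)) = pairing ε (H τ) σ + pairing ε τ (H σ) := by
  rw [diagonalAction, LinearMap.add_apply, LinearMap.rTensor_tmul, LinearMap.lTensor_tmul, map_add]
  rfl

/-- The pairing carries the operators on either tensor factor to `mulFst`, `derivFst` or `mulSnd`,
`derivSnd`. The tensor product is used because iterates of `H ⊗ 1 + 1 ⊗ H` leave the pure tensors.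
-/
theorem pairingL_diagonalAction_hamiltonian {ε : ℂ} (hε : ε ≠ 0) (u₀ : ℂ) (n : ℕ)
    (x : Fock ⊗[ℂ] Fock) (N : ℕ) :
    pairingL ε (diagonalAction (hamiltonianL u₀ (ε ^ 2) n) x) - ∑ i ∈ range N,
      PowerSeries.coeff (n + 2) (hamPrefactor u₀ (ε ^ 2) •
        (vertexOp ε (mulFst ε) (derivFst ε) i + vertexOp ε (mulSnd ε) (derivSnd ε) i))
        (pairingL ε x) ∈ doubleOrder N := by
  induction x using TensorProduct.induction_on with
  | zero => simp
  | add x y hx hy =>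
    simp only [map_add, sum_add_distrib] at hx hy ⊢
    rw [add_sub_add_comm]
    exact (doubleOrder N).add_mem hx hy
  | tmul τ σ =>
    rw [pairingL_diagonalAction_tmul]
    have h1 := pairing_mem_doubleOrder_fst ε (hamiltonian_sub_mem hε u₀ n N τ) σ
    have h2 := pairing_mem_doubleOrder_snd ε τ (hamiltonian_sub_mem hε u₀ n N σ)
    have h3 := fun i => (intertwines_vertexOp (T := (pairing ε).flip σ)
      (fun k v => pairing_mulX_fst ε k v σ) (fun k v => pairing_derivX_fst hε k v σ) ε i).smul
      (hamPrefactor u₀ (ε ^ 2)) (n + 2) τ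
    have h4 := fun i => (intertwines_vertexOp (T := pairing ε τ)
      (fun k v => pairing_mulX_snd ε k τ v) (fun k v => pairing_derivX_snd hε k τ v) ε i).smul
      (hamPrefactor u₀ (ε ^ 2)) (n + 2) σ
    simp only [LinearMap.flip_apply] at h3
    rw [map_sub, map_sum, LinearMap.sub_apply, LinearMap.sum_apply] at h1
    rw [map_sub, map_sum] at h2
    simp only [h3] at h1
    simp only [h4] at h2
    have h5 := (doubleOrder N).add_mem h1 h2
    rw [sub_add_sub_comm, ← sum_add_distrib] at h5
    simp only [smul_add, map_add, LinearMap.add_apply]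
    exact h5

theorem kpBilinear_diagonalAction_hamiltonian {ε : ℂ} (hε : ε ≠ 0) (u₀ : ℂ) (n : ℕ)
    {x : Fock ⊗[ℂ] Fock} (hx : kpBilinear (pairingL ε x) = 0) :
    kpBilinear (pairingL ε (diagonalAction (hamiltonianL u₀ (ε ^ 2) n) x)) = 0 :=
  kpBilinear_eq_zero hε _ _ hx (pairingL_diagonalAction_hamiltonian hε u₀ n x)

end DiskSFT

end

noncomputable section

namespace DiskSFT

open Finset hiding mk antidiagonal mem_antidiagonal
open Finset.HasAntidiagonal hiding mk
open MvPowerSeries (coeff pderiv)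

/-! ### Continuity -/

section Continuity

open scoped MvPowerSeries.WithPiTopology
open MvPowerSeries.WithPiTopology TensorProduct

theorem continuous_of_coeff {σ R X : Type*} [Semiring R] [TopologicalSpace R] [TopologicalSpace X]
    {f : X → MvPowerSeries σ R} (h : ∀ m, Continuous fun x => coeff m (f x)) : Continuous f :=
  continuous_pi h

theorem continuous_of_coeff_coeff {X : Type*} [TopologicalSpace X]
    {f : X → DoubleFock} (h : ∀ m n, Continuous fun x => coeff n (coeff m (f x))) : Continuous f :=
  continuous_of_coeff fun m => continuous_of_coeff fun n => h m n

theorem continuous_coeff_coeff (m n : ℕ+ →₀ ℕ) :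
    Continuous fun f : DoubleFock => coeff n (coeff m f) :=
  (continuous_coeff ℂ n).comp (continuous_coeff Fock m)

theorem continuous_shift (c : ℂ) : Continuous (shift c) :=
  continuous_of_coeff_coeff fun m n => by
    simp only [coeff_shift, map_smul]
    exact continuous_const.mul (continuous_const.mul (continuous_coeff ℂ (n + m)))

theorem continuous_mulOuter (k : ℕ+) : Continuous (mulOuter k) :=
  continuous_const.mul continuous_id

theorem continuous_derivOuter (k : ℕ+) : Continuous (derivOuter k) :=
  continuous_of_coeff fun m => by
    simp only [derivOuter_apply, MvPowerSeries.coeff_pderiv]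
    exact (continuous_coeff Fock _).mul continuous_const

theorem continuous_double_smul {f : DoubleFock → DoubleFock} (hf : Continuous f) (c : ℂ) :
    Continuous fun x => c • f x :=
  continuous_of_coeff_coeff fun m n => by
    simp only [coeff_const_smul_double, map_smul, smul_eq_mul]
    exact continuous_const.mul ((continuous_coeff_coeff m n).comp hf)

theorem continuous_hop {q : ℕ+ → Module.End ℂ DoubleFock} (hq : ∀ k, Continuous (q k)) (n : ℕ) :
    Continuous fun f => (hop q n : Module.End ℂ DoubleFock) f := by
  refine hop_rel {p : Module.End ℂ DoubleFock × Module.End ℂ DoubleFock | Continuous p.1} q q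
    continuous_id (fun x hx y hy => ?_) continuous_const (fun c x hx => ?_) (fun k x hx => ?_) n
  · exact Continuous.add hx hy
  · exact continuous_double_smul hx c
  · exact (hq k).comp hx

theorem continuous_kpTerm (j : ℕ) : Continuous (kpTerm j) :=
  (continuous_hop (fun k => continuous_double_smul (continuous_mulOuter k) _) j).comp
    (continuous_hop (fun k => continuous_double_smul (continuous_derivOuter k) _) (j + 1))

/-- For the product topology it suffices that each coefficient is a finite sum of continuous
functions; this lets the operator pass through infinite sums. -/
theorem continuous_kpBilinear : Continuous kpBilinear :=
  continuous_of_coeff_coeff fun m n => by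
    simp only [coeff_kpBilinear]
    exact continuous_finsetSum _ fun j _ => (continuous_coeff_coeff m n).comp (continuous_kpTerm j)

theorem continuous_pairing_left (ε : ℂ) (σ : Fock) : Continuous fun τ => pairing ε τ σ :=
  (continuous_shift ε).mul continuous_const

theorem continuous_pairing_right (ε : ℂ) (τ : Fock) : Continuous fun σ => pairing ε τ σ :=
  continuous_const.mul (continuous_shift (-ε))

theorem hasSum_pairing_left (ε : ℂ) {ι : Type*} {f : ι → Fock} {τ : Fock} (h : HasSum f τ)
    (σ : Fock) : HasSum (fun i => pairing ε (f i) σ) (pairing ε τ σ) :=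
  h.map ((pairing ε).flip σ) (continuous_pairing_left ε σ)

theorem hasSum_pairing_right (ε : ℂ) {ι : Type*} {f : ι → Fock} {σ : Fock} (h : HasSum f σ)
    (τ : Fock) : HasSum (fun i => pairing ε τ (f i)) (pairing ε τ σ) :=
  h.map (pairing ε τ) (continuous_pairing_right ε τ)

theorem coeff_coeff_mul (f g : DoubleFock) (m n : ℕ+ →₀ ℕ) :
    coeff n (coeff m (f * g)) = ∑ x ∈ antidiagonal m, ∑ y ∈ antidiagonal n,
      coeff y.1 (coeff x.1 f) * coeff y.2 (coeff x.2 g) := by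
  simp only [MvPowerSeries.coeff_mul, map_sum]

theorem hasSum_mul_antidiagonal_of_summable {f g : ℕ → ℂ} (hf : Summable f) (hg : Summable g) :
    HasSum (fun N => ∑ z ∈ antidiagonal N, f z.1 * g z.2) ((∑' i, f i) * ∑' i, g i) := by
  rw [tsum_mul_tsum_eq_tsum_sum_antidiagonal_of_summable_norm hf.norm hg.norm]
  exact (summable_norm_sum_mul_antidiagonal_of_summable_norm hf.norm hg.norm).of_norm.hasSum

theorem hasSum_coeff_coeff {f : ℕ → DoubleFock} {F : DoubleFock} (hf : HasSum f F)
    (m n : ℕ+ →₀ ℕ) : HasSum (fun i => coeff n (coeff m (f i))) (coeff n (coeff m F)) :=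
  hasSum_iff_hasSum_coeff.1 (hasSum_iff_hasSum_coeff.1 hf m) n

/-- The Cauchy product formula. -/
theorem hasSum_mul_double {f g : ℕ → DoubleFock} {F G : DoubleFock} (hf : HasSum f F)
    (hg : HasSum g G) : HasSum (fun N => ∑ z ∈ antidiagonal N, f z.1 * g z.2) (F * G) := by
  refine hasSum_iff_hasSum_coeff.2 fun m => hasSum_iff_hasSum_coeff.2 fun n => ?_
  have h : HasSum (fun N => ∑ x ∈ antidiagonal m, ∑ y ∈ antidiagonal n, ∑ z ∈ antidiagonal N,
      coeff y.1 (coeff x.1 (f z.1)) * coeff y.2 (coeff x.2 (g z.2)))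
      (∑ x ∈ antidiagonal m, ∑ y ∈ antidiagonal n,
        coeff y.1 (coeff x.1 F) * coeff y.2 (coeff x.2 G)) := by
    refine hasSum_sum fun x _ => hasSum_sum fun y _ => ?_
    have h1 := hasSum_coeff_coeff hf x.1 y.1
    have h2 := hasSum_coeff_coeff hg x.2 y.2
    have h3 := hasSum_mul_antidiagonal_of_summable h1.summable h2.summable
    rw [h1.tsum_eq, h2.tsum_eq] at h3
    exact h3
  rw [coeff_coeff_mul]
  have e : (fun N => coeff n (coeff m (∑ z ∈ antidiagonal N, f z.1 * g z.2))) =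
      fun N => ∑ x ∈ antidiagonal m, ∑ y ∈ antidiagonal n, ∑ z ∈ antidiagonal N,
      coeff y.1 (coeff x.1 (f z.1)) * coeff y.2 (coeff x.2 (g z.2)) := by
    funext N
    rw [map_sum, map_sum]
    simp only [coeff_coeff_mul]
    rw [sum_comm]
    exact sum_congr rfl fun x _ => sum_comm
  rw [e]
  exact h

/-- The Cauchy product formula for the pairing of two series. -/
theorem hasSum_pairing_antidiagonal (ε : ℂ) {f : ℕ → Fock} {τ : Fock} (h : HasSum f τ) :
    HasSum (fun N => ∑ x ∈ antidiagonal N, pairing ε (f x.1) (f x.2)) (pairing ε τ τ) := by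
  have h1 : HasSum (fun i => shift ε (f i)) (shift ε τ) :=
    h.map (shiftL ε) (continuous_shift ε)
  have h2 : HasSum (fun i => shift (-ε) (f i)) (shift (-ε) τ) :=
    h.map (shiftL (-ε)) (continuous_shift (-ε))
  exact hasSum_mul_double (f := fun i => shift ε (f i)) (g := fun i => shift (-ε) (f i)) h1 h2

/-! ### The evolution operator -/

/-- The evolution operator as a linear operator. -/
def evolutionL (u₀ ħ : ℂ) (t : ℕ → ℂ) (ht : Admissible u₀ ħ t) : Module.End ℂ Fock where
  toFun := evolution u₀ ħ t
  map_add' f g := by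
    ext m
    change ħ⁻¹ * ∑' k, t k * coeff m (hamiltonianL u₀ ħ k (f + g)) =
      ħ⁻¹ * ∑' k, t k * coeff m (hamiltonian u₀ ħ k f) +
      ħ⁻¹ * ∑' k, t k * coeff m (hamiltonian u₀ ħ k g)
    rw [← mul_add, ← (ht f m).tsum_add (ht g m)]
    simp only [map_add, mul_add]
    rfl
  map_smul' c f := by
    ext m
    change ħ⁻¹ * ∑' k, t k * coeff m (hamiltonianL u₀ ħ k (c • f)) =
      c * (ħ⁻¹ * ∑' k, t k * coeff m (hamiltonian u₀ ħ k f))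
    rw [mul_left_comm c, ← tsum_mul_left (a := c)]
    refine congrArg (HMul.hMul ħ⁻¹) ?_
    refine congrArg tsum (funext fun k => ?_)
    rw [map_smul, map_smul, smul_eq_mul, mul_left_comm]
    rfl

variable {u₀ ħ : ℂ} {t : ℕ → ℂ}

theorem coeff_evolutionL (ht : Admissible u₀ ħ t) (f : Fock) (m : ℕ+ →₀ ℕ) :
    coeff m (evolutionL u₀ ħ t ht f) = ħ⁻¹ * ∑' k, t k * coeff m (hamiltonian u₀ ħ k f) := rfl

theorem hasSum_evolutionL (ht : Admissible u₀ ħ t) (f : Fock) :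
    HasSum (fun k => (ħ⁻¹ * t k) • hamiltonianL u₀ ħ k f) (evolutionL u₀ ħ t ht f) :=
  hasSum_iff_hasSum_coeff.2 fun m => by
    simp only [map_smul, smul_eq_mul, mul_assoc]
    exact (ht f m).hasSum.mul_left ħ⁻¹

theorem hasSum_pairingL_diagonalAction (ht : Admissible u₀ ħ t) (ε : ℂ) (x : Fock ⊗[ℂ] Fock) :
    HasSum (fun k => (ħ⁻¹ * t k) • pairingL ε (diagonalAction (hamiltonianL u₀ ħ k) x))
      (pairingL ε (diagonalAction (evolutionL u₀ ħ t ht) x)) := by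
  induction x using TensorProduct.induction_on with
  | zero => simp
  | add x y hx hy =>
    simp only [map_add, smul_add]
    exact hx.add hy
  | tmul τ σ =>
    simp only [pairingL_diagonalAction_tmul, smul_add]
    have h1 := hasSum_pairing_left ε (hasSum_evolutionL ht τ) σ
    have h2 := hasSum_pairing_right ε (hasSum_evolutionL ht σ) τ
    simp only [map_smul, LinearMap.smul_apply] at h1 h2
    exact h1.add h2

theorem kpBilinear_diagonalAction_evolution {ε : ℂ} (hε : ε ≠ 0)
    (ht : Admissible u₀ (ε ^ 2) t) {x : Fock ⊗[ℂ] Fock} (hx : kpBilinear (pairingL ε x) = 0) :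
    kpBilinear (pairingL ε (diagonalAction (evolutionL u₀ (ε ^ 2) t ht) x)) = 0 := by
  have h := (hasSum_pairingL_diagonalAction ht ε x).map kpBilinear continuous_kpBilinear
  have e : (kpBilinear ∘ fun k => ((ε ^ 2)⁻¹ * t k) •
      pairingL ε (diagonalAction (hamiltonianL u₀ (ε ^ 2) k) x)) = fun _ => 0 := by
    funext k
    rw [Function.comp_apply, map_smul, kpBilinear_diagonalAction_hamiltonian hε u₀ k hx, smul_zero]
  rw [e] at h
  exact h.unique hasSum_zero

theorem kpBilinear_diagonalAction_pow {ε : ℂ} (hε : ε ≠ 0)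
    (ht : Admissible u₀ (ε ^ 2) t) {x : Fock ⊗[ℂ] Fock} (hx : kpBilinear (pairingL ε x) = 0)
    (N : ℕ) :
    kpBilinear (pairingL ε ((diagonalAction (evolutionL u₀ (ε ^ 2) t ht) ^ N) x)) = 0 := by
  induction N with
  | zero => simpa using hx
  | succ N ih =>
    rw [pow_succ', Module.End.mul_apply]
    exact kpBilinear_diagonalAction_evolution hε ht ih

/-- The binomial theorem for the commuting operators `E ⊗ 1` and `1 ⊗ E`: the right side is the
degree `N` part of `exp E τ ⊗ exp E τ`. -/
theorem diagonalAction_pow_tmul (E : Module.End ℂ Fock) (τ : Fock) (N : ℕ) :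
    (N ! : ℂ)⁻¹ • (diagonalAction E ^ N) (τ ⊗ₜ τ) = ∑ x ∈ antidiagonal N,
      ((x.1 ! : ℂ)⁻¹ • (E ^ x.1) τ) ⊗ₜ[ℂ] ((x.2 ! : ℂ)⁻¹ • (E ^ x.2) τ) := by
  have hc : Commute (E.rTensor Fock) (E.lTensor Fock) := by
    rw [Commute, SemiconjBy, Module.End.mul_eq_comp, Module.End.mul_eq_comp,
      LinearMap.rTensor_comp_lTensor, LinearMap.lTensor_comp_rTensor]
  rw [diagonalAction, hc.add_pow', LinearMap.sum_apply, smul_sum]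
  refine sum_congr rfl fun x hx => ?_
  rw [LinearMap.smul_apply, Module.End.mul_apply, LinearMap.rTensor_pow, LinearMap.lTensor_pow,
    LinearMap.lTensor_tmul, LinearMap.rTensor_tmul, TensorProduct.smul_tmul_smul,
    ← Nat.cast_smul_eq_nsmul ℂ, smul_smul]
  congr 1
  have hx := mem_antidiagonal.1 hx
  have h1 : (N ! : ℂ) ≠ 0 := by exact_mod_cast Nat.factorial_ne_zero _
  have h2 : (x.1 ! : ℂ) ≠ 0 := by exact_mod_cast Nat.factorial_ne_zero _
  have h3 : (x.2 ! : ℂ) ≠ 0 := by exact_mod_cast Nat.factorial_ne_zero _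
  have h4 : ((N.choose x.1 : ℕ) : ℂ) * (x.1 ! : ℂ) * (x.2 ! : ℂ) = (N ! : ℂ) := by
    rw [← hx]
    rw [Nat.choose_symm_add]
    exact_mod_cast Nat.add_choose_mul_factorial_mul_factorial x.1 x.2
  field_simp
  linear_combination h4

/-! ### Convergence of the exponential series -/

theorem coeff_evolutionL_eq_zero (ht : Admissible u₀ ħ t) {f : Fock} {m : ℕ+ →₀ ℕ}
    (h : ∀ m', wt m' = wt m → coeff m' f = 0) : coeff m (evolutionL u₀ ħ t ht f) = 0 := by
  rw [coeff_evolutionL]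
  simp only [coeff_hamiltonian_eq_zero u₀ ħ _ h, mul_zero, tsum_zero]

/-- A weight-preserving operator is bounded on each weight space. -/
theorem exists_bound_of_weight_preserving {E : Module.End ℂ Fock}
    (hE : ∀ (f : Fock) m, (∀ m', wt m' = wt m → coeff m' f = 0) → coeff m (E f) = 0) (w : ℕ) :
    ∃ c : ℝ, 0 ≤ c ∧ ∀ f : Fock, ∑ m ∈ multiIndices w, ‖coeff m (E f)‖ ≤
      c * ∑ m ∈ multiIndices w, ‖coeff m f‖ := by
  classical
  refine ⟨∑ m ∈ multiIndices w, ∑ n ∈ multiIndices w,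
    ‖coeff m (E (MvPowerSeries.monomial n (1 : ℂ)))‖,
    sum_nonneg fun m _ => sum_nonneg fun n _ => norm_nonneg _, fun f => ?_⟩
  rw [sum_mul]
  refine sum_le_sum fun m hm => ?_
  have h1 : coeff m (E f) = ∑ n ∈ multiIndices w,
      coeff n f * coeff m (E (MvPowerSeries.monomial n (1 : ℂ))) := by
    -- After its weight `w` part is subtracted, `f` no longer contributes to this coefficient, so
    -- `E` acts there as a finite matrix whose entries bound the norm.
    have h2 := hE (f - ∑ n ∈ multiIndices w, coeff n f • MvPowerSeries.monomial n (1 : ℂ)) m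
      fun m' hm' => by
        rw [map_sub, map_sum, sub_eq_zero]
        simp only [map_smul, MvPowerSeries.coeff_monomial, smul_eq_mul, mul_ite, mul_one, mul_zero]
        rw [sum_ite_eq, if_pos]
        rw [mem_multiIndices] at hm ⊢
        rw [hm', hm]
    rw [map_sub, map_sub, sub_eq_zero] at h2
    rw [h2]
    simp only [map_sum, map_smul, smul_eq_mul]
  rw [h1, sum_mul]
  refine (norm_sum_le _ _).trans (sum_le_sum fun n hn => ?_)
  rw [norm_mul, mul_comm]
  exact mul_le_mul_of_nonneg_left
    (single_le_sum (f := fun m => ‖coeff m f‖) (fun _ _ => norm_nonneg _) hn) (norm_nonneg _)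

/-- On a finite-dimensional weight space the terms are dominated by a multiple of `c^N / N!`. -/
theorem summable_exp_of_weight_preserving {E : Module.End ℂ Fock}
    (hE : ∀ (f : Fock) m, (∀ m', wt m' = wt m → coeff m' f = 0) → coeff m (E f) = 0)
    (f : Fock) (m : ℕ+ →₀ ℕ) :
    Summable fun N : ℕ => (N ! : ℂ)⁻¹ * coeff m ((E ^ N) f) := by
  obtain ⟨c, hc, h⟩ := exists_bound_of_weight_preserving hE (wt m)
  set B := ∑ m' ∈ multiIndices (wt m), ‖coeff m' f‖ with hB
  have hpow : ∀ N : ℕ, ∑ m' ∈ multiIndices (wt m), ‖coeff m' ((E ^ N) f)‖ ≤ c ^ N * B := by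
    intro N
    induction N with
    | zero => simp [hB]
    | succ N ih =>
      rw [pow_succ', Module.End.mul_apply, pow_succ', mul_assoc]
      exact (h _).trans (mul_le_mul_of_nonneg_left ih hc)
  refine Summable.of_norm_bounded ((Real.summable_pow_div_factorial c).mul_right B) fun N => ?_
  rw [norm_mul, norm_inv, Complex.norm_natCast, div_mul_eq_mul_div, div_eq_inv_mul]
  refine mul_le_mul_of_nonneg_left ?_ (by positivity)
  exact (single_le_sum (f := fun m' => ‖coeff m' ((E ^ N) f)‖) (fun _ _ => norm_nonneg _)
    (mem_multiIndices.2 rfl)).trans (hpow N)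

theorem evolutionL_pow_apply (ht : Admissible u₀ ħ t) (N : ℕ) (f : Fock) :
    (evolutionL u₀ ħ t ht ^ N) f = (evolution u₀ ħ t)^[N] f := by
  rw [Module.End.pow_apply]
  rfl

theorem summable_potentialTerm (ht : Admissible u₀ ħ t) (m : ℕ+ →₀ ℕ) :
    Summable (potentialTerm u₀ ħ t m) := by
  have h := summable_exp_of_weight_preserving (E := evolutionL u₀ ħ t ht)
    (fun f m => coeff_evolutionL_eq_zero ht) (planeWave ħ) m
  simp only [evolutionL_pow_apply] at h
  exact h

theorem hasSum_diskPotential (ht : Admissible u₀ ħ t) :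
    HasSum (fun N : ℕ => (N ! : ℂ)⁻¹ • (evolutionL u₀ ħ t ht ^ N) (planeWave ħ))
      (diskPotential u₀ ħ t) :=
  hasSum_iff_hasSum_coeff.2 fun m => by
    simp only [map_smul, smul_eq_mul, evolutionL_pow_apply]
    exact (summable_potentialTerm ht m).hasSum

theorem kpBilinear_pairing_diskPotential {ε : ℂ} (hε : ε ≠ 0) (ht : Admissible u₀ (ε ^ 2) t)
    (h0 : kpBilinear (pairing ε (planeWave (ε ^ 2)) (planeWave (ε ^ 2))) = 0) :
    kpBilinear (pairing ε (diskPotential u₀ (ε ^ 2) t) (diskPotential u₀ (ε ^ 2) t)) = 0 := by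
  set v : ℕ → Fock := fun N => (N ! : ℂ)⁻¹ • (evolutionL u₀ (ε ^ 2) t ht ^ N) (planeWave (ε ^ 2))
    with hv
  have h := (hasSum_pairing_antidiagonal ε (f := v) (hasSum_diskPotential ht)).map kpBilinear
    continuous_kpBilinear
  have e : (kpBilinear ∘ fun N => ∑ x ∈ antidiagonal N, pairing ε (v x.1) (v x.2)) =
      fun _ => 0 := by
    funext N
    have h1 := congrArg (fun x => kpBilinear (pairingL ε x))
      (diagonalAction_pow_tmul (evolutionL u₀ (ε ^ 2) t ht) (planeWave (ε ^ 2)) N)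
    simp only [map_smul, kpBilinear_diagonalAction_pow hε ht
      (x := planeWave (ε ^ 2) ⊗ₜ planeWave (ε ^ 2)) h0, smul_zero] at h1
    rw [map_sum (pairingL ε)] at h1
    exact h1.symm
  rw [e] at h
  exact h.unique hasSum_zero

end Continuity

/-! ### The plane wave -/

theorem pderiv_expLin (c : ℕ+ → ℂ) (k : ℕ+) : pderiv ℂ k (expLin c) = c k • expLin c := by
  ext m
  rw [MvPowerSeries.coeff_pderiv, map_smul, smul_eq_mul, ← coeff_expLin_add_single, smul_eq_mul,
    mul_comm]
  push_cast
  rfl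

/-- In the product of the exponentials of `c·(x + εy)` and `c·(x - εy)` the variable `y` cancels. -/
theorem derivOuter_pairing_expLin (ε : ℂ) (c : ℕ+ → ℂ) (k : ℕ+) :
    derivOuter k (pairing ε (expLin c) (expLin c)) = 0 := by
  rw [pairing_apply, derivOuter_mul, derivOuter_shift, derivOuter_shift, pderiv_expLin]
  have h : ∀ r : ℂ, shift r (c k • expLin c) = c k • shift r (expLin c) := fun r =>
    map_smul (shiftL r) _ _
  rw [h, h, mul_smul_comm, mul_smul_comm, smul_mul_assoc, smul_mul_assoc, neg_smul, neg_add_cancel]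

theorem hop_succ_eq_zero {M : Type*} [AddCommGroup M] [Module ℂ M] {q : ℕ+ → Module.End ℂ M} {v : M}
    (h : ∀ k, q k v = 0) (n : ℕ) : hop q (n + 1) v = 0 := by
  -- The map `1 ↦ v` intertwines the zero operators on `ℂ` with the `q_k`, and `hop` of zero
  -- vanishes in positive degree.
  have h1 := intertwines_hop (T := LinearMap.toSpanSingleton ℂ M v) (q := 0) (q' := q)
    (fun k c => by simp [h]) (n + 1) 1
  rw [hop_zero_fun, if_neg n.succ_ne_zero] at h1
  simpa using h1.symm

theorem kpBilinear_pairing_planeWave (ε : ℂ) :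
    kpBilinear (pairing ε (planeWave (ε ^ 2)) (planeWave (ε ^ 2))) = 0 := by
  ext m n
  rw [coeff_kpBilinear]
  refine sum_eq_zero fun j _ => ?_
  rw [kpTerm, Module.End.mul_apply, hop_succ_eq_zero, map_zero]
  · rfl
  · intro k
    rw [LinearMap.smul_apply, planeWave, derivOuter_pairing_expLin, smul_zero]

end DiskSFT

end

noncomputable section

namespace DiskSFT

open Finset hiding mk antidiagonal mem_antidiagonal
open Finset.HasAntidiagonal hiding mk
open MvPowerSeries (coeff pderiv)

/-! ### Hirota bilinear expressions -/

theorem hirota_eq_sum {P : MvPolynomial ℕ+ ℂ} (τ : Fock) {s : Finset (ℕ+ →₀ ℕ)}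
    (h : P.support ⊆ s) : hirota P τ =
      ∑ a ∈ s, (MvPolynomial.coeff a P * (a.prod fun _ n => (n ! : ℂ))) •
        coeff a (shift 1 τ * shift (-1) τ) :=
  sum_subset h fun a _ ha => by rw [MvPolynomial.notMem_support_iff.1 ha, zero_mul, zero_smul]

/-- The Hirota bilinear expression as a linear function of the polynomial. -/
def hirotaL (τ : Fock) : MvPolynomial ℕ+ ℂ →ₗ[ℂ] Fock where
  toFun P := hirota P τ
  map_add' P Q := by
    classical
    rw [hirota_eq_sum τ MvPolynomial.support_add,
      hirota_eq_sum τ (subset_union_left (s₁ := P.support) (s₂ := Q.support)),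
      hirota_eq_sum τ (subset_union_right (s₁ := P.support) (s₂ := Q.support)), ← sum_add_distrib]
    exact sum_congr rfl fun a _ => by rw [MvPolynomial.coeff_add, add_mul, add_smul]
  map_smul' c P := by
    rw [hirota_eq_sum τ (MvPolynomial.support_smul (a := c) (f := P)), hirota, smul_sum]
    exact sum_congr rfl fun a _ => by
      rw [MvPolynomial.coeff_smul, smul_eq_mul, mul_assoc, mul_smul]; rfl

theorem hirotaL_monomial (τ : Fock) (a : ℕ+ →₀ ℕ) (c : ℂ) :
    hirotaL τ (MvPolynomial.monomial a c) =
      (c * (a.prod fun _ n => (n ! : ℂ))) • coeff a (shift 1 τ * shift (-1) τ) := by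
  refine (hirota_eq_sum τ MvPolynomial.support_monomial_subset).trans ?_
  rw [sum_singleton, MvPolynomial.coeff_monomial, if_pos rfl]

/-- The Hirota bilinear expressions of the coefficients of a power series. -/
def hirotaSeries (τ : Fock) : MvPowerSeries ℕ+ (MvPolynomial ℕ+ ℂ) →ₗ[ℂ] DoubleFock where
  toFun Q := fun m => hirotaL τ (coeff m Q)
  map_add' P Q := by
    ext m : 1
    exact (congrArg _ (map_add (coeff m) P Q)).trans (map_add (hirotaL τ) _ _)
  map_smul' c P := by
    ext m : 1
    exact (hirotaL τ).map_smul c (coeff m P)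

theorem coeff_hirotaSeries (τ : Fock) (Q : MvPowerSeries ℕ+ (MvPolynomial ℕ+ ℂ)) (m : ℕ+ →₀ ℕ) :
    coeff m (hirotaSeries τ Q) = hirotaL τ (coeff m Q) := rfl

theorem hirotaSeries_X_mul (τ : Fock) (k : ℕ+) (Q : MvPowerSeries ℕ+ (MvPolynomial ℕ+ ℂ)) :
    hirotaSeries τ (MvPowerSeries.X k * Q) = mulOuter k (hirotaSeries τ Q) := by
  ext m : 1
  rw [coeff_hirotaSeries, mulOuter_apply, coeff_X_mul, coeff_X_mul]
  split_ifs
  · exact map_zero _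
  · rfl

theorem coeff_expLin_smul_X (ε : ℂ) (a : ℕ+ →₀ ℕ) :
    coeff a (expLin fun k => ε • (MvPolynomial.X k : MvPolynomial ℕ+ ℂ)) =
      MvPolynomial.monomial a (a.prod fun _ n => ε ^ n / (n ! : ℂ)) := by
  rw [MvPolynomial.monomial_eq, Finsupp.prod, map_prod, Finsupp.prod, ← prod_mul_distrib]
  refine prod_congr rfl fun k _ => ?_
  change (_ : ℂ)⁻¹ • (ε • MvPolynomial.X k) ^ a k = _
  rw [smul_pow, smul_smul, MvPolynomial.smul_eq_C_mul, div_eq_inv_mul]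

theorem coeff_shift_mul (ε c : ℂ) (τ : Fock) (a : ℕ+ →₀ ℕ) :
    coeff a (shift (ε * c) τ) = (a.prod fun _ n => ε ^ n) • coeff a (shift c τ) := by
  rw [coeff_shift, coeff_shift, smul_smul, ← Finsupp.prod_mul]
  simp only [mul_pow, mul_div_assoc]

theorem coeff_pairing_self (ε : ℂ) (τ : Fock) (a : ℕ+ →₀ ℕ) :
    coeff a (pairing ε τ τ) =
      (a.prod fun _ n => ε ^ n) • coeff a (shift 1 τ * shift (-1) τ) := by
  classical
  rw [pairing_apply, MvPowerSeries.coeff_mul, MvPowerSeries.coeff_mul, smul_sum]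
  refine sum_congr rfl fun x hx => ?_
  have h1 := coeff_shift_mul ε 1 τ x.1
  have h2 := coeff_shift_mul ε (-1) τ x.2
  rw [mul_one] at h1
  rw [mul_neg_one] at h2
  rw [h1, h2, smul_mul_assoc, mul_smul_comm, smul_smul, ← mem_antidiagonal.1 hx,
    Finsupp.prod_add_index' (fun _ => pow_zero _) fun _ _ _ => pow_add _ _ _]

/-- Taylor's formula: applying `exp (ε ∑ y_k D_k)` to `τ·τ` replaces the auxiliary variable `q` by
`εy`. -/
theorem hirotaSeries_expLin (ε : ℂ) (τ : Fock) :
    hirotaSeries τ (expLin fun k => ε • MvPolynomial.X k) = pairing ε τ τ := by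
  ext a : 1
  rw [coeff_hirotaSeries, coeff_expLin_smul_X, hirotaL_monomial, coeff_pairing_self,
    ← Finsupp.prod_mul]
  congr 2
  funext k n
  exact div_mul_cancel₀ _ (by exact_mod_cast n.factorial_ne_zero)

/-- The bilinear expressions `P(D) exp (ε ∑_k y_k D_k) τ·τ`. -/
def hirotaExp (ε : ℂ) (τ : Fock) : MvPolynomial ℕ+ ℂ →ₗ[ℂ] DoubleFock where
  toFun P := hirotaSeries τ (MvPowerSeries.C P * expLin fun k => ε • MvPolynomial.X k)
  map_add' P Q := by rw [map_add, add_mul, map_add]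
  map_smul' c P := by
    rw [← map_smul (hirotaSeries τ), ← smul_mul_assoc]
    congr 2
    ext m : 1
    change _ = c • coeff m (MvPowerSeries.C P)
    rw [MvPowerSeries.coeff_C, MvPowerSeries.coeff_C]
    split_ifs
    · rfl
    · exact (smul_zero c).symm

theorem hirotaExp_apply (ε : ℂ) (τ : Fock) (P : MvPolynomial ℕ+ ℂ) : hirotaExp ε τ P =
    hirotaSeries τ (MvPowerSeries.C P * expLin fun k => ε • MvPolynomial.X k) := rfl

/-- Differentiating `exp (ε ∑ y_k D_k)` with respect to `y_k` brings down `ε D_k`; this converts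
Hirota polynomials into differential operators in `y`. -/
theorem hirotaExp_smul_X_mul (ε : ℂ) (τ : Fock) (k : ℕ+) (P : MvPolynomial ℕ+ ℂ) :
    hirotaExp ε τ ((ε • MvPolynomial.X k) * P) = derivOuter k (hirotaExp ε τ P) := by
  ext m : 1
  rw [hirotaExp_apply, coeff_hirotaSeries, MvPowerSeries.coeff_C_mul, derivOuter_apply,
    MvPowerSeries.coeff_pderiv, hirotaExp_apply, coeff_hirotaSeries, MvPowerSeries.coeff_C_mul,
    mul_comm (ε • _) P, mul_assoc,
    ← coeff_expLin_add_single (fun k => ε • (MvPolynomial.X k : MvPolynomial ℕ+ ℂ)) m k,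
    mul_smul_comm, map_smul, ← Nat.cast_succ, Nat.cast_smul_eq_nsmul, nsmul_eq_mul]
  exact mul_comm _ _

theorem hirotaExp_h (ε : ℂ) (τ : Fock) (n : ℕ) :
    hirotaExp ε τ (h n fun k => (ε * (k : ℂ)) • MvPolynomial.X k) =
      hop (fun k => ((k : ℕ) : ℂ) • derivOuter k) n (pairing ε τ τ) := by
  have h1 := intertwines_hop (T := hirotaExp ε τ)
    (q := fun k => Algebra.lmul ℂ _ ((ε * (k : ℂ)) • MvPolynomial.X k))
    (q' := fun k => ((k : ℕ) : ℂ) • derivOuter k) (fun k P => by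
      rw [Algebra.coe_lmul_eq_mul, LinearMap.mul_apply', mul_comm ε, mul_smul, smul_mul_assoc,
        map_smul, hirotaExp_smul_X_mul]
      rfl) n 1
  rw [← lmul_hop, Algebra.coe_lmul_eq_mul, LinearMap.mul_apply', mul_one, ← h_eq_hop,
    hirotaExp_apply ε τ 1, map_one, one_mul, hirotaSeries_expLin] at h1
  exact h1

theorem hirotaSeries_h_mul (τ : Fock) (n : ℕ) (Q : MvPowerSeries ℕ+ (MvPolynomial ℕ+ ℂ)) :
    hirotaSeries τ (h n (fun k => (-2 : ℂ) • MvPowerSeries.X k) * Q) =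
      hop (fun k => (-2 : ℂ) • mulOuter k) n (hirotaSeries τ Q) := by
  have h1 := intertwines_hop (T := hirotaSeries τ)
    (q := fun k => Algebra.lmul ℂ _ ((-2 : ℂ) • MvPowerSeries.X k))
    (q' := fun k => (-2 : ℂ) • mulOuter k) (fun k P => by
      rw [Algebra.coe_lmul_eq_mul, LinearMap.mul_apply', smul_mul_assoc, map_smul,
        hirotaSeries_X_mul]
      rfl) n Q
  rw [← lmul_hop, Algebra.coe_lmul_eq_mul, LinearMap.mul_apply', ← h_eq_hop] at h1
  exact h1

theorem hirota_kpOperator (ε : ℂ) (τ : Fock) (m : ℕ+ →₀ ℕ) :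
    hirota (kpOperator ε m) τ =
      ∑ j ∈ range (wt m + 1), coeff m (kpTerm j (pairing ε τ τ)) := by
  change hirotaL τ (kpOperator ε m) = _
  rw [kpOperator, map_sum]
  refine sum_congr rfl fun j _ => ?_
  rw [← coeff_hirotaSeries, mul_assoc, hirotaSeries_h_mul, ← hirotaExp_apply, hirotaExp_h]
  rfl

/-- The elements of order at least `N` in `y₁, y₂, …`. -/
def outerOrder (N : ℕ) : Submodule ℂ DoubleFock where
  carrier := {f | ∀ m, wt m < N → coeff m f = 0}
  add_mem' hf hg m hm := by rw [map_add, hf m hm, hg m hm, add_zero]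
  zero_mem' m _ := map_zero _
  smul_mem' c f hf m hm := by rw [coeff_const_smul_double, hf m hm, smul_zero]

theorem outerOrder_antitone : Antitone outerOrder := fun _ _ h _ hf m hm =>
  hf m (lt_of_lt_of_le hm h)

theorem outerOrder_zero : outerOrder 0 = ⊤ :=
  eq_top_iff.2 fun _ _ _ h => absurd h (Nat.not_lt_zero _)

theorem hasDegree_mulOuter_outerOrder (k : ℕ+) :
    HasDegree outerOrder (k : ℕ) (PowerSeries.C (mulOuter k)) :=
  HasDegree.C fun N N' f hN hf m hm => by
    rw [mulOuter_apply, coeff_X_mul]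
    split_ifs with h
    · rfl
    · have := wt_sub_single h
      exact hf _ (by omega)

/-- The sum in `kpOperator` is cut off by the weight in `y` alone, whereas `kpBilinear` uses the
total weight in `x` and `y`. Counting only `y` shows that the additional terms vanish. -/
theorem kpTerm_mem_outerOrder (j : ℕ) (f : DoubleFock) : kpTerm j f ∈ outerOrder j := by
  have h := HasDegree.hop (c := 1) outerOrder_antitone outerOrder_zero
    (q := fun k => PowerSeries.C ((-2 : ℂ) • mulOuter k)) (fun k => by
      rw [one_mul, C_const_smul]
      exact (hasDegree_mulOuter_outerOrder k).smul' _) j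
  rw [one_mul, ← C_hop] at h
  have h1 := h 0 0 j (hop (fun k => ((k : ℕ) : ℂ) • derivOuter k) (j + 1) f)
    (by simp) (outerOrder_zero ▸ Submodule.mem_top)
  rwa [PowerSeries.coeff_zero_C] at h1

theorem coeff_kpBilinear_pairing (ε : ℂ) (τ : Fock) (m : ℕ+ →₀ ℕ) :
    hirota (kpOperator ε m) τ = coeff m (kpBilinear (pairing ε τ τ)) := by
  ext n
  rw [hirota_kpOperator, coeff_kpBilinear, map_sum]
  refine sum_subset (range_subset_range.2 (by omega)) fun j _ hj => ?_
  rw [mem_range, not_lt] at hj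
  rw [kpTerm_mem_outerOrder j _ m (by omega), map_zero]

theorem satisfiesKP_iff (ε : ℂ) (τ : Fock) :
    SatisfiesKP ε τ ↔ kpBilinear (pairing ε τ τ) = 0 := by
  simp only [SatisfiesKP, coeff_kpBilinear_pairing, MvPowerSeries.ext_iff, map_zero]

end DiskSFT

end

theorem corollary1p6 (u₀ ε : ℂ) (hε : ε ≠ 0) (t : ℕ → ℂ)
    (ht : DiskSFT.Admissible u₀ (ε ^ 2) t) :
    (∀ m, Summable (DiskSFT.potentialTerm u₀ (ε ^ 2) t m)) ∧
      DiskSFT.SatisfiesKP ε (DiskSFT.diskPotential u₀ (ε ^ 2) t) :=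
  ⟨DiskSFT.summable_potentialTerm ht, (DiskSFT.satisfiesKP_iff _ _).2
    (DiskSFT.kpBilinear_pairing_diskPotential hε ht (DiskSFT.kpBilinear_pairing_planeWave ε))⟩
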